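/- Let $\mathbb F$ be a field, $\mathcal Q$ a finite quiver, $k=\mathbb F\mathcal Q_0$, $V=\mathbb F\mathcal Q_1$, $R$ a sub-$k$-bimodule of $V\otimes_kV\cong\mathbb F\mathcal Q_2$, and $A=T_k(V)/(R)$ the quadratic quiver algebra, graded by path length, with components $A_m$ ($A_m=0$ for $m<0$). Put $A^e=A\otimes_{\mathbb F}A^{op}$. Let $B(A)=(A\otimes_kA^{\otimes_k\bullet}\otimes_kA,d)$ be the bar resolution of $A$ relative to $k$, and let $K(A)$ be the Koszul bimodule complex, with $K(A)_p=A\otimes_kW_p\otimes_kA$, $W_0=k$, $W_1=V$, $W_p=\bigcap_{i+2+j=p}V^{\otimes_k i}\otimes_kR\otimes_kV^{\otimes_k j}$ for $p\ge2$ (so $W_2=R$), and $$d(a\otimes x_1\cdots x_p\otimes a')=ax_1\otimes x_2\cdots x_p\otimes a'+(-1)^pa\otimes x_1\cdots x_{p-1}\otimes x_pa'.$$ Let $\chi:K(A)\to B(A)$ be the inclusion. For an $A$-bimodule $M$ on which $\mathbb F$ acts symmetrically, $HK_\bullet(A,M)$ and $HK^\bullet(A,M)$ are the (co)homology spaces of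 $M\otimes_{A^e}K(A)$ and $\mathrm{Hom}_{A^e}(K(A),M)$; let $b^K_p$, $b_K^p$ be their differentials ($b^K_p$ goes out of degree $p$, $b_K^p$ goes into degree $p$). Replacing $K(A)$ by $B(A)$ gives $HH_\bullet(A,M)$ and $HH^\bullet(A,M)$. In the category of graded $A$-bimodules, $A$ has a minimal projective resolution. For any such resolution $(P,\delta)$ there is exactly one weight-preserving morphism of bimodule complexes $\iota:K(A)\to P$ lifting $\mathrm{id}_A$; the maps $\iota_0,\iota_1,\iota_2$ are isomorphisms; and there is a morphism of bimodule complexes $\varphi:P\to B(A)$ lifting $\mathrm{id}_A$. Write $\tilde\delta=M\otimes_{A^e}\delta$, $\delta^*=\mathrm{Hom}_{A^e}(\delta,M)$, and similarly $\tilde\iota,\iota^*,\tilde\varphi,\varphi^*,\tilde\chi,\chi^*$. **(1)** For every $A$-bimodule $M$, $H(\tilde\chi)_2:HK_2(A,M)\to HH_2(A,M)$ is surjective and $H(\chi^*)_2:HH^2(A,M)\to HK^2(A,M)$ is injective. Moreover, for all $P,\iota,\varphi$ as above: - $H(\tilde\varphi)_2$ and $H(\varphi^*)_2$ are isomorphisms,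 $H(\tilde\varphi)_2\circ H(\tilde\iota)_2=H(\tilde\chi)_2$ and $H(\iota^*)_2\circ H(\varphi^*)_2=H(\chi^*)_2$; that is, $H(\tilde\iota)_2$ and $H(\iota^*)_2$ are the comparison maps above when Hochschild (co)homology is computed with $P$. - $H(\tilde\iota)_2$ is surjective, and $z\mapsto[z]$ induces an isomorphism $\mathrm{Im}(\tilde\delta_3)/\mathrm{Im}(b^K_3)\cong\ker H(\tilde\iota)_2$, where $\mathrm{Im}(\tilde\delta_3)$ is seen in $M\otimes_{A^e}K(A)_2$ by means of the isomorphism $\tilde\iota_2$ (here $\tilde\delta_3$ goes out of degree 3). - $H(\iota^*)_2$ is injective, and $f\mapsto[f]$ induces an isomorphism $\ker(\delta^*_3)/\mathrm{Im}(b_K^2)\cong\mathrm{Im}\,H(\iota^*)_2$, where $\ker(\delta^*_3)$ is seen in $\mathrm{Hom}_{A^e}(K(A)_2,M)$ by means of the isomorphism $\iota^*_2$ (here $\delta^*_3$ goes into degree 3). **(2)** Let $M=A$. Let $HK_2(A)_r$ (resp. $HK^2(A)_r$) be the part of coefficient weight $r$, that is, the space of classes of cycles in $A_r\otimes_{k^e}R$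 (resp. of cocycles $R\to A_r$). Let $HH_2(A)_t$ (resp. $HH^2(A)_t$) be the part of total weight $t$, that is, the space of classes of cycles that are sums of $a\otimes z$ with $a\in A$, $z$ in the degree 2 term of the resolution, both homogeneous and with weights of sum $t$ (resp. of cocycles that send each element of weight $n$ of the degree 2 term to $A_{n+t}$). - If $r=0$ or $r=1$, then $H(\tilde\chi)_2$ restricts to a bijection from $HK_2(A)_r$ onto $HH_2(A)_{r+2}$. - If $A$ is finite dimensional, $\max$ is the largest $m$ with $A_m\ne0$, and $r=\max$ or $r=\max-1$, then $H(\chi^*)_2$ restricts to a bijection from $HH^2(A)_{r-2}$ onto $HK^2(A)_r$. Both statements also hold with $\chi$ replaced by $\iota:K(A)\to P$, for every minimal graded projective resolution $P$, with Hochschild (co)homology and its total weight computed on $P$. -/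

import Mathlib

open scoped TensorProduct
open MulOpposite

set_option linter.unusedSectionVars false
set_option linter.unusedVariables false

universe u v w x y

noncomputable section

namespace QuadraticQuiver

section PathAlgebra

/-- All paths of the quiver `Q`, each recorded with its source and its target. -/
abbrev PathIdx (Q : Type u) [Quiver.{v} Q] := Σ i j : Q, Quiver.Path i j

/-- All arrows of the quiver `Q`. -/
abbrev Arrow (Q : Type u) [Quiver.{v} Q] := Σ i j : Q, (i ⟶ j)

/-- The path algebra: the vector space with basis the paths of `Q`. -/
def PathAlg (F : Type w) (Q : Type u) [Field F] [Quiver.{v} Q] := PathIdx Q →₀ F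

variable (F : Type w) (Q : Type u) [Field F] [Quiver.{v} Q]

instance : AddCommGroup (PathAlg F Q) := inferInstanceAs (AddCommGroup (PathIdx Q →₀ F))
instance : Module F (PathAlg F Q) := inferInstanceAs (Module F (PathIdx Q →₀ F))

namespace PathAlg
variable {F Q}

/-- The basis element given by a path. -/
def of {i j : Q} (p : Quiver.Path i j) : PathAlg F Q :=
  Finsupp.single (⟨i, j, p⟩ : PathIdx Q) (1 : F)

/-- The linear map on the path algebra with prescribed values on paths. -/
def lift {N : Type*} [AddCommGroup N] [Module F N] (f : ∀ i j : Q, Quiver.Path i j → N) :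
    PathAlg F Q →ₗ[F] N :=
  Finsupp.linearCombination F (fun p : PathIdx Q => f p.1 p.2.1 p.2.2)

@[simp] theorem lift_of {N : Type*} [AddCommGroup N] [Module F N]
    (f : ∀ i j : Q, Quiver.Path i j → N) {i j : Q} (p : Quiver.Path i j) :
    lift f (of p : PathAlg F Q) = f i j p := by
  exact (Finsupp.linearCombination_single F (1 : F) (⟨i, j, p⟩ : PathIdx Q)).trans (one_smul F _)

theorem induction {P : PathAlg F Q → Prop} (x : PathAlg F Q) (zero : P 0)
    (add : ∀ x y, P x → P y → P (x + y)) (smul : ∀ (c : F) x, P x → P (c • x))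
    (of : ∀ (i j : Q) (p : Quiver.Path i j), P (of p)) : P x := by
  refine Finsupp.induction_linear (motive := P) x zero (fun f g hf hg => add f g hf hg) ?_
  rintro ⟨i, j, p⟩ c
  have h := smul c _ (of i j p)
  have h' : c • (PathAlg.of p : PathAlg F Q) = Finsupp.single (⟨i, j, p⟩ : PathIdx Q) c :=
    (Finsupp.smul_single c _ (1 : F)).trans (by rw [smul_eq_mul, mul_one])
  rwa [h'] at h

open Classical in
/-- The product of two paths: `p * q` is the path `q` followed by `p`
(paths are written from right to left), and `0` if they cannot be composed. -/
def pathMul {i j k l : Q} (p : Quiver.Path k l) (q : Quiver.Path i j) : PathAlg F Q :=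
  if h : j = k then of (q.comp (h ▸ p)) else 0

theorem pathMul_comp {i j l : Q} (p : Quiver.Path j l) (q : Quiver.Path i j) :
    (pathMul p q : PathAlg F Q) = of (q.comp p) := by
  simp [pathMul]

theorem pathMul_ne {i j k l : Q} (p : Quiver.Path k l) (q : Quiver.Path i j) (h : j ≠ k) :
    (pathMul p q : PathAlg F Q) = 0 := by
  simp [pathMul, h]

/-- The multiplication of the path algebra, as a bilinear map. -/
def mulHom : PathAlg F Q →ₗ[F] PathAlg F Q →ₗ[F] PathAlg F Q :=
  lift fun _ _ p => lift fun _ _ q => pathMul p q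

instance : Mul (PathAlg F Q) := ⟨fun x y => mulHom x y⟩

theorem mul_def (x y : PathAlg F Q) : x * y = mulHom x y := rfl

theorem of_mul_of {i j k l : Q} (p : Quiver.Path k l) (q : Quiver.Path i j) :
    (of p * of q : PathAlg F Q) = pathMul p q := by
  simp [mul_def, mulHom]

theorem of_mul_of_comp {i j l : Q} (p : Quiver.Path j l) (q : Quiver.Path i j) :
    (of p * of q : PathAlg F Q) = of (q.comp p) := by
  rw [of_mul_of, pathMul_comp]

theorem of_mul_of_ne {i j k l : Q} (p : Quiver.Path k l) (q : Quiver.Path i j) (h : j ≠ k) :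
    (of p * of q : PathAlg F Q) = 0 := by
  rw [of_mul_of, pathMul_ne _ _ h]

/-- The idempotent of a vertex. -/
def e (i : Q) : PathAlg F Q := of (Quiver.Path.nil : Quiver.Path i i)

variable [Fintype Q]

instance : One (PathAlg F Q) := ⟨∑ i : Q, e i⟩

theorem one_def : (1 : PathAlg F Q) = ∑ i : Q, e i := rfl

theorem e_mul_of {i j : Q} (p : Quiver.Path i j) : (e j * of p : PathAlg F Q) = of p := by
  rw [e, of_mul_of_comp, Quiver.Path.comp_nil]

theorem of_mul_e {i j : Q} (p : Quiver.Path i j) : (of p * e i : PathAlg F Q) = of p := by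
  rw [e, of_mul_of_comp, Quiver.Path.nil_comp]

instance : NonUnitalNonAssocRing (PathAlg F Q) where
  left_distrib x y z := (mulHom x).map_add y z
  right_distrib x y z := by simp [mul_def]
  zero_mul x := by simp [mul_def]
  mul_zero x := (mulHom x).map_zero

instance : IsScalarTower F (PathAlg F Q) (PathAlg F Q) :=
  ⟨fun c x y => by simp [mul_def]⟩

instance : SMulCommClass F (PathAlg F Q) (PathAlg F Q) :=
  ⟨fun c x y => by simp [mul_def]⟩

theorem of_mul_assoc {i j k l m n : Q} (p : Quiver.Path m n) (q : Quiver.Path k l)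
    (r : Quiver.Path i j) : (of p * of q * of r : PathAlg F Q) = of p * (of q * of r) := by
  by_cases h : l = m <;> by_cases h' : j = k
  · subst h h'
    simp only [of_mul_of_comp, Quiver.Path.comp_assoc]
  · subst h
    rw [of_mul_of_comp, of_mul_of_ne _ _ h', of_mul_of_ne _ _ h', mul_zero]
  · subst h'
    rw [of_mul_of_comp, of_mul_of_ne _ _ h, of_mul_of_ne _ _ h, zero_mul]
  · rw [of_mul_of_ne _ _ h, of_mul_of_ne _ _ h', zero_mul, mul_zero]

instance : Ring (PathAlg F Q) where
  __ := (inferInstance : NonUnitalNonAssocRing (PathAlg F Q))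
  mul_assoc x y z := by
    induction x using induction with
    | zero => simp only [zero_mul]
    | add x x' hx hx' => simp only [add_mul, hx, hx']
    | smul c x hx => simp only [smul_mul_assoc, hx]
    | of i j p =>
    induction y using induction with
    | zero => simp only [zero_mul, mul_zero]
    | add x x' hx hx' => simp only [add_mul, mul_add, hx, hx']
    | smul c x hx => simp only [smul_mul_assoc, mul_smul_comm, hx]
    | of k l q =>
    induction z using induction with
    | zero => simp only [mul_zero]
    | add x x' hx hx' => simp only [mul_add, hx, hx']
    | smul c x hx => simp only [mul_smul_comm, hx]
    | of m n r => exact of_mul_assoc p q r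
  one_mul x := by
    induction x using induction with
    | zero => simp only [mul_zero]
    | add x x' hx hx' => simp only [mul_add, hx, hx']
    | smul c x hx => simp only [mul_smul_comm, hx]
    | of i j p =>
      rw [one_def, Finset.sum_mul, Finset.sum_eq_single j, e_mul_of]
      · intro k _ hk
        exact of_mul_of_ne _ _ hk.symm
      · simp
  mul_one x := by
    induction x using induction with
    | zero => simp only [zero_mul]
    | add x x' hx hx' => simp only [add_mul, hx, hx']
    | smul c x hx => simp only [smul_mul_assoc, hx]
    | of i j p =>
      rw [one_def, Finset.mul_sum, Finset.sum_eq_single i, of_mul_e]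
      · intro k _ hk
        exact of_mul_of_ne _ _ hk
      · simp

instance : Algebra F (PathAlg F Q) :=
  Algebra.ofModule (fun c x y => smul_mul_assoc c x y) (fun c x y => mul_smul_comm c x y)

/-- The span `F Q_m` of the paths of length `m`; it is identified with `V^{⊗ m}`. -/
def wt (m : ℕ) : Submodule F (PathAlg F Q) :=
  Submodule.span F {x | ∃ (i j : Q) (p : Quiver.Path i j), p.length = m ∧ x = of p}

theorem of_mem_wt {i j : Q} (p : Quiver.Path i j) : (of p : PathAlg F Q) ∈ wt p.length :=
  Submodule.subset_span ⟨i, j, p, rfl, rfl⟩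

theorem wt_induction {m : ℕ} {P : PathAlg F Q → Prop} {x : PathAlg F Q} (hx : x ∈ wt m)
    (zero : P 0) (add : ∀ x y, P x → P y → P (x + y)) (smul : ∀ (c : F) x, P x → P (c • x))
    (of : ∀ (i j : Q) (p : Quiver.Path i j), p.length = m → P (of p)) : P x := by
  refine Submodule.span_induction ?_ zero (fun x y _ _ => add x y) (fun c x _ => smul c x) hx
  rintro _ ⟨i, j, p, hp, rfl⟩
  exact of i j p hp

theorem wt_mul_le (m n : ℕ) : (wt m * wt n : Submodule F (PathAlg F Q)) ≤ wt (m + n) := by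
  rw [Submodule.mul_le]
  intro x hx y hy
  refine wt_induction (P := fun x => x * y ∈ wt (m + n)) hx (by simp) (fun x x' h h' => by rw [add_mul]; exact add_mem h h')
    (fun c x h => by rw [smul_mul_assoc]; exact Submodule.smul_mem _ c h) ?_
  intro k l p hp
  refine wt_induction (P := fun y => of p * y ∈ wt (m + n)) hy (by simp) (fun x x' h h' => by rw [mul_add]; exact add_mem h h')
    (fun c x h => by rw [mul_smul_comm]; exact Submodule.smul_mem _ c h) ?_
  intro i j q hq
  by_cases h : j = k
  · subst h
    rw [of_mul_of_comp]
    have := of_mem_wt (F := F) (q.comp p)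
    rwa [Quiver.Path.length_comp, hp, hq, add_comm] at this
  · rw [of_mul_of_ne _ _ h]; exact zero_mem _

open Classical in
/-- Left division by the arrow `a`: the map sending a path `a q` to `q`, and every path that does
not end with the arrow `a` (that is, whose leftmost arrow is not `a`) to `0`. -/
def leftDiv (a : Arrow Q) : PathAlg F Q →ₗ[F] PathAlg F Q :=
  lift fun i _ p => match p with
    | .nil => 0
    | .cons (b := j) (c := k) q b => if (⟨j, k, b⟩ : Arrow Q) = a then of q else 0

/-- Splitting off the first arrow of a path. -/
def splitFirst {i : Q} : ∀ {j : Q}, Quiver.Path i j → Option (Σ k : Q, (i ⟶ k) × Quiver.Path k j)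
  | _, .nil => none
  | j, .cons .nil b => some ⟨j, b, .nil⟩
  | _, .cons (.cons q c) b =>
    (splitFirst (.cons q c)).map fun s => ⟨s.1, s.2.1, s.2.2.cons b⟩

open Classical in
/-- Right division by the arrow `a`: the map sending a path `q a` to `q`, and every path that does
not start with the arrow `a` (that is, whose rightmost arrow is not `a`) to `0`. -/
def rightDiv (a : Arrow Q) : PathAlg F Q →ₗ[F] PathAlg F Q :=
  lift fun i _ p => match splitFirst p with
    | none => 0
    | some ⟨k, b, q⟩ => if (⟨i, k, b⟩ : Arrow Q) = a then of q else 0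

theorem splitFirst_comp {i j k : Q} (a : i ⟶ k) (q : Quiver.Path k j) :
    splitFirst (a.toPath.comp q) = some ⟨k, a, q⟩ := by
  induction q with
  | nil => rfl
  | cons q b ih =>
    rw [Quiver.Path.comp_cons]
    generalize a.toPath.comp q = p at ih
    cases p with
    | nil => simp [splitFirst] at ih
    | cons p c => simp [splitFirst, ih]

open Classical in
theorem leftDiv_cons (a : Arrow Q) {i j k : Q} (q : Quiver.Path i j) (b : j ⟶ k) :
    leftDiv a (of (q.cons b) : PathAlg F Q) = if (⟨j, k, b⟩ : Arrow Q) = a then of q else 0 := by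
  rw [leftDiv, lift_of]

theorem leftDiv_nil (a : Arrow Q) (i : Q) :
    leftDiv a (of (.nil : Quiver.Path i i) : PathAlg F Q) = 0 := by
  rw [leftDiv, lift_of]

open Classical in
theorem rightDiv_comp (a : Arrow Q) {i j k : Q} (b : i ⟶ k) (q : Quiver.Path k j) :
    rightDiv a (of (b.toPath.comp q) : PathAlg F Q) =
      if (⟨i, k, b⟩ : Arrow Q) = a then of q else 0 := by
  rw [rightDiv, lift_of, splitFirst_comp]

theorem rightDiv_nil (a : Arrow Q) (i : Q) :
    rightDiv a (of (.nil : Quiver.Path i i) : PathAlg F Q) = 0 := by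
  rw [rightDiv, lift_of]; rfl

theorem exists_cons {i j : Q} (p : Quiver.Path i j) {n : ℕ} (h : p.length = n + 1) :
    ∃ (k : Q) (q : Quiver.Path i k) (b : k ⟶ j), p = q.cons b ∧ q.length = n := by
  cases p with
  | nil => simp at h
  | cons q b => exact ⟨_, q, b, rfl, by simpa using h⟩

theorem exists_comp {i j : Q} (p : Quiver.Path i j) {n : ℕ} (h : p.length = n + 1) :
    ∃ (k : Q) (b : i ⟶ k) (q : Quiver.Path k j), p = b.toPath.comp q ∧ q.length = n := by
  obtain ⟨k, b, q, h1, h2⟩ := Quiver.Path.eq_toPath_comp_of_length_eq_succ p h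
  exact ⟨k, b, q, h2, h1⟩

theorem leftDiv_mem (a : Arrow Q) {n : ℕ} {x : PathAlg F Q} (hx : x ∈ wt (n + 1)) :
    leftDiv a x ∈ wt n := by
  refine wt_induction (P := fun x => leftDiv a x ∈ wt n) hx (by simp)
    (fun x x' h h' => by rw [map_add]; exact add_mem h h')
    (fun c x h => by rw [map_smul]; exact Submodule.smul_mem _ c h) ?_
  intro i j p hp
  obtain ⟨k, q, b, rfl, hq⟩ := exists_cons p hp
  rw [leftDiv_cons]
  split
  · rw [← hq]; exact of_mem_wt q
  · exact zero_mem _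

theorem rightDiv_mem (a : Arrow Q) {n : ℕ} {x : PathAlg F Q} (hx : x ∈ wt (n + 1)) :
    rightDiv a x ∈ wt n := by
  refine wt_induction (P := fun x => rightDiv a x ∈ wt n) hx (by simp)
    (fun x x' h h' => by rw [map_add]; exact add_mem h h')
    (fun c x h => by rw [map_smul]; exact Submodule.smul_mem _ c h) ?_
  intro i j p hp
  obtain ⟨k, b, q, rfl, hq⟩ := exists_comp p hp
  rw [rightDiv_comp]
  split
  · rw [← hq]; exact of_mem_wt q
  · exact zero_mem _

theorem leftDiv_mul (a : Arrow Q) {n : ℕ} {x : PathAlg F Q} (hx : x ∈ wt (n + 1))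
    (y : PathAlg F Q) : leftDiv a (x * y) = leftDiv a x * y := by
  refine wt_induction (P := fun x => leftDiv a (x * y) = leftDiv a x * y) hx (by simp)
    (fun x x' h h' => by simp only [add_mul, map_add, h, h'])
    (fun c x h => by simp only [smul_mul_assoc, map_smul, h]) ?_
  intro i j p hp
  obtain ⟨k, q, b, rfl, hq⟩ := exists_cons p hp
  induction y using induction with
  | zero => simp
  | add x x' hx hx' => simp only [mul_add, map_add, hx, hx']
  | smul c x hx => simp only [mul_smul_comm, map_smul, hx]
  | of l m r =>
    by_cases h : m = i
    · subst h
      rw [of_mul_of_comp, Quiver.Path.comp_cons, leftDiv_cons, leftDiv_cons, ite_mul, zero_mul,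
        of_mul_of_comp]
    · rw [of_mul_of_ne _ _ h, leftDiv_cons, ite_mul, zero_mul, of_mul_of_ne _ _ h]; simp

theorem rightDiv_mul (a : Arrow Q) {n : ℕ} {x : PathAlg F Q} (hx : x ∈ wt (n + 1))
    (y : PathAlg F Q) : rightDiv a (y * x) = y * rightDiv a x := by
  refine wt_induction (P := fun x => rightDiv a (y * x) = y * rightDiv a x) hx (by simp)
    (fun x x' h h' => by simp only [mul_add, map_add, h, h'])
    (fun c x h => by simp only [mul_smul_comm, map_smul, h]) ?_
  intro i j p hp
  obtain ⟨k, b, q, rfl, hq⟩ := exists_comp p hp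
  induction y using induction with
  | zero => simp
  | add x x' hx hx' => simp only [add_mul, map_add, hx, hx']
  | smul c x hx => simp only [smul_mul_assoc, map_smul, hx]
  | of l m r =>
    by_cases h : j = l
    · subst h
      rw [of_mul_of_comp, Quiver.Path.comp_assoc, rightDiv_comp, rightDiv_comp, mul_ite, mul_zero,
        of_mul_of_comp]
    · rw [of_mul_of_ne _ _ h, rightDiv_comp, mul_ite, mul_zero, of_mul_of_ne _ _ h]; simp

theorem leftDiv_rightDiv (a c : Arrow Q) {n : ℕ} {x : PathAlg F Q} (hx : x ∈ wt (n + 2)) :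
    leftDiv a (rightDiv c x) = rightDiv c (leftDiv a x) := by
  refine wt_induction (P := fun x => leftDiv a (rightDiv c x) = rightDiv c (leftDiv a x)) hx
    (by simp) (fun x x' h h' => by simp only [map_add, h, h'])
    (fun c x h => by simp only [map_smul, h]) ?_
  intro i j p hp
  obtain ⟨k, b, q, rfl, hq⟩ := exists_comp p hp
  obtain ⟨l, r, d, rfl, hr⟩ := exists_cons q hq
  have h1 : (of (b.toPath.comp (r.cons d)) : PathAlg F Q) = of d.toPath * of r * of b.toPath := by
    rw [of_mul_of_comp, of_mul_of_comp]; rfl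
  have hd : (of d.toPath : PathAlg F Q) ∈ wt (0 + 1) := of_mem_wt d.toPath
  have hb : (of b.toPath : PathAlg F Q) ∈ wt (0 + 1) := of_mem_wt b.toPath
  rw [h1, rightDiv_mul c hb, mul_assoc, mul_assoc, leftDiv_mul a hd, leftDiv_mul a hd, ← mul_assoc,
    ← mul_assoc, rightDiv_mul c hb]

/-- The basis element given by an arrow. -/
def arr (a : Arrow Q) : PathAlg F Q := of a.2.2.toPath

theorem arr_mem (a : Arrow Q) : (arr a : PathAlg F Q) ∈ wt 1 := of_mem_wt a.2.2.toPath

theorem e_mem (i : Q) : (e i : PathAlg F Q) ∈ wt 0 := of_mem_wt (.nil : Quiver.Path i i)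

section Sums

variable [∀ i j : Q, Fintype (i ⟶ j)] {N : Type*} [AddCommGroup N] [Module F N]

theorem sum_leftDiv_cons (B : PathAlg F Q →ₗ[F] PathAlg F Q →ₗ[F] N) {i j k : Q}
    (q : Quiver.Path i j) (b : j ⟶ k) :
    ∑ a : Arrow Q, B (arr a) (leftDiv a (of (q.cons b))) = B (of b.toPath) (of q) := by
  rw [Finset.sum_eq_single (⟨j, k, b⟩ : Arrow Q), leftDiv_cons, if_pos rfl]
  · rfl
  · intro a _ ha
    rw [leftDiv_cons, if_neg (Ne.symm ha), map_zero]
  · simp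

theorem sum_rightDiv_comp (B : PathAlg F Q →ₗ[F] PathAlg F Q →ₗ[F] N) {i j k : Q}
    (b : i ⟶ k) (q : Quiver.Path k j) :
    ∑ a : Arrow Q, B (rightDiv a (of (b.toPath.comp q))) (arr a) = B (of q) (of b.toPath) := by
  rw [Finset.sum_eq_single (⟨i, k, b⟩ : Arrow Q), rightDiv_comp, if_pos rfl]
  · rfl
  · intro a _ ha
    rw [rightDiv_comp, if_neg (Ne.symm ha), map_zero, LinearMap.zero_apply]
  · simp

theorem sum_arr_mul_leftDiv {n : ℕ} {x : PathAlg F Q} (hx : x ∈ wt (n + 1)) :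
    ∑ a : Arrow Q, arr a * leftDiv a x = x := by
  refine wt_induction (P := fun x => ∑ a : Arrow Q, arr a * leftDiv a x = x) hx (by simp)
    (fun x x' h h' => by simp only [map_add, mul_add, Finset.sum_add_distrib, h, h'])
    (fun c x h => by simp only [map_smul, mul_smul_comm, ← Finset.smul_sum, h]) ?_
  intro i j p hp
  obtain ⟨k, q, b, rfl, hq⟩ := exists_cons p hp
  exact (sum_leftDiv_cons (LinearMap.mul F (PathAlg F Q)) q b).trans (of_mul_of_comp _ _)

theorem sum_rightDiv_mul_arr {n : ℕ} {x : PathAlg F Q} (hx : x ∈ wt (n + 1)) :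
    ∑ a : Arrow Q, rightDiv a x * arr a = x := by
  refine wt_induction (P := fun x => ∑ a : Arrow Q, rightDiv a x * arr a = x) hx (by simp)
    (fun x x' h h' => by simp only [map_add, add_mul, Finset.sum_add_distrib, h, h'])
    (fun c x h => by simp only [map_smul, smul_mul_assoc, ← Finset.smul_sum, h]) ?_
  intro i j p hp
  obtain ⟨k, b, q, rfl, hq⟩ := exists_comp p hp
  exact (sum_rightDiv_comp (LinearMap.mul F (PathAlg F Q)) b q).trans (of_mul_of_comp _ _)

theorem sum_leftDiv_vertex_mul (B : PathAlg F Q →ₗ[F] PathAlg F Q →ₗ[F] N) {n : ℕ}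
    {l x : PathAlg F Q} (hl : l ∈ wt 0) (hx : x ∈ wt (n + 1)) :
    ∑ a : Arrow Q, B (arr a) (leftDiv a (l * x)) = ∑ a : Arrow Q, B (l * arr a) (leftDiv a x) := by
  refine wt_induction (P := fun x => ∑ a : Arrow Q, B (arr a) (leftDiv a (l * x)) =
      ∑ a : Arrow Q, B (l * arr a) (leftDiv a x)) hx (by simp)
    (fun x x' h h' => by simp only [map_add, mul_add, Finset.sum_add_distrib, h, h'])
    (fun c x h => by simp only [map_smul, mul_smul_comm, ← Finset.smul_sum, h]) ?_
  intro i j p hp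
  obtain ⟨k, q, b, rfl, hq⟩ := exists_cons p hp
  refine wt_induction (P := fun l => ∑ a : Arrow Q, B (arr a) (leftDiv a (l * of (q.cons b))) =
      ∑ a : Arrow Q, B (l * arr a) (leftDiv a (of (q.cons b)))) hl (by simp)
    (fun x x' h h' => by
      simp only [map_add, add_mul, LinearMap.add_apply, Finset.sum_add_distrib, h, h'])
    (fun c x h => by
      simp only [map_smul, smul_mul_assoc, LinearMap.smul_apply, ← Finset.smul_sum, h]) ?_
  intro r s p' hp'
  cases p' with
  | cons => simp at hp'
  | nil =>
    have h2 := sum_leftDiv_cons (B ∘ₗ LinearMap.mulLeft F (of (.nil : Quiver.Path r r))) q b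
    simp only [LinearMap.comp_apply, LinearMap.mulLeft_apply] at h2
    rw [h2]
    by_cases h : j = r
    · subst h
      have h3 : (of (.nil : Quiver.Path j j) * of (q.cons b) : PathAlg F Q) = of (q.cons b) :=
        of_mul_of_comp _ _
      have h4 : (of (.nil : Quiver.Path j j) * of b.toPath : PathAlg F Q) = of b.toPath :=
        of_mul_of_comp _ _
      rw [h3, h4, sum_leftDiv_cons]
    · rw [of_mul_of_ne _ _ h, of_mul_of_ne _ _ h]; simp

theorem sum_rightDiv_mul_vertex (B : PathAlg F Q →ₗ[F] PathAlg F Q →ₗ[F] N) {n : ℕ}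
    {l x : PathAlg F Q} (hl : l ∈ wt 0) (hx : x ∈ wt (n + 1)) :
    ∑ a : Arrow Q, B (rightDiv a (x * l)) (arr a) =
      ∑ a : Arrow Q, B (rightDiv a x) (arr a * l) := by
  refine wt_induction (P := fun x => ∑ a : Arrow Q, B (rightDiv a (x * l)) (arr a) =
      ∑ a : Arrow Q, B (rightDiv a x) (arr a * l)) hx (by simp)
    (fun x x' h h' => by
      simp only [map_add, add_mul, LinearMap.add_apply, Finset.sum_add_distrib, h, h'])
    (fun c x h => by
      simp only [map_smul, smul_mul_assoc, LinearMap.smul_apply, ← Finset.smul_sum, h]) ?_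
  intro i j p hp
  obtain ⟨k, b, q, rfl, hq⟩ := exists_comp p hp
  refine wt_induction
    (P := fun l => ∑ a : Arrow Q, B (rightDiv a (of (b.toPath.comp q) * l)) (arr a) =
      ∑ a : Arrow Q, B (rightDiv a (of (b.toPath.comp q))) (arr a * l)) hl (by simp)
    (fun x x' h h' => by
      simp only [map_add, mul_add, LinearMap.add_apply, Finset.sum_add_distrib, h, h'])
    (fun c x h => by
      simp only [map_smul, mul_smul_comm, LinearMap.smul_apply, ← Finset.smul_sum, h]) ?_
  intro r s p' hp'
  cases p' with
  | cons => simp at hp'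
  | nil =>
    have h2 := sum_rightDiv_comp
      (B.compl₂ (LinearMap.mulRight F (of (.nil : Quiver.Path r r)))) b q
    simp only [LinearMap.compl₂_apply, LinearMap.mulRight_apply] at h2
    rw [h2]
    by_cases h : r = i
    · subst h
      have h3 : (of (b.toPath.comp q) * of (.nil : Quiver.Path r r) : PathAlg F Q) =
        of (b.toPath.comp q) := of_mul_e _
      have h4 : (of b.toPath * of (.nil : Quiver.Path r r) : PathAlg F Q) = of b.toPath :=
        of_mul_e _
      rw [h3, h4, sum_rightDiv_comp]
    · rw [of_mul_of_ne _ _ h, of_mul_of_ne _ _ h]; simp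

theorem sum_vertex_right (B : PathAlg F Q →ₗ[F] PathAlg F Q →ₗ[F] N) {i j : Q}
    (p : Quiver.Path i j) : ∑ k : Q, B (of p * e k) (e k) = B (of p) (e i) := by
  rw [Finset.sum_eq_single i, of_mul_e]
  · intro k _ hk
    rw [e, of_mul_of_ne _ _ hk]; simp
  · simp

theorem sum_vertex_left (B : PathAlg F Q →ₗ[F] PathAlg F Q →ₗ[F] N) {i j : Q}
    (p : Quiver.Path i j) : ∑ k : Q, B (e k) (e k * of p) = B (e j) (of p) := by
  rw [Finset.sum_eq_single j, e_mul_of]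
  · intro k _ hk
    rw [e, of_mul_of_ne _ _ hk.symm]; simp
  · simp

theorem sum_leftDiv_leftDiv (B : PathAlg F Q →ₗ[F] PathAlg F Q →ₗ[F] N) {x : PathAlg F Q}
    (hx : x ∈ wt 2) :
    ∑ a : Arrow Q, ∑ c : Arrow Q, B (arr a * arr c) (leftDiv c (leftDiv a x)) =
      ∑ k : Q, B (x * e k) (e k) := by
  refine wt_induction (P := fun x => ∑ a : Arrow Q, ∑ c : Arrow Q,
      B (arr a * arr c) (leftDiv c (leftDiv a x)) = ∑ k : Q, B (x * e k) (e k)) hx (by simp)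
    (fun x x' h h' => by
      simp only [map_add, add_mul, LinearMap.add_apply, Finset.sum_add_distrib, h, h'])
    (fun c x h => by
      simp only [map_smul, smul_mul_assoc, LinearMap.smul_apply, ← Finset.smul_sum, h]) ?_
  intro i j p hp
  obtain ⟨k, q, b, rfl, hq⟩ := exists_cons p hp
  obtain ⟨l, r, d, rfl, hr⟩ := exists_cons q hq
  cases r with
  | cons => simp at hr
  | nil =>
    rw [sum_vertex_right, Finset.sum_comm]
    have h (c : Arrow Q) : ∑ a : Arrow Q, B (arr a * arr c)
        (leftDiv c (leftDiv a (of ((Quiver.Path.nil.cons d).cons b)))) =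
        B (of b.toPath * arr c) (leftDiv c (of (Quiver.Path.nil.cons d))) :=
      sum_leftDiv_cons ((B ∘ₗ LinearMap.mulRight F (arr c)).compl₂ (leftDiv c)) _ b
    simp only [h]
    refine (sum_leftDiv_cons (B ∘ₗ LinearMap.mulLeft F (of b.toPath)) .nil d).trans ?_
    simp only [LinearMap.comp_apply, LinearMap.mulLeft_apply, of_mul_of_comp]
    rfl

theorem sum_rightDiv_rightDiv (B : PathAlg F Q →ₗ[F] PathAlg F Q →ₗ[F] N) {x : PathAlg F Q}
    (hx : x ∈ wt 2) :
    ∑ a : Arrow Q, ∑ c : Arrow Q, B (rightDiv c (rightDiv a x)) (arr c * arr a) =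
      ∑ k : Q, B (e k) (e k * x) := by
  refine wt_induction (P := fun x => ∑ a : Arrow Q, ∑ c : Arrow Q,
      B (rightDiv c (rightDiv a x)) (arr c * arr a) = ∑ k : Q, B (e k) (e k * x)) hx (by simp)
    (fun x x' h h' => by
      simp only [map_add, mul_add, LinearMap.add_apply, Finset.sum_add_distrib, h, h'])
    (fun c x h => by
      simp only [map_smul, mul_smul_comm, LinearMap.smul_apply, ← Finset.smul_sum, h]) ?_
  intro i j p hp
  obtain ⟨k, b, q, rfl, hq⟩ := exists_comp p hp
  obtain ⟨l, d, r, rfl, hr⟩ := exists_comp q hq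
  cases r with
  | cons => simp at hr
  | nil =>
    rw [sum_vertex_left, Finset.sum_comm]
    have h (c : Arrow Q) : ∑ a : Arrow Q,
        B (rightDiv c (rightDiv a (of (b.toPath.comp (d.toPath.comp .nil))))) (arr c * arr a) =
        B (rightDiv c (of (d.toPath.comp .nil))) (arr c * of b.toPath) :=
      sum_rightDiv_comp ((B ∘ₗ rightDiv c).compl₂ (LinearMap.mulLeft F (arr c))) b _
    simp only [h]
    refine (sum_rightDiv_comp (B.compl₂ (LinearMap.mulRight F (of b.toPath))) d .nil).trans ?_
    simp only [LinearMap.compl₂_apply, LinearMap.mulRight_apply, of_mul_of_comp]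
    rfl

end Sums

end PathAlg
end PathAlgebra

section Bimodules

variable (F : Type w) (A : Type x) [Field F] [Ring A] [Algebra F A]

/-- The enveloping algebra `A ⊗ Aᵒᵖ`. An `A`-bimodule on which `F` acts symmetrically is the same
thing as a module over it: `Env.tmul a b • m` is `a m b`. -/
def Env := A ⊗[F] Aᵐᵒᵖ

instance : Ring (Env F A) := inferInstanceAs (Ring (A ⊗[F] Aᵐᵒᵖ))
instance : Algebra F (Env F A) := inferInstanceAs (Algebra F (A ⊗[F] Aᵐᵒᵖ))

/-- The element `a ⊗ b` of the enveloping algebra. -/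
def Env.tmul {A : Type x} [Ring A] [Algebra F A] (a b : A) : Env F A :=
  (a ⊗ₜ[F] op b : A ⊗[F] Aᵐᵒᵖ)

/-- The bimodule `A`, with action `a x b = a * x * b`. -/
instance instEnvModule : Module (Env F A) A :=
  Module.compHom A (AlgHom.mulLeftRight F A).toRingHom

variable {F A}

/-- The element `a ⊗ 1`, which gives the left action of `a` on a bimodule. -/
abbrev lact (a : A) : Env F A := Env.tmul F a 1

/-- The element `1 ⊗ a`, which gives the right action of `a` on a bimodule. -/
abbrev ract (a : A) : Env F A := Env.tmul F 1 a

namespace Env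

theorem tmul_mul_tmul (a b c d : A) : tmul F a b * tmul F c d = tmul F (a * c) (d * b) :=
  Algebra.TensorProduct.tmul_mul_tmul a c (op b) (op d)

theorem tmul_one_one : tmul F (1 : A) 1 = 1 := rfl

theorem tmul_add_left (a a' b : A) : tmul F (a + a') b = tmul F a b + tmul F a' b :=
  TensorProduct.add_tmul a a' (op b)

theorem tmul_add_right (a b b' : A) : tmul F a (b + b') = tmul F a b + tmul F a b' :=
  TensorProduct.tmul_add a (op b) (op b')

theorem tmul_smul_left (c : F) (a b : A) : tmul F (c • a) b = c • tmul F a b :=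
  (TensorProduct.smul_tmul' c a (op b)).symm

theorem tmul_smul_right (c : F) (a b : A) : tmul F a (c • b) = c • tmul F a b :=
  TensorProduct.tmul_smul c a (op b)

theorem tmul_zero_left (b : A) : tmul F 0 b = 0 := TensorProduct.zero_tmul _ (op b)

theorem tmul_zero_right (a : A) : tmul F a 0 = 0 := TensorProduct.tmul_zero _ a

@[elab_as_elim]
theorem induction {P : Env F A → Prop} (s : Env F A)
    (add : ∀ s t, P s → P t → P (s + t)) (tmul : ∀ a b : A, P (tmul F a b)) : P s := by
  refine TensorProduct.induction_on (motive := P) s ?_ (fun a b => tmul a b.unop)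
    (fun s t hs ht => add s t hs ht)
  have h := tmul 0 0
  rwa [tmul_zero_left] at h

theorem lact_mul (a b : A) : (lact (a * b) : Env F A) = lact a * lact b := by
  rw [tmul_mul_tmul, one_mul]

theorem ract_mul (a b : A) : (ract (a * b) : Env F A) = ract b * ract a := by
  rw [tmul_mul_tmul, one_mul]

theorem lact_mul_ract (a b : A) : (lact a * ract b : Env F A) = tmul F a b := by
  rw [tmul_mul_tmul, mul_one, mul_one]

theorem ract_mul_lact (a b : A) : (ract b * lact a : Env F A) = tmul F a b := by
  rw [tmul_mul_tmul, one_mul, one_mul]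

variable (F A) in
/-- The left action of `A`, as an algebra homomorphism. -/
def lactHom : A →ₐ[F] Env F A :=
  (Algebra.TensorProduct.includeLeft : A →ₐ[F] A ⊗[F] Aᵐᵒᵖ)

theorem lactHom_apply (a : A) : lactHom F A a = lact a := rfl

variable (F A) in
/-- The right action of `A`, as an algebra homomorphism. -/
def ractHom : Aᵐᵒᵖ →ₐ[F] Env F A :=
  (Algebra.TensorProduct.includeRight : Aᵐᵒᵖ →ₐ[F] A ⊗[F] Aᵐᵒᵖ)

theorem ractHom_apply (a : A) : ractHom F A (op a) = ract a := rfl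

theorem tmul_smul (a b x : A) : tmul F a b • x = a * x * b :=
  AlgHom.mulLeftRight_apply F A a (op b) x

instance : IsScalarTower F (Env F A) A := ⟨fun c s x =>
  LinearMap.congr_fun (map_smul (AlgHom.mulLeftRight F A) c s) x⟩

end Env

section Balanced

variable (k : Submodule F A) (Y : Type x) [AddCommGroup Y] [Module F Y] [Module (Env F A) Y]
  [IsScalarTower F (Env F A) Y]

/-- The relations `(a l) ⊗ y = a ⊗ (l y)` with `l` in `k`. -/
def balRel : Submodule F (A ⊗[F] Y) :=
  Submodule.span F {z | ∃ (a l : A) (y : Y), l ∈ k ∧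
    z = (a * l) ⊗ₜ[F] y - a ⊗ₜ[F] ((lact l : Env F A) • y)}

/-- The tensor product `A ⊗_k Y` of `A` and an `A`-bimodule `Y`. -/
def BalTensor := (A ⊗[F] Y) ⧸ balRel k Y

instance : AddCommGroup (BalTensor k Y) := inferInstanceAs (AddCommGroup ((A ⊗[F] Y) ⧸ balRel k Y))
instance : Module F (BalTensor k Y) := inferInstanceAs (Module F ((A ⊗[F] Y) ⧸ balRel k Y))

/-- The left action of `A` on `A ⊗_F Y`: `a (a' ⊗ y) = (a a') ⊗ y`. -/
def actLeft : A →ₐ[F] Module.End F (A ⊗[F] Y) :=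
  (Module.End.rTensorAlgHom F A Y).comp (Algebra.lmul F A)

/-- The right action of `A` on `A ⊗_F Y`: `(a' ⊗ y) b = a' ⊗ (y b)`. -/
def actRight : Aᵐᵒᵖ →ₐ[F] Module.End F (A ⊗[F] Y) :=
  (Module.End.lTensorAlgHom F Y A).comp ((Algebra.lsmul F F Y).comp (Env.ractHom F A))

theorem act_commute (a : A) (b : Aᵐᵒᵖ) : Commute (actLeft (F := F) Y a) (actRight Y b) := by
  rw [commute_iff_eq]
  ext x y
  rfl

/-- The action of the enveloping algebra on `A ⊗_F Y`: `a (a' ⊗ y) b = (a a') ⊗ (y b)`. -/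
def envAct : Env F A →ₐ[F] Module.End F (A ⊗[F] Y) :=
  (Algebra.TensorProduct.lift (actLeft Y) (actRight Y) (act_commute Y) :
    A ⊗[F] Aᵐᵒᵖ →ₐ[F] Module.End F (A ⊗[F] Y))

theorem envAct_tmul (a b a' : A) (y : Y) :
    envAct Y (Env.tmul F a b) (a' ⊗ₜ[F] y) = (a * a') ⊗ₜ[F] ((ract b : Env F A) • y) := by
  have h : envAct Y (Env.tmul F a b) = actLeft Y a * actRight Y (op b) :=
    Algebra.TensorProduct.lift_tmul (actLeft Y) (actRight Y) (act_commute Y) a (op b)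
  rw [h]; rfl

theorem envAct_mem (s : Env F A) {z : A ⊗[F] Y} (hz : z ∈ balRel k Y) :
    envAct Y s z ∈ balRel k Y := by
  induction s using Env.induction with
  | add s t hs ht => rw [map_add]; exact add_mem hs ht
  | tmul a b =>
    refine Submodule.span_induction (p := fun z _ => envAct Y (Env.tmul F a b) z ∈ balRel k Y)
      ?_ (by simp) (fun x y _ _ hx hy => by rw [map_add]; exact add_mem hx hy)
      (fun c x _ hx => by rw [map_smul]; exact Submodule.smul_mem _ c hx) hz
    rintro _ ⟨a', l, y, hl, rfl⟩
    refine Submodule.subset_span ⟨a * a', l, (ract b : Env F A) • y, hl, ?_⟩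
    rw [map_sub, envAct_tmul, envAct_tmul, mul_assoc, smul_smul, smul_smul,
      Env.ract_mul_lact, Env.lact_mul_ract]

instance : Module (Env F A) (BalTensor k Y) where
  smul s z := Submodule.mapQ (balRel k Y) (balRel k Y) (envAct Y s)
    (fun _ hz => envAct_mem k Y s hz) z
  one_smul z := by
    obtain ⟨z, rfl⟩ := Submodule.mkQ_surjective _ z
    change Submodule.Quotient.mk (envAct Y 1 z) = _
    rw [map_one]; rfl
  mul_smul s t z := by
    obtain ⟨z, rfl⟩ := Submodule.mkQ_surjective _ z
    change Submodule.Quotient.mk (envAct Y (s * t) z) =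
      Submodule.Quotient.mk (envAct Y s (envAct Y t z))
    rw [map_mul]; rfl
  smul_zero s := map_zero _
  smul_add s := map_add _
  add_smul s t z := by
    obtain ⟨z, rfl⟩ := Submodule.mkQ_surjective _ z
    change Submodule.Quotient.mk (envAct Y (s + t) z) =
      Submodule.Quotient.mk (envAct Y s z) + Submodule.Quotient.mk (envAct Y t z)
    rw [map_add]; rfl
  zero_smul z := by
    obtain ⟨z, rfl⟩ := Submodule.mkQ_surjective _ z
    change Submodule.Quotient.mk (envAct Y 0 z) = _
    rw [map_zero]; rfl

instance : IsScalarTower F (Env F A) (BalTensor k Y) := ⟨fun c s z => by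
  obtain ⟨z, rfl⟩ := Submodule.mkQ_surjective _ z
  change Submodule.Quotient.mk (envAct Y (c • s) z) = c • Submodule.Quotient.mk (envAct Y s z)
  rw [map_smul]; rfl⟩

namespace BalTensor

variable {Y}

/-- The element `a ⊗ y` of `A ⊗_k Y`, linear in both variables. -/
def mk : A →ₗ[F] Y →ₗ[F] BalTensor k Y :=
  (TensorProduct.mk F A Y).compr₂ (balRel k Y).mkQ

theorem smul_mk (a b a' : A) (y : Y) :
    Env.tmul F a b • mk k a' y = mk k (a * a') ((ract b : Env F A) • y) := by
  change Submodule.Quotient.mk (envAct Y (Env.tmul F a b) (a' ⊗ₜ[F] y)) = _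
  rw [envAct_tmul]; rfl

theorem lact_smul_mk (a a' : A) (y : Y) :
    (lact a : Env F A) • mk k a' y = mk k (a * a') y := by
  rw [smul_mk, ract, Env.tmul_one_one, one_smul]

theorem ract_smul_mk (b a' : A) (y : Y) :
    (ract b : Env F A) • mk k a' y = mk k a' ((ract b : Env F A) • y) := by
  rw [smul_mk, one_mul]

theorem mk_mul (a l : A) (hl : l ∈ k) (y : Y) :
    mk k (a * l) y = mk k a ((lact l : Env F A) • y) :=
  (Submodule.Quotient.eq (balRel k Y)).2 (Submodule.subset_span ⟨a, l, y, hl, rfl⟩)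

theorem induction {P : BalTensor k Y → Prop} (z : BalTensor k Y) (zero : P 0)
    (add : ∀ z z', P z → P z' → P (z + z')) (mk : ∀ a y, P (mk k a y)) : P z := by
  obtain ⟨z, rfl⟩ := Submodule.mkQ_surjective _ z
  induction z using TensorProduct.induction_on with
  | zero => rw [map_zero]; exact zero
  | add z z' hz hz' => rw [map_add]; exact add _ _ hz hz'
  | tmul a y => exact mk a y

variable {N : Type*} [AddCommGroup N] [Module F N] [Module (Env F A) N]
  [IsScalarTower F (Env F A) N]

theorem hom_ext {f g : BalTensor k Y →ₗ[Env F A] N} (h : ∀ a y, f (mk k a y) = g (mk k a y)) :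
    f = g := by
  ext z
  induction z using induction with
  | zero => simp
  | add z z' hz hz' => rw [map_add, map_add, hz, hz']
  | mk a y => exact h a y

/-- The linear map out of `A ⊗_k Y` given by a `k`-balanced bilinear map `f`. -/
def liftLinear (f : A →ₗ[F] Y →ₗ[F] N)
    (hk : ∀ (a l : A) (y : Y), l ∈ k → f (a * l) y = f a ((lact l : Env F A) • y)) :
    BalTensor k Y →ₗ[F] N :=
  (balRel k Y).liftQ (TensorProduct.lift f) (by
    rw [balRel, Submodule.span_le]
    rintro _ ⟨a, l, y, hl, rfl⟩
    simp [hk a l y hl])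

theorem liftLinear_mk (f : A →ₗ[F] Y →ₗ[F] N) (hk) (a : A) (y : Y) :
    liftLinear k f hk (mk k a y) = f a y := rfl

/-- The bimodule map out of `A ⊗_k Y` given by a `k`-balanced bilinear map `f` which is compatible
with the left action on `A` and the right action on `Y`. -/
def lift (f : A →ₗ[F] Y →ₗ[F] N)
    (hk : ∀ (a l : A) (y : Y), l ∈ k → f (a * l) y = f a ((lact l : Env F A) • y))
    (hs : ∀ (a b a' : A) (y : Y),
      f (a * a') ((ract b : Env F A) • y) = Env.tmul F a b • f a' y) :
    BalTensor k Y →ₗ[Env F A] N where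
  toFun := liftLinear k f hk
  map_add' := map_add _
  map_smul' s z := by
    rw [RingHom.id_apply]
    induction s using Env.induction with
    | add s t hs ht => rw [add_smul, map_add, hs, ht, add_smul]
    | tmul a b =>
    induction z using induction with
    | zero => rw [smul_zero, map_zero, smul_zero]
    | add z z' hz hz' => rw [smul_add, map_add, hz, hz', map_add, smul_add]
    | mk a' y => rw [smul_mk, liftLinear_mk, liftLinear_mk, hs]

theorem lift_mk (f : A →ₗ[F] Y →ₗ[F] N) (hk hs) (a : A) (y : Y) :
    lift k f hk hs (mk k a y) = f a y := rfl

variable (Y) in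
/-- The action `A ⊗_k Y → Y`, `a ⊗ y ↦ a y`. -/
def act : BalTensor k Y →ₗ[Env F A] Y :=
  lift k (((Algebra.lsmul F F Y).toLinearMap ∘ₗ
      (Env.lactHom F A).toLinearMap))
    (fun a l y _ => by
      change (lact (a * l) : Env F A) • y = (lact a : Env F A) • (lact l : Env F A) • y
      rw [smul_smul, Env.lact_mul])
    (fun a b a' y => by
      change (lact (a * a') : Env F A) • (ract b : Env F A) • y =
        Env.tmul F a b • (lact a' : Env F A) • y
      rw [smul_smul, smul_smul, Env.tmul_mul_tmul, Env.tmul_mul_tmul, one_mul, mul_one, mul_one])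

theorem act_mk (a : A) (y : Y) : act k Y (mk k a y) = (lact a : Env F A) • y := rfl

/-- The map `A ⊗_k Y → A ⊗_k Y'`, `a ⊗ y ↦ a ⊗ f y` induced by a bimodule map `f`. -/
def map {Y' : Type x} [AddCommGroup Y'] [Module F Y'] [Module (Env F A) Y']
    [IsScalarTower F (Env F A) Y'] (f : Y →ₗ[Env F A] Y') :
    BalTensor k Y →ₗ[Env F A] BalTensor k Y' :=
  lift k ((mk k).compl₂ (f.restrictScalars F))
    (fun a l y hl => by simp [mk_mul k a l hl])
    (fun a b a' y => by simp [smul_mk])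

theorem map_mk {Y' : Type x} [AddCommGroup Y'] [Module F Y'] [Module (Env F A) Y']
    [IsScalarTower F (Env F A) Y'] (f : Y →ₗ[Env F A] Y') (a : A) (y : Y) :
    map k f (mk k a y) = mk k a (f y) := rfl

/-- The next bar differential: `a ⊗ z ↦ a z - a ⊗ d z`. -/
def barStep (d : BalTensor k Y →ₗ[Env F A] Y) :
    BalTensor k (BalTensor k Y) →ₗ[Env F A] BalTensor k Y :=
  act k (BalTensor k Y) - map k d

theorem barStep_mk (d : BalTensor k Y →ₗ[Env F A] Y) (a : A) (z : BalTensor k Y) :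
    barStep k d (mk k a z) = (lact a : Env F A) • z - mk k a (d z) := rfl

theorem act_barStep (z : BalTensor k (BalTensor k A)) :
    act k A (barStep k (act k A) z) = 0 := by
  induction z using induction with
  | zero => rw [map_zero, map_zero]
  | add z z' hz hz' => rw [map_add, map_add, hz, hz', add_zero]
  | mk a y => rw [barStep_mk, map_sub, map_smul, act_mk k a, sub_self]

theorem barStep_barStep (d : BalTensor k Y →ₗ[Env F A] Y) (hd : ∀ z, d (barStep k d z) = 0)
    (z : BalTensor k (BalTensor k (BalTensor k Y))) :
    barStep k d (barStep k (barStep k d) z) = 0 := by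
  induction z using induction with
  | zero => rw [map_zero, map_zero]
  | add z z' hz hz' => rw [map_add, map_add, hz, hz', add_zero]
  | mk a y =>
    rw [barStep_mk, map_sub, map_smul, barStep_mk k d a, hd, map_zero, sub_zero, sub_self]

end BalTensor

end Balanced

section Complexes

variable (F A) in
/-- An augmented chain complex `⋯ → X 1 → X 0 → A` of `A`-bimodules, with, in each homological
degree `n`, a family of subspaces `gr n m` (the elements of weight `m`). -/
structure BimodComplex where
  X : ℕ → Type x
  [addCommGroup : ∀ n, AddCommGroup (X n)]
  [module : ∀ n, Module F (X n)]
  [envModule : ∀ n, Module (Env F A) (X n)]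
  [isScalarTower : ∀ n, IsScalarTower F (Env F A) (X n)]
  d : ∀ n, X (n + 1) →ₗ[Env F A] X n
  aug : X 0 →ₗ[Env F A] A
  gr : ∀ n : ℕ, ℕ → Submodule F (X n)
  d_d : ∀ n z, d n (d (n + 1) z) = 0
  aug_d : ∀ z, aug (d 0 z) = 0

attribute [instance] BimodComplex.addCommGroup BimodComplex.module BimodComplex.envModule
  BimodComplex.isScalarTower

/-- A morphism of complexes of bimodules which induces the identity of `A`. -/
@[ext]
structure BimodComplex.Hom (C D : BimodComplex F A) where
  f : ∀ n, C.X n →ₗ[Env F A] D.X n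
  comm : ∀ n z, f n (C.d n z) = D.d n (f (n + 1) z)
  aug : ∀ z, D.aug (f 0 z) = C.aug z

/-- A morphism of complexes is homogeneous if it preserves the weight. -/
def BimodComplex.Hom.IsHomogeneous {C D : BimodComplex F A} (φ : C.Hom D) : Prop :=
  ∀ n m, ∀ z ∈ C.gr n m, φ.f n z ∈ D.gr n m

section Bar

variable (k : Submodule F A) (𝒜 : ℕ → Submodule F A)

/-- One step of the construction of the bar resolution. -/
structure BarStage (k : Submodule F A) where
  Y : Type x
  [addCommGroup : AddCommGroup Y]
  [module : Module F Y]
  [envModule : Module (Env F A) Y]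
  [isScalarTower : IsScalarTower F (Env F A) Y]
  d : BalTensor k Y →ₗ[Env F A] Y
  gr : ℕ → Submodule F Y

attribute [instance] BarStage.addCommGroup BarStage.module BarStage.envModule
  BarStage.isScalarTower

/-- The weight of `a ⊗ y` is the sum of the weights of `a` and `y`. -/
def BalTensor.grading {Y : Type x} [AddCommGroup Y] [Module F Y] [Module (Env F A) Y]
    [IsScalarTower F (Env F A) Y] (gr : ℕ → Submodule F Y) (m : ℕ) :
    Submodule F (BalTensor k Y) :=
  Submodule.span F {z | ∃ (i j : ℕ) (a : A) (y : Y), i + j = m ∧ a ∈ 𝒜 i ∧ y ∈ gr j ∧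
    z = BalTensor.mk k a y}

/-- The augmented bar resolution: the bimodule `Y` of stage `n` is `A ⊗_k ⋯ ⊗_k A` with `n + 1`
factors, and `d : A ⊗_k Y → Y` is the bar differential, which is the multiplication
`a ⊗ a' ↦ a a'` at stage `0`, and satisfies `d (a ⊗ y) = a y - a ⊗ d y` at all later stages. Thus
`d (a₀ ⊗ ⋯ ⊗ aₙ₊₁)` is the alternating sum of the `a₀ ⊗ ⋯ ⊗ aᵢ aᵢ₊₁ ⊗ ⋯ ⊗ aₙ₊₁`. -/
def barStage : ℕ → BarStage k
  | 0 => { Y := A, d := BalTensor.act k A, gr := 𝒜 }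
  | n + 1 =>
    { Y := BalTensor k (barStage n).Y
      d := BalTensor.barStep k (barStage n).d
      gr := BalTensor.grading k 𝒜 (barStage n).gr }

theorem barStage_d_d : ∀ (n : ℕ) (z : BalTensor k (BalTensor k (barStage k 𝒜 n).Y)),
    (barStage k 𝒜 n).d (BalTensor.barStep k (barStage k 𝒜 n).d z) = 0
  | 0, z => BalTensor.act_barStep k z
  | n + 1, z => BalTensor.barStep_barStep k (barStage k 𝒜 n).d (barStage_d_d n) z

/-- The bar resolution `B(A)`, with terms `A ⊗_k A^{⊗_k n} ⊗_k A`, graded by the total weight. -/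
def barComplex : BimodComplex F A where
  X n := BalTensor k (barStage k 𝒜 n).Y
  d n := BalTensor.barStep k (barStage k 𝒜 n).d
  aug := (barStage k 𝒜 0).d
  gr n := (barStage k 𝒜 (n + 1)).gr
  d_d n z := barStage_d_d k 𝒜 (n + 1) z
  aug_d z := barStage_d_d k 𝒜 0 z

end Bar

end Complexes

end Bimodules

section Koszul

variable (F : Type w) (Q : Type u) [Field F] [Quiver.{v} Q] [Fintype Q]

/-- A space of homogeneous quadratic relations: a sub-`k`-bimodule `R` of `V ⊗_k V = F Q₂`, where
`k = F Q₀` is spanned by the vertices. -/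
structure QuadraticRelations where
  carrier : Submodule F (PathAlg F Q)
  le_wt : carrier ≤ PathAlg.wt 2
  vertex_mul : ∀ l ∈ PathAlg.wt 0, ∀ r ∈ carrier, l * r ∈ carrier
  mul_vertex : ∀ l ∈ PathAlg.wt 0, ∀ r ∈ carrier, r * l ∈ carrier

variable {F Q} (R : QuadraticRelations F Q)

/-- The quadratic quiver algebra `A = T_k(V) / (R)`. -/
def QuadAlg := (TwoSidedIdeal.span (R.carrier : Set (PathAlg F Q))).ringCon.Quotient

namespace QuadAlg

instance : Ring (QuadAlg R) :=
  inferInstanceAs (Ring (TwoSidedIdeal.span (R.carrier : Set (PathAlg F Q))).ringCon.Quotient)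

instance : Algebra F (QuadAlg R) :=
  inferInstanceAs (Algebra F (TwoSidedIdeal.span (R.carrier : Set (PathAlg F Q))).ringCon.Quotient)

/-- The projection from the path algebra to `A`. -/
def proj : PathAlg F Q →ₐ[F] QuadAlg R :=
  RingCon.mkₐ F (TwoSidedIdeal.span (R.carrier : Set (PathAlg F Q))).ringCon

theorem proj_eq_zero {r : PathAlg F Q} (hr : r ∈ R.carrier) : proj R r = 0 :=
  (RingCon.eq _).2 ((TwoSidedIdeal.mem_iff _ _).1 (TwoSidedIdeal.subset_span hr))

/-- The component `A_m` of weight `m`. -/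
def wt (m : ℕ) : Submodule F (QuadAlg R) := (PathAlg.wt m).map (proj R).toLinearMap

theorem proj_mem {m : ℕ} {x : PathAlg F Q} (hx : x ∈ PathAlg.wt m) : proj R x ∈ wt R m :=
  ⟨x, hx, rfl⟩

end QuadAlg

open PathAlg QuadAlg

/-- The space `W_p`, where `W_0 = k`, `W_1 = V`, and `W_p` is the intersection of the
`V^{⊗ i} ⊗ R ⊗ V^{⊗ j}` with `i + 2 + j = p` inside `V^{⊗ p} = F Q_p` for `2 ≤ p`. -/
def W (p : ℕ) : Submodule F (PathAlg F Q) :=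
  PathAlg.wt p ⊓ ⨅ (i : ℕ) (j : ℕ) (_ : i + 2 + j = p),
    PathAlg.wt i * R.carrier * PathAlg.wt j

theorem mem_W {p : ℕ} {x : PathAlg F Q} : x ∈ W R p ↔ x ∈ PathAlg.wt p ∧
    ∀ i j, i + 2 + j = p → x ∈ PathAlg.wt i * R.carrier * PathAlg.wt j := by
  simp [W, Submodule.mem_iInf]

theorem leftDiv_mem_W (a : Arrow Q) {p : ℕ} {x : PathAlg F Q} (hx : x ∈ W R (p + 1)) :
    leftDiv a x ∈ W R p := by
  rw [mem_W] at hx ⊢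
  refine ⟨leftDiv_mem a hx.1, fun i j h => ?_⟩
  have hx' := hx.2 (i + 1) j (by omega)
  rw [mul_assoc] at hx' ⊢
  refine Submodule.mul_induction_on hx' ?_ (fun y z hy hz => by rw [map_add]; exact add_mem hy hz)
  intro y hy z hz
  rw [leftDiv_mul a hy]
  exact Submodule.mul_mem_mul (leftDiv_mem a hy) hz

theorem rightDiv_mem_W (a : Arrow Q) {p : ℕ} {x : PathAlg F Q} (hx : x ∈ W R (p + 1)) :
    rightDiv a x ∈ W R p := by
  rw [mem_W] at hx ⊢
  refine ⟨rightDiv_mem a hx.1, fun i j h => ?_⟩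
  have hx' := hx.2 i (j + 1) (by omega)
  refine Submodule.mul_induction_on hx' ?_ (fun y z hy hz => by rw [map_add]; exact add_mem hy hz)
  intro y hy z hz
  rw [rightDiv_mul a hz]
  exact Submodule.mul_mem_mul hy (rightDiv_mem a hz)

/-- Left division by an arrow, as a map `W_{p+1} → W_p`. -/
def leftDivW (a : Arrow Q) (p : ℕ) : W R (p + 1) →ₗ[F] W R p :=
  (leftDiv a).restrict fun _ hx => leftDiv_mem_W R a hx

/-- Right division by an arrow, as a map `W_{p+1} → W_p`. -/
def rightDivW (a : Arrow Q) (p : ℕ) : W R (p + 1) →ₗ[F] W R p :=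
  (rightDiv a).restrict fun _ hx => rightDiv_mem_W R a hx

/-- The relations `l ⊗ x ⊗ m = 1 ⊗ l x m ⊗ 1` with `l` and `m` in `k`. -/
def koszulRel (p : ℕ) : Submodule (Env F (QuadAlg R)) (Env F (QuadAlg R) ⊗[F] W R p) :=
  Submodule.span _ {z | ∃ (l m : PathAlg F Q) (x y : W R p), l ∈ PathAlg.wt 0 ∧ m ∈ PathAlg.wt 0 ∧
    (y : PathAlg F Q) = l * x * m ∧
    z = Env.tmul F (proj R l) (proj R m) ⊗ₜ[F] x - (1 : Env F (QuadAlg R)) ⊗ₜ[F] y}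

/-- The term `A ⊗_k W_p ⊗_k A` of the Koszul complex, where `(a ⊗ b) ⊗ x` stands for
`a ⊗ x ⊗ b`. -/
def KoszulTerm (p : ℕ) := (Env F (QuadAlg R) ⊗[F] W R p) ⧸ koszulRel R p

namespace KoszulTerm

variable (p : ℕ)

instance : AddCommGroup (KoszulTerm R p) :=
  inferInstanceAs (AddCommGroup ((Env F (QuadAlg R) ⊗[F] W R p) ⧸ koszulRel R p))
instance : Module (Env F (QuadAlg R)) (KoszulTerm R p) :=
  inferInstanceAs (Module (Env F (QuadAlg R)) ((Env F (QuadAlg R) ⊗[F] W R p) ⧸ koszulRel R p))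
instance : Module F (KoszulTerm R p) :=
  inferInstanceAs (Module F ((Env F (QuadAlg R) ⊗[F] W R p) ⧸ koszulRel R p))
instance : IsScalarTower F (Env F (QuadAlg R)) (KoszulTerm R p) :=
  inferInstanceAs (IsScalarTower F (Env F (QuadAlg R))
    ((Env F (QuadAlg R) ⊗[F] W R p) ⧸ koszulRel R p))

/-- The element `1 ⊗ x ⊗ 1` of `A ⊗_k W_p ⊗_k A`. -/
def gen : W R p →ₗ[F] KoszulTerm R p :=
  ((koszulRel R p).mkQ.restrictScalars F) ∘ₗ (TensorProduct.mk F (Env F (QuadAlg R)) (W R p) 1)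

theorem gen_rel {l m : PathAlg F Q} (hl : l ∈ PathAlg.wt 0) (hm : m ∈ PathAlg.wt 0) (x y : W R p)
    (h : (y : PathAlg F Q) = l * x * m) :
    gen R p y = Env.tmul F (proj R l) (proj R m) • gen R p x := by
  symm
  have h1 : Env.tmul F (proj R l) (proj R m) • gen R p x =
      (koszulRel R p).mkQ (Env.tmul F (proj R l) (proj R m) ⊗ₜ[F] x) := by
    change (koszulRel R p).mkQ (Env.tmul F (proj R l) (proj R m) •
      ((1 : Env F (QuadAlg R)) ⊗ₜ[F] x)) = _
    rw [TensorProduct.smul_tmul', smul_eq_mul, mul_one]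
  rw [h1]
  exact (Submodule.Quotient.eq (koszulRel R p)).2
    (Submodule.subset_span ⟨l, m, x, y, hl, hm, h, rfl⟩)

theorem induction {P : KoszulTerm R p → Prop} (z : KoszulTerm R p)
    (zero : P 0) (add : ∀ z z', P z → P z' → P (z + z'))
    (smul : ∀ (s : Env F (QuadAlg R)) (x : W R p), P (s • gen R p x)) : P z := by
  obtain ⟨z, rfl⟩ := Submodule.mkQ_surjective _ z
  induction z using TensorProduct.induction_on with
  | zero => rw [map_zero]; exact zero
  | add z z' hz hz' => rw [map_add]; exact add _ _ hz hz'
  | tmul s x =>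
    have h := smul s x
    have h1 : s • gen R p x = (koszulRel R p).mkQ (s ⊗ₜ[F] x) := by
      change (koszulRel R p).mkQ (s • ((1 : Env F (QuadAlg R)) ⊗ₜ[F] x)) = _
      rw [TensorProduct.smul_tmul', smul_eq_mul, mul_one]
    rwa [h1] at h

variable {N : Type*} [AddCommGroup N] [Module F N] [Module (Env F (QuadAlg R)) N]
  [IsScalarTower F (Env F (QuadAlg R)) N]

variable {R p} in
theorem hom_ext {f g : KoszulTerm R p →ₗ[Env F (QuadAlg R)] N}
    (h : ∀ x, f (gen R p x) = g (gen R p x)) : f = g := by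
  ext z
  induction z using induction with
  | zero => rw [map_zero, map_zero]
  | add z z' hz hz' => rw [map_add, map_add, hz, hz']
  | smul s x => rw [map_smul, map_smul, h]

/-- The bimodule map out of `A ⊗_k W_p ⊗_k A` given by a map of `k`-bimodules out of `W_p`. -/
def lift (f : W R p →ₗ[F] N)
    (hf : ∀ (l m : PathAlg F Q) (x y : W R p), l ∈ PathAlg.wt 0 → m ∈ PathAlg.wt 0 →
      (y : PathAlg F Q) = l * x * m →
      f y = Env.tmul F (proj R l) (proj R m) • f x) :
    KoszulTerm R p →ₗ[Env F (QuadAlg R)] N :=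
  (koszulRel R p).liftQ
    (TensorProduct.AlgebraTensorModule.lift (LinearMap.toSpanSingleton (Env F (QuadAlg R)) _ f)) (by
      rw [koszulRel, Submodule.span_le]
      rintro _ ⟨l, m, x, y, hl, hm, h, rfl⟩
      simp [hf l m x y hl hm h])

theorem lift_gen (f : W R p →ₗ[F] N) (hf) (x : W R p) : lift R p f hf (gen R p x) = f x :=
  one_smul (Env F (QuadAlg R)) (f x)

end KoszulTerm

section Differential

variable [∀ i j : Q, Fintype (i ⟶ j)]

section Lemmas

variable {N : Type*} [AddCommGroup N] [Module F N] [Module (Env F (QuadAlg R)) N]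
  [IsScalarTower F (Env F (QuadAlg R)) N]

/-- The bilinear map `(a, z) ↦ a g(z)`. -/
def leftBil (g : PathAlg F Q →ₗ[F] N) : PathAlg F Q →ₗ[F] PathAlg F Q →ₗ[F] N :=
  ((Algebra.lsmul F F N).toLinearMap ∘ₗ (Env.lactHom F (QuadAlg R)).toLinearMap ∘ₗ
    (proj R).toLinearMap).compl₂ g

theorem leftBil_apply (g : PathAlg F Q →ₗ[F] N) (a z : PathAlg F Q) :
    leftBil R g a z = (lact (proj R a) : Env F (QuadAlg R)) • g z := rfl

/-- The bilinear map `(z, a) ↦ g(z) a`. -/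
def rightBil (g : PathAlg F Q →ₗ[F] N) : PathAlg F Q →ₗ[F] PathAlg F Q →ₗ[F] N :=
  (((Algebra.lsmul F F N).toLinearMap ∘ₗ (Env.ractHom F (QuadAlg R)).toLinearMap ∘ₗ
    (opLinearEquiv F).toLinearMap ∘ₗ (proj R).toLinearMap).compl₂ g).flip

theorem rightBil_apply (g : PathAlg F Q →ₗ[F] N) (a z : PathAlg F Q) :
    rightBil R g z a = (ract (proj R a) : Env F (QuadAlg R)) • g z := rfl

theorem sum_sum_leftDiv_eq_zero (g : PathAlg F Q →ₗ[F] N) {p : ℕ} {x : PathAlg F Q}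
    (hx : x ∈ W R (p + 2)) :
    ∑ a : Arrow Q, ∑ c : Arrow Q, (lact (proj R (arr a)) : Env F (QuadAlg R)) •
      (lact (proj R (arr c)) : Env F (QuadAlg R)) • g (leftDiv c (leftDiv a x)) = 0 := by
  have hx' := ((mem_W R).1 hx).2 0 p (by omega)
  refine Submodule.mul_induction_on hx' ?_ ?_
  · intro r' hr' y hy
    have hr : r' ∈ R.carrier := by
      refine Submodule.mul_induction_on hr' (fun l hl r hr => R.vertex_mul l hl r hr)
        (fun _ _ h h' => add_mem h h')
    have h := sum_leftDiv_leftDiv (leftBil R (g ∘ₗ LinearMap.mulRight F y)) (R.le_wt hr)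
    simp only [leftBil_apply, proj_eq_zero R (R.mul_vertex _ (e_mem _) _ hr),
      Env.tmul_zero_left, zero_smul, Finset.sum_const_zero] at h
    rw [← h]
    refine Finset.sum_congr rfl fun a _ => Finset.sum_congr rfl fun c _ => ?_
    rw [smul_smul, ← Env.lact_mul, ← map_mul, leftDiv_mul a (R.le_wt hr),
      leftDiv_mul c (leftDiv_mem a (R.le_wt hr))]
    rfl
  · intro x y hx hy
    simp only [map_add, smul_add, Finset.sum_add_distrib, hx, hy, add_zero]

theorem sum_sum_rightDiv_eq_zero (g : PathAlg F Q →ₗ[F] N) {p : ℕ} {x : PathAlg F Q}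
    (hx : x ∈ W R (p + 2)) :
    ∑ a : Arrow Q, ∑ c : Arrow Q, (ract (proj R (arr a)) : Env F (QuadAlg R)) •
      (ract (proj R (arr c)) : Env F (QuadAlg R)) • g (rightDiv c (rightDiv a x)) = 0 := by
  have hx' := ((mem_W R).1 hx).2 p 0 (by omega)
  rw [mul_assoc] at hx'
  refine Submodule.mul_induction_on hx' ?_ ?_
  · intro y hy r' hr'
    have hr : r' ∈ R.carrier := by
      refine Submodule.mul_induction_on hr' (fun r hr l hl => R.mul_vertex l hl r hr)
        (fun _ _ h h' => add_mem h h')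
    have h := sum_rightDiv_rightDiv (rightBil R (g ∘ₗ LinearMap.mulLeft F y)) (R.le_wt hr)
    simp only [rightBil_apply, proj_eq_zero R (R.vertex_mul _ (e_mem _) _ hr),
      Env.tmul_zero_right, zero_smul, Finset.sum_const_zero] at h
    rw [← h]
    refine Finset.sum_congr rfl fun a _ => Finset.sum_congr rfl fun c _ => ?_
    rw [smul_smul, ← Env.ract_mul, ← map_mul, rightDiv_mul a (R.le_wt hr),
      rightDiv_mul c (rightDiv_mem a (R.le_wt hr))]
    rfl
  · intro x y hx hy
    simp only [map_add, smul_add, Finset.sum_add_distrib, hx, hy, add_zero]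

theorem sum_left_equivariant (g : PathAlg F Q →ₗ[F] N) {p : ℕ} {l m x : PathAlg F Q}
    (hl : l ∈ PathAlg.wt 0) (hx : x ∈ PathAlg.wt (p + 1))
    (hg : ∀ a : Arrow Q, g (leftDiv a x * m) =
      (ract (proj R m) : Env F (QuadAlg R)) • g (leftDiv a x)) :
    ∑ a : Arrow Q, (lact (proj R (arr a)) : Env F (QuadAlg R)) • g (leftDiv a (l * x * m)) =
      Env.tmul F (proj R l) (proj R m) • ∑ a : Arrow Q,
        (lact (proj R (arr a)) : Env F (QuadAlg R)) • g (leftDiv a x) := by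
  have hlx : l * x ∈ PathAlg.wt (p + 1) := by
    have h := wt_mul_le 0 (p + 1) (Submodule.mul_mem_mul hl hx)
    rwa [zero_add] at h
  have h := sum_leftDiv_vertex_mul (leftBil R (g ∘ₗ LinearMap.mulRight F m)) hl hx
  simp only [leftBil_apply, LinearMap.comp_apply, LinearMap.mulRight_apply] at h
  simp only [leftDiv_mul _ hlx]
  rw [h, Finset.smul_sum]
  refine Finset.sum_congr rfl fun a _ => ?_
  rw [hg, map_mul, Env.lact_mul, smul_smul, smul_smul, mul_assoc, Env.lact_mul_ract,
    ← Env.ract_mul_lact, ← mul_assoc, Env.lact_mul_ract]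

theorem sum_right_equivariant (g : PathAlg F Q →ₗ[F] N) {p : ℕ} {l m x : PathAlg F Q}
    (hl : l ∈ PathAlg.wt 0) (hm : m ∈ PathAlg.wt 0) (hx : x ∈ PathAlg.wt (p + 1))
    (hg : ∀ a : Arrow Q, g (l * rightDiv a x) =
      (lact (proj R l) : Env F (QuadAlg R)) • g (rightDiv a x)) :
    ∑ a : Arrow Q, (ract (proj R (arr a)) : Env F (QuadAlg R)) • g (rightDiv a (l * x * m)) =
      Env.tmul F (proj R l) (proj R m) • ∑ a : Arrow Q,
        (ract (proj R (arr a)) : Env F (QuadAlg R)) • g (rightDiv a x) := by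
  have hxm : x * m ∈ PathAlg.wt (p + 1) := wt_mul_le (p + 1) 0 (Submodule.mul_mem_mul hx hm)
  have h := sum_rightDiv_mul_vertex (rightBil R (g ∘ₗ LinearMap.mulLeft F l)) hm hx
  simp only [rightBil_apply, LinearMap.comp_apply, LinearMap.mulLeft_apply] at h
  simp only [mul_assoc, rightDiv_mul _ hxm]
  rw [h, Finset.smul_sum]
  refine Finset.sum_congr rfl fun a _ => ?_
  rw [hg, map_mul, Env.ract_mul, smul_smul, smul_smul, mul_assoc, Env.ract_mul_lact,
    ← Env.lact_mul_ract, ← mul_assoc, Env.ract_mul_lact]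

end Lemmas

theorem W_mul_mem {p : ℕ} {l m x : PathAlg F Q} (hl : l ∈ PathAlg.wt 0) (hm : m ∈ PathAlg.wt 0)
    (hx : x ∈ W R p) : l * x * m ∈ W R p := by
  rw [mem_W] at hx ⊢
  have hle (n : ℕ) : (PathAlg.wt 0 * PathAlg.wt n : Submodule F (PathAlg F Q)) ≤ PathAlg.wt n := by
    have h := wt_mul_le (F := F) (Q := Q) 0 n
    rwa [zero_add] at h
  have hle' (n : ℕ) : (PathAlg.wt n * PathAlg.wt 0 : Submodule F (PathAlg F Q)) ≤ PathAlg.wt n :=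
    wt_mul_le n 0
  refine ⟨hle' p (Submodule.mul_mem_mul (hle p (Submodule.mul_mem_mul hl hx.1)) hm),
    fun i j h => ?_⟩
  have h1 := Submodule.mul_mem_mul (Submodule.mul_mem_mul hl (hx.2 i j h)) hm
  rw [← mul_assoc, ← mul_assoc, mul_assoc _ (PathAlg.wt j)] at h1
  exact mul_le_mul' (mul_le_mul' (hle i) le_rfl) (hle' j) h1

theorem one_mem_wt : (1 : PathAlg F Q) ∈ PathAlg.wt 0 := by
  rw [one_def]
  exact Submodule.sum_mem _ fun i _ => e_mem i

namespace KoszulTerm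

/-- An extension of `gen` to the whole path algebra, for use in proofs only. -/
theorem exists_genExt (p : ℕ) : ∃ g : PathAlg F Q →ₗ[F] KoszulTerm R p,
    ∀ x : W R p, g x = gen R p x := by
  obtain ⟨g, hg⟩ := LinearMap.exists_extend (gen R p)
  exact ⟨g, fun x => LinearMap.congr_fun hg x⟩

theorem genExt_tmul {p : ℕ} {g : PathAlg F Q →ₗ[F] KoszulTerm R p}
    (hg : ∀ x : W R p, g x = gen R p x) {l m x : PathAlg F Q}
    (hl : l ∈ PathAlg.wt 0) (hm : m ∈ PathAlg.wt 0) (hx : x ∈ W R p) :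
    g (l * x * m) = Env.tmul F (proj R l) (proj R m) • g x := by
  have h := gen_rel R p hl hm ⟨x, hx⟩ ⟨l * x * m, W_mul_mem R hl hm hx⟩ rfl
  rwa [← hg, ← hg] at h

theorem genExt_lact {p : ℕ} {g : PathAlg F Q →ₗ[F] KoszulTerm R p}
    (hg : ∀ x : W R p, g x = gen R p x) {l x : PathAlg F Q}
    (hl : l ∈ PathAlg.wt 0) (hx : x ∈ W R p) :
    g (l * x) = (lact (proj R l) : Env F (QuadAlg R)) • g x := by
  have h := genExt_tmul R hg hl one_mem_wt hx
  rwa [mul_one, map_one] at h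

theorem genExt_ract {p : ℕ} {g : PathAlg F Q →ₗ[F] KoszulTerm R p}
    (hg : ∀ x : W R p, g x = gen R p x) {m x : PathAlg F Q}
    (hm : m ∈ PathAlg.wt 0) (hx : x ∈ W R p) :
    g (x * m) = (ract (proj R m) : Env F (QuadAlg R)) • g x := by
  have h := genExt_tmul R hg one_mem_wt hm hx
  rwa [one_mul, map_one] at h

/-- The value of the Koszul differential on `1 ⊗ x₁ ⋯ xₚ₊₁ ⊗ 1`, namely
`x₁ ⊗ x₂ ⋯ xₚ₊₁ ⊗ 1 + (-1)^(p+1) 1 ⊗ x₁ ⋯ xₚ ⊗ xₚ₊₁`. -/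
def dGen (p : ℕ) : W R (p + 1) →ₗ[F] KoszulTerm R p :=
  ∑ a : Arrow Q, Algebra.lsmul F F _ (lact (proj R (arr a)) : Env F (QuadAlg R)) ∘ₗ
      gen R p ∘ₗ leftDivW R a p +
    (-1 : F) ^ (p + 1) • ∑ a : Arrow Q,
      Algebra.lsmul F F _ (ract (proj R (arr a)) : Env F (QuadAlg R)) ∘ₗ
        gen R p ∘ₗ rightDivW R a p

theorem dGen_apply (p : ℕ) (x : W R (p + 1)) : dGen R p x =
    ∑ a : Arrow Q, (lact (proj R (arr a)) : Env F (QuadAlg R)) • gen R p (leftDivW R a p x) +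
    (-1 : F) ^ (p + 1) • ∑ a : Arrow Q,
      (ract (proj R (arr a)) : Env F (QuadAlg R)) • gen R p (rightDivW R a p x) := by
  simp [dGen, LinearMap.sum_apply]

theorem dGen_eq {p : ℕ} {g : PathAlg F Q →ₗ[F] KoszulTerm R p}
    (hg : ∀ x : W R p, g x = gen R p x) (x : W R (p + 1)) : dGen R p x =
    ∑ a : Arrow Q, (lact (proj R (arr a)) : Env F (QuadAlg R)) • g (leftDiv a x) +
    (-1 : F) ^ (p + 1) • ∑ a : Arrow Q,
      (ract (proj R (arr a)) : Env F (QuadAlg R)) • g (rightDiv a x) := by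
  rw [dGen_apply]
  simp only [← hg]
  rfl

theorem smul_comm' {N : Type*} [AddCommGroup N] [Module F N] [Module (Env F (QuadAlg R)) N]
    [IsScalarTower F (Env F (QuadAlg R)) N] (c : F) (s : Env F (QuadAlg R)) (n : N) :
    s • c • n = c • s • n :=
  (Algebra.lsmul F F N s).map_smul c n

/-- The Koszul differential. -/
def d (p : ℕ) : KoszulTerm R (p + 1) →ₗ[Env F (QuadAlg R)] KoszulTerm R p :=
  lift R (p + 1) (dGen R p) (by
    intro l m x y hl hm hy
    obtain ⟨g, hg⟩ := exists_genExt R p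
    have hx := ((mem_W R).1 x.2).1
    rw [dGen_eq R hg, dGen_eq R hg, hy, sum_left_equivariant R g hl hx
      (fun a => genExt_ract R hg hm (leftDiv_mem_W R a x.2)),
      sum_right_equivariant R g hl hm hx
      (fun a => genExt_lact R hg hl (rightDiv_mem_W R a x.2)), smul_add, smul_comm'])

theorem d_gen (p : ℕ) (x : W R (p + 1)) : d R p (gen R (p + 1) x) = dGen R p x :=
  lift_gen _ _ _ _ _

theorem d_d (p : ℕ) (z : KoszulTerm R (p + 2)) : d R p (d R (p + 1) z) = 0 := by
  suffices h : d R p ∘ₗ d R (p + 1) = 0 from LinearMap.congr_fun h z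
  refine hom_ext fun x => ?_
  obtain ⟨g, hg⟩ := exists_genExt R p
  rw [LinearMap.comp_apply, d_gen, dGen_apply]
  simp only [map_add, map_sum, map_smul, d_gen, dGen_eq R hg]
  have hs (c : F) (z : KoszulTerm R (p + 1)) : d R p (c • z) = c • d R p z :=
    ((d R p).restrictScalars F).map_smul c z
  simp only [hs, map_sum, map_smul, d_gen, dGen_eq R hg, smul_add, Finset.sum_add_distrib,
    smul_comm', Finset.smul_sum]
  have h1 := sum_sum_leftDiv_eq_zero R g x.2
  have h2 := sum_sum_rightDiv_eq_zero R g x.2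
  have e1 (a : Arrow Q) : (leftDivW R a (p + 1) x : PathAlg F Q) = leftDiv a x := rfl
  have e2 (a : Arrow Q) : (rightDivW R a (p + 1) x : PathAlg F Q) = rightDiv a x := rfl
  have h3 : ∑ a : Arrow Q, ∑ c : Arrow Q, (ract (proj R (arr a)) : Env F (QuadAlg R)) •
      (lact (proj R (arr c)) : Env F (QuadAlg R)) • g (leftDiv c (rightDiv a x)) =
      ∑ a : Arrow Q, ∑ c : Arrow Q, (lact (proj R (arr a)) : Env F (QuadAlg R)) •
      (ract (proj R (arr c)) : Env F (QuadAlg R)) • g (rightDiv c (leftDiv a x)) := by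
    rw [Finset.sum_comm]
    refine Finset.sum_congr rfl fun a _ => Finset.sum_congr rfl fun c _ => ?_
    rw [leftDiv_rightDiv a c ((mem_W R).1 x.2).1, smul_smul, smul_smul, Env.ract_mul_lact,
      Env.lact_mul_ract]
  simp only [e1, e2]
  simp only [← Finset.smul_sum] at h1 h2 h3 ⊢
  rw [h1, h2, h3]
  simp only [smul_zero, add_zero, zero_add, LinearMap.zero_apply]
  rw [← add_smul, pow_succ (-1 : F) (p + 1), mul_neg_one, add_neg_cancel, zero_smul]

/-- The augmentation `A ⊗_k A → A`. -/
def aug : KoszulTerm R 0 →ₗ[Env F (QuadAlg R)] QuadAlg R :=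
  lift R 0 ((proj R).toLinearMap ∘ₗ (W R 0).subtype) (by
    intro l m x y hl hm hy
    simp [hy, Env.tmul_smul])

theorem aug_gen (x : W R 0) : aug R (gen R 0 x) = proj R x := lift_gen _ _ _ _ _

theorem aug_d (z : KoszulTerm R 1) : aug R (d R 0 z) = 0 := by
  suffices h : aug R ∘ₗ d R 0 = 0 from LinearMap.congr_fun h z
  refine hom_ext fun x => ?_
  have hs (c : F) (z : KoszulTerm R 0) : aug R (c • z) = c • aug R z :=
    ((aug R).restrictScalars F).map_smul c z
  rw [LinearMap.comp_apply, d_gen, dGen_apply]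
  have hx := ((mem_W R).1 x.2).1
  simp only [map_add, hs, map_sum, map_smul, aug_gen, Env.tmul_smul, mul_one, one_mul,
    LinearMap.zero_apply]
  have h1 : ∑ a : Arrow Q, proj R (arr a) * proj R (leftDivW R a 0 x) = proj R x := by
    simp only [← map_mul, ← map_sum]
    exact congrArg (proj R) (sum_arr_mul_leftDiv hx)
  have h2 : ∑ a : Arrow Q, proj R (rightDivW R a 0 x) * proj R (arr a) = proj R x := by
    simp only [← map_mul, ← map_sum]
    exact congrArg (proj R) (sum_rightDiv_mul_arr hx)
  rw [h1, h2]
  simp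

end KoszulTerm

/-- The Koszul bimodule complex `K(A)`, graded by the total weight. -/
def koszulComplex : BimodComplex F (QuadAlg R) where
  X := KoszulTerm R
  d := KoszulTerm.d R
  aug := KoszulTerm.aug R
  gr p m := Submodule.span F {z | ∃ (i j : ℕ) (a b : QuadAlg R) (x : W R p), i + p + j = m ∧
    a ∈ QuadAlg.wt R i ∧ b ∈ QuadAlg.wt R j ∧ z = Env.tmul F a b • KoszulTerm.gen R p x}
  d_d := KoszulTerm.d_d R
  aug_d := KoszulTerm.aug_d R

/-- The bar resolution `B(A)` of the quadratic algebra `A`, relative to `k = A₀`. -/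
def bar : BimodComplex F (QuadAlg R) := barComplex (QuadAlg.wt R 0) (QuadAlg.wt R)

section Inclusion

variable {R} {Y : Type (max u v w)} [AddCommGroup Y] [Module F Y] [Module (Env F (QuadAlg R)) Y]
  [IsScalarTower F (Env F (QuadAlg R)) Y]

variable (R Y) in
/-- The map `y ↦ 1 ⊗ y`. -/
def oneTensor : Y →ₗ[F] BalTensor (QuadAlg.wt R 0) Y := BalTensor.mk (QuadAlg.wt R 0) 1

/-- From `s`, the map sending a path `a x`, with `a` an arrow, to `1 ⊗ a s(x)`. -/
def sigmaStep (s : PathAlg F Q →ₗ[F] Y) : PathAlg F Q →ₗ[F] BalTensor (QuadAlg.wt R 0) Y :=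
  ∑ a : Arrow Q, oneTensor R Y ∘ₗ
    Algebra.lsmul F F Y (lact (proj R (arr a)) : Env F (QuadAlg R)) ∘ₗ s ∘ₗ leftDiv a

theorem sigmaStep_apply (s : PathAlg F Q →ₗ[F] Y) (x : PathAlg F Q) :
    sigmaStep s x = oneTensor R Y (∑ a : Arrow Q,
      (lact (proj R (arr a)) : Env F (QuadAlg R)) • s (leftDiv a x)) := by
  simp [sigmaStep, LinearMap.sum_apply, map_sum]

theorem tmul_smul_oneTensor {l m : PathAlg F Q} (hl : l ∈ PathAlg.wt 0) (y : Y) :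
    (Env.tmul F (proj R l) (proj R m) : Env F (QuadAlg R)) • oneTensor R Y y =
      oneTensor R Y ((Env.tmul F (proj R l) (proj R m) : Env F (QuadAlg R)) • y) := by
  have h := BalTensor.mk_mul (QuadAlg.wt R 0) (1 : QuadAlg R) (proj R l) (proj_mem R hl)
    ((ract (proj R m) : Env F (QuadAlg R)) • y)
  rw [smul_smul, Env.lact_mul_ract, one_mul] at h
  rw [oneTensor, BalTensor.smul_mk, mul_one, h]

/-- Compatibility of a map out of the path algebra with the actions of `k`. -/
def IsEquivariant (s : PathAlg F Q →ₗ[F] Y) (p : ℕ) : Prop :=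
  ∀ l m x : PathAlg F Q, l ∈ PathAlg.wt 0 → m ∈ PathAlg.wt 0 → x ∈ PathAlg.wt p →
    s (l * x * m) = (Env.tmul F (proj R l) (proj R m) : Env F (QuadAlg R)) • s x

theorem sigmaStep_equivariant {s : PathAlg F Q →ₗ[F] Y} {p : ℕ}
    (hs : IsEquivariant (R := R) s p) :
    IsEquivariant (R := R) (sigmaStep (R := R) s) (p + 1) := by
  intro l m x hl hm hx
  rw [sigmaStep_apply, sigmaStep_apply, tmul_smul_oneTensor hl, sum_left_equivariant R s hl hx]
  intro a
  have h := hs 1 m (leftDiv a x) one_mem_wt hm (leftDiv_mem a hx)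
  rwa [one_mul, map_one] at h

theorem barStep_sigmaStep (d : BalTensor (QuadAlg.wt R 0) Y →ₗ[Env F (QuadAlg R)] Y)
    (s : PathAlg F Q →ₗ[F] BalTensor (QuadAlg.wt R 0) Y) (x : PathAlg F Q) :
    BalTensor.barStep (QuadAlg.wt R 0) d (sigmaStep s x) =
      ∑ a : Arrow Q, (lact (proj R (arr a)) : Env F (QuadAlg R)) • s (leftDiv a x) -
      oneTensor R Y (∑ a : Arrow Q,
        (lact (proj R (arr a)) : Env F (QuadAlg R)) • d (s (leftDiv a x))) := by
  rw [sigmaStep_apply]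
  refine (BalTensor.barStep_mk _ _ _ _).trans ?_
  rw [show (lact (1 : QuadAlg R) : Env F (QuadAlg R)) = 1 from Env.tmul_one_one, one_smul, map_sum]
  simp only [map_smul]
  rfl

/-- The statement that `s` and `sigmaStep s` are compatible with the Koszul differential in
degree `p + 1`. -/
def IsCompat (d : BalTensor (QuadAlg.wt R 0) Y →ₗ[Env F (QuadAlg R)] Y)
    (s : PathAlg F Q →ₗ[F] BalTensor (QuadAlg.wt R 0) Y) (p : ℕ) : Prop :=
  ∀ x ∈ W R (p + 1), BalTensor.barStep (QuadAlg.wt R 0) d (sigmaStep s x) =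
    ∑ a : Arrow Q, (lact (proj R (arr a)) : Env F (QuadAlg R)) • s (leftDiv a x) +
    (-1 : F) ^ (p + 1) • ∑ a : Arrow Q,
      (ract (proj R (arr a)) : Env F (QuadAlg R)) • s (rightDiv a x)

theorem isCompat_succ {d : BalTensor (QuadAlg.wt R 0) Y →ₗ[Env F (QuadAlg R)] Y}
    {s : PathAlg F Q →ₗ[F] BalTensor (QuadAlg.wt R 0) Y} {p : ℕ} (h : IsCompat d s p) :
    IsCompat (BalTensor.barStep (QuadAlg.wt R 0) d) (sigmaStep s) (p + 1) := by
  intro x hx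
  have e (a : Arrow Q) : BalTensor.barStep (QuadAlg.wt R 0) d (sigmaStep s (leftDiv a x)) =
    ∑ c : Arrow Q, (lact (proj R (arr c)) : Env F (QuadAlg R)) • s (leftDiv c (leftDiv a x)) +
    (-1 : F) ^ (p + 1) • ∑ c : Arrow Q,
      (ract (proj R (arr c)) : Env F (QuadAlg R)) • s (rightDiv c (leftDiv a x)) :=
    h _ (leftDiv_mem_W R a hx)
  rw [barStep_sigmaStep]
  simp only [e, smul_add, Finset.smul_sum, KoszulTerm.smul_comm', Finset.sum_add_distrib,
    sum_sum_leftDiv_eq_zero R s hx, zero_add]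
  simp only [← Finset.smul_sum, map_smul]
  have h3 : oneTensor R (BalTensor (QuadAlg.wt R 0) Y) (∑ a : Arrow Q, ∑ c : Arrow Q,
      (lact (proj R (arr a)) : Env F (QuadAlg R)) •
      (ract (proj R (arr c)) : Env F (QuadAlg R)) • s (rightDiv c (leftDiv a x))) =
      ∑ c : Arrow Q, (ract (proj R (arr c)) : Env F (QuadAlg R)) •
        sigmaStep s (rightDiv c x) := by
    rw [Finset.sum_comm, map_sum]
    refine Finset.sum_congr rfl fun c _ => ?_
    rw [sigmaStep_apply, oneTensor, BalTensor.ract_smul_mk, Finset.smul_sum]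
    refine congrArg _ (Finset.sum_congr rfl fun a _ => ?_)
    rw [leftDiv_rightDiv a c ((mem_W R).1 hx).1, smul_smul, smul_smul, Env.ract_mul_lact,
      Env.lact_mul_ract]
  simp only [← Finset.smul_sum] at h3
  rw [h3, pow_succ (-1 : F) (p + 1), mul_neg_one, neg_smul, sub_eq_add_neg]

end Inclusion

/-- The map sending a path `x₁ ⋯ xₚ` of length `p` to the element `1 ⊗ x₁ ⊗ ⋯ ⊗ xₚ ⊗ 1` of
`A ⊗_k A^{⊗_k p} ⊗_k A`. -/
def sigma : ∀ p : ℕ, PathAlg F Q →ₗ[F]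
    BalTensor (QuadAlg.wt R 0) (barStage (QuadAlg.wt R 0) (QuadAlg.wt R) p).Y
  | 0 => (BalTensor.mk (QuadAlg.wt R 0)).flip (1 : QuadAlg R) ∘ₗ (proj R).toLinearMap
  | p + 1 => sigmaStep (R := R)
      (Y := BalTensor (QuadAlg.wt R 0) (barStage (QuadAlg.wt R 0) (QuadAlg.wt R) p).Y) (sigma p)

theorem mk_one_eq {c b : QuadAlg R} (hc : c ∈ QuadAlg.wt R 0) :
    BalTensor.mk (F := F) (Y := QuadAlg R) (QuadAlg.wt R 0) c b =
      BalTensor.mk (QuadAlg.wt R 0) 1 (c * b) := by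
  have h := BalTensor.mk_mul (F := F) (Y := QuadAlg R) (QuadAlg.wt R 0) (1 : QuadAlg R) c hc b
  rwa [one_mul, Env.tmul_smul, mul_one] at h

theorem sigma_equivariant_zero : IsEquivariant (R := R)
    (Y := BalTensor (QuadAlg.wt R 0) (QuadAlg R))
    ((BalTensor.mk (QuadAlg.wt R 0)).flip (1 : QuadAlg R) ∘ₗ (proj R).toLinearMap) 0 := by
  intro l m x hl hm hx
  have hm' := proj_mem R hm
  have hx' := proj_mem R hx
  have h : l * x ∈ PathAlg.wt 0 := by
    simpa using wt_mul_le 0 0 (Submodule.mul_mem_mul hl hx)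
  change BalTensor.mk (QuadAlg.wt R 0) (proj R (l * x * m)) (1 : QuadAlg R) =
    Env.tmul F (proj R l) (proj R m) • BalTensor.mk (QuadAlg.wt R 0) (proj R x) (1 : QuadAlg R)
  rw [BalTensor.smul_mk, map_mul (proj R), map_mul (proj R), BalTensor.mk_mul _ _ _ hm', Env.tmul_smul,
    Env.tmul_smul, one_mul, mul_one, one_mul, mul_one]

theorem sigma_equivariant : ∀ p : ℕ, IsEquivariant (R := R) (sigma R p) p
  | 0 => sigma_equivariant_zero R
  | p + 1 => sigmaStep_equivariant (R := R)
      (Y := BalTensor (QuadAlg.wt R 0) (barStage (QuadAlg.wt R 0) (QuadAlg.wt R) p).Y)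
      (sigma_equivariant p)

theorem sigma_isCompat_zero : IsCompat (R := R) (Y := QuadAlg R)
    (BalTensor.act (QuadAlg.wt R 0) (QuadAlg R))
    ((BalTensor.mk (QuadAlg.wt R 0)).flip (1 : QuadAlg R) ∘ₗ (proj R).toLinearMap) 0 := by
  intro x hx
  have hx' := ((mem_W R).1 hx).1
  refine (barStep_sigmaStep _ _ x).trans ?_
  rw [sub_eq_add_neg, zero_add, pow_one, neg_one_smul]
  refine congrArg (_ + -·) ?_
  have h1 : ∀ a : Arrow Q, (lact (proj R (arr a)) : Env F (QuadAlg R)) •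
      BalTensor.act (QuadAlg.wt R 0) (QuadAlg R)
        (BalTensor.mk (F := F) (QuadAlg.wt R 0) (proj R (leftDiv a x)) (1 : QuadAlg R)) =
      proj R (arr a * leftDiv a x) := by
    intro a
    rw [BalTensor.act_mk, Env.tmul_smul, Env.tmul_smul, mul_one, mul_one, mul_one,
      map_mul (proj R)]
  have h2 : ∀ a : Arrow Q, (ract (proj R (arr a)) : Env F (QuadAlg R)) •
      BalTensor.mk (F := F) (QuadAlg.wt R 0) (proj R (rightDiv a x)) (1 : QuadAlg R) =
      BalTensor.mk (QuadAlg.wt R 0) 1 (proj R (rightDiv a x * arr a)) := by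
    intro a
    rw [BalTensor.ract_smul_mk, Env.tmul_smul, one_mul, one_mul,
      mk_one_eq R (proj_mem R (rightDiv_mem a hx')), map_mul (proj R)]
  refine (congrArg (oneTensor R (QuadAlg R)) (Finset.sum_congr rfl fun a _ => h1 a)).trans ?_
  refine Eq.trans ?_ (Finset.sum_congr rfl fun a _ => h2 a).symm
  rw [← map_sum, ← map_sum, ← map_sum, sum_arr_mul_leftDiv hx', sum_rightDiv_mul_arr hx']
  rfl

theorem sigma_isCompat : ∀ p : ℕ, IsCompat (R := R)
    (barStage (QuadAlg.wt R 0) (QuadAlg.wt R) p).d (sigma R p) p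
  | 0 => sigma_isCompat_zero R
  | p + 1 => isCompat_succ (R := R)
      (Y := (barStage (QuadAlg.wt R 0) (QuadAlg.wt R) p).Y) (sigma_isCompat p)

/-- The map `A ⊗_k W_p ⊗_k A → A ⊗_k A^{⊗_k p} ⊗_k A` induced by `W_p ⊆ V^{⊗ p} ⊆ A^{⊗_k p}`. -/
def chiTerm (p : ℕ) : KoszulTerm R p →ₗ[Env F (QuadAlg R)]
    BalTensor (QuadAlg.wt R 0) (barStage (QuadAlg.wt R 0) (QuadAlg.wt R) p).Y :=
  KoszulTerm.lift R p (sigma R p ∘ₗ (W R p).subtype) (by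
    intro l m x y hl hm hy
    have h := sigma_equivariant R p l m x hl hm ((mem_W R).1 x.2).1
    rwa [← hy] at h)

theorem chiTerm_gen (p : ℕ) (x : W R p) : chiTerm R p (KoszulTerm.gen R p x) = sigma R p x :=
  KoszulTerm.lift_gen _ _ _ _ _

section

variable {R} {N N' : Type*} [AddCommGroup N] [Module F N] [Module (Env F (QuadAlg R)) N]
  [IsScalarTower F (Env F (QuadAlg R)) N] [AddCommGroup N'] [Module (Env F (QuadAlg R)) N']

theorem comm_of_gen {p : ℕ} (f : KoszulTerm R p →ₗ[Env F (QuadAlg R)] N)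
    (g : KoszulTerm R (p + 1) →ₗ[Env F (QuadAlg R)] N') (D : N' →ₗ[Env F (QuadAlg R)] N)
    (h : ∀ x : W R (p + 1), D (g (KoszulTerm.gen R (p + 1) x)) =
      ∑ a : Arrow Q, (lact (proj R (arr a)) : Env F (QuadAlg R)) •
        f (KoszulTerm.gen R p (leftDivW R a p x)) +
      (-1 : F) ^ (p + 1) • ∑ a : Arrow Q, (ract (proj R (arr a)) : Env F (QuadAlg R)) •
        f (KoszulTerm.gen R p (rightDivW R a p x))) (z : KoszulTerm R (p + 1)) :
    f (KoszulTerm.d R p z) = D (g z) := by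
  suffices h : f ∘ₗ KoszulTerm.d R p = D ∘ₗ g from LinearMap.congr_fun h z
  refine KoszulTerm.hom_ext fun x => ?_
  have hs (c : F) (z : KoszulTerm R p) : f (c • z) = c • f z :=
    (f.restrictScalars F).map_smul c z
  rw [LinearMap.comp_apply, LinearMap.comp_apply, KoszulTerm.d_gen, KoszulTerm.dGen_apply, h]
  simp only [map_add, hs, map_sum, map_smul]

theorem aug_of_gen (f : KoszulTerm R 0 →ₗ[Env F (QuadAlg R)] N')
    (D : N' →ₗ[Env F (QuadAlg R)] QuadAlg R)
    (h : ∀ x : W R 0, D (f (KoszulTerm.gen R 0 x)) = proj R x) (z : KoszulTerm R 0) :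
    D (f z) = KoszulTerm.aug R z := by
  suffices h : D ∘ₗ f = KoszulTerm.aug R from LinearMap.congr_fun h z
  refine KoszulTerm.hom_ext fun x => ?_
  rw [LinearMap.comp_apply, h, KoszulTerm.aug_gen]

end

/-- The inclusion `χ : K(A) → B(A)` of the Koszul complex in the bar resolution. -/
def chi : (koszulComplex R).Hom (bar R) where
  f p := chiTerm R p
  comm p := comm_of_gen (chiTerm R p) (chiTerm R (p + 1)) _ fun x => by
    refine (congrArg _ (chiTerm_gen R (p + 1) x)).trans ((sigma_isCompat R p x x.2).trans ?_)
    simp only [chiTerm_gen]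
    rfl
  aug := aug_of_gen (chiTerm R 0) _ fun x => by
    refine (congrArg _ (chiTerm_gen R 0 x)).trans ((BalTensor.act_mk _ _ _).trans ?_)
    rw [Env.tmul_smul, mul_one, mul_one]
    rfl

end Differential

end Koszul

section Homology

variable {F : Type w} {A : Type x} [Field F] [Ring A] [Algebra F A]

section Coefficients

variable (M : Type y) [AddCommGroup M] [Module F M] [Module (Env F A) M]
  [IsScalarTower F (Env F A) M]

section TensorHom

variable (N N' : Type x) [AddCommGroup N] [Module F N] [Module (Env F A) N]
  [IsScalarTower F (Env F A) N] [AddCommGroup N'] [Module F N'] [Module (Env F A) N']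
  [IsScalarTower F (Env F A) N']

variable (F A) in
/-- The relations `(b m a) ⊗ n = m ⊗ (a n b)`. -/
def envRel : Submodule F (M ⊗[F] N) :=
  Submodule.span F {z | ∃ (a b : A) (m : M) (n : N),
    z = (Env.tmul F b a • m) ⊗ₜ[F] n - m ⊗ₜ[F] (Env.tmul F a b • n)}

variable (F A) in
/-- The tensor product `M ⊗_{Aᵉ} N` of two `A`-bimodules, where `M` is seen as a right module and
`N` as a left module over the enveloping algebra. -/
abbrev EnvTensor := (M ⊗[F] N) ⧸ envRel F A M N

variable {N N'}

/-- The element `m ⊗ n` of `M ⊗_{Aᵉ} N`. -/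
def EnvTensor.tmul (m : M) (n : N) : EnvTensor F A M N :=
  (envRel F A M N).mkQ (m ⊗ₜ[F] n)

/-- The map `M ⊗_{Aᵉ} f`. -/
def EnvTensor.map (f : N →ₗ[Env F A] N') :
    EnvTensor F A M N →ₗ[F] EnvTensor F A M N' :=
  (envRel F A M N).mapQ (envRel F A M N') ((f.restrictScalars F).lTensor M) (by
    rw [envRel, Submodule.span_le]
    rintro _ ⟨a, b, m, n, rfl⟩
    refine Submodule.subset_span ⟨a, b, m, f n, ?_⟩
    simp)

theorem EnvTensor.map_comp_apply {N'' : Type x} [AddCommGroup N''] [Module F N'']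
    [Module (Env F A) N''] [IsScalarTower F (Env F A) N''] (g : N' →ₗ[Env F A] N'')
    (f : N →ₗ[Env F A] N') (z : EnvTensor F A M N) :
    map M g (map M f z) = map M (g ∘ₗ f) z := by
  obtain ⟨z, rfl⟩ := Submodule.mkQ_surjective _ z
  induction z using TensorProduct.induction_on with
  | zero => simp only [map_zero]
  | add z z' hz hz' => simp only [map_add, hz, hz']
  | tmul m n => rfl

/-- The map `Hom_{Aᵉ}(f, M)`. -/
def precomp (f : N →ₗ[Env F A] N') : (N' →ₗ[Env F A] M) →ₗ[F] (N →ₗ[Env F A] M) where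
  toFun g := g ∘ₗ f
  map_add' _ _ := rfl
  map_smul' _ _ := rfl

end TensorHom

variable (C : BimodComplex F A) {D : BimodComplex F A}

/-- The cycles of degree 2 of `M ⊗_{Aᵉ} C`. -/
def cycles : Submodule F (EnvTensor F A M (C.X 2)) := (EnvTensor.map M (C.d 1)).ker

/-- The boundaries of degree 2 of `M ⊗_{Aᵉ} C`. -/
def boundaries : Submodule F (EnvTensor F A M (C.X 2)) := (EnvTensor.map M (C.d 2)).range

/-- The homology space `H₂(M ⊗_{Aᵉ} C)`. -/
abbrev Homology := cycles M C ⧸ (boundaries M C).submoduleOf (cycles M C)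

/-- The cocycles of degree 2 of `Hom_{Aᵉ}(C, M)`. -/
def cocycles : Submodule F (C.X 2 →ₗ[Env F A] M) := (precomp M (C.d 2)).ker

/-- The coboundaries of degree 2 of `Hom_{Aᵉ}(C, M)`. -/
def coboundaries : Submodule F (C.X 2 →ₗ[Env F A] M) := (precomp M (C.d 1)).range

/-- The cohomology space `H²(Hom_{Aᵉ}(C, M))`. -/
abbrev Cohomology := cocycles M C ⧸ (coboundaries M C).submoduleOf (cocycles M C)

variable {C}

/-- The homology class of a cycle. -/
def homologyClass : cycles M C →ₗ[F] Homology M C := Submodule.mkQ _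

/-- The cohomology class of a cocycle. -/
def cohomologyClass : cocycles M C →ₗ[F] Cohomology M C := Submodule.mkQ _

/-- The map of chains of degree 2 induced by a morphism of complexes. -/
def chainMap (φ : C.Hom D) : EnvTensor F A M (C.X 2) →ₗ[F] EnvTensor F A M (D.X 2) :=
  EnvTensor.map M (φ.f 2)

/-- The map of cochains of degree 2 induced by a morphism of complexes. -/
def cochainMap (φ : C.Hom D) : (D.X 2 →ₗ[Env F A] M) →ₗ[F] (C.X 2 →ₗ[Env F A] M) :=
  precomp M (φ.f 2)

theorem chainMap_map (φ : C.Hom D) (z : EnvTensor F A M (C.X 3)) :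
    chainMap M φ (EnvTensor.map M (C.d 2) z) =
      EnvTensor.map M (D.d 2) (EnvTensor.map M (φ.f 3) z) := by
  rw [chainMap, EnvTensor.map_comp_apply, EnvTensor.map_comp_apply]
  exact congrArg (EnvTensor.map M · z) (LinearMap.ext (φ.comm 2))

theorem map_chainMap (φ : C.Hom D) (z : EnvTensor F A M (C.X 2)) :
    EnvTensor.map M (D.d 1) (chainMap M φ z) =
      EnvTensor.map M (φ.f 1) (EnvTensor.map M (C.d 1) z) := by
  rw [chainMap, EnvTensor.map_comp_apply, EnvTensor.map_comp_apply]
  exact congrArg (EnvTensor.map M · z) (LinearMap.ext (φ.comm 1)).symm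

/-- The map `H₂(M ⊗_{Aᵉ} C) → H₂(M ⊗_{Aᵉ} D)` induced by a morphism of complexes. -/
def homologyMap (φ : C.Hom D) : Homology M C →ₗ[F] Homology M D :=
  Submodule.mapQ _ _ ((chainMap M φ).restrict (p := cycles M C) (q := cycles M D) (by
    intro z hz
    rw [cycles, LinearMap.mem_ker] at hz ⊢
    rw [map_chainMap, hz, map_zero])) (by
    rintro ⟨_, hz⟩ ⟨z, rfl⟩
    exact ⟨EnvTensor.map M (φ.f 3) z, (chainMap_map M φ z).symm⟩)

/-- The map `H²(Hom_{Aᵉ}(D, M)) → H²(Hom_{Aᵉ}(C, M))` induced by a morphism of complexes. -/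
def cohomologyMap (φ : C.Hom D) : Cohomology M D →ₗ[F] Cohomology M C :=
  Submodule.mapQ _ _ ((cochainMap M φ).restrict (p := cocycles M D) (q := cocycles M C) (by
    intro f hf
    rw [cocycles, LinearMap.mem_ker] at hf ⊢
    ext z
    exact (congrArg f (φ.comm 2 z)).trans (LinearMap.congr_fun hf (φ.f 3 z)))) (by
    rintro ⟨_, hf⟩ ⟨f, rfl⟩
    refine ⟨f ∘ₗ φ.f 1, LinearMap.ext fun z => ?_⟩
    exact congrArg f (φ.comm 1 z))

theorem homologyMap_class (φ : C.Hom D) (z : cycles M C) (z' : cycles M D)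
    (h : chainMap M φ z = z') :
    homologyMap M φ (homologyClass M z) = homologyClass M z' :=
  congrArg (homologyClass M) (Subtype.ext h)

theorem cohomologyMap_class (φ : C.Hom D) (f : cocycles M D) (f' : cocycles M C)
    (h : cochainMap M φ f = f') :
    cohomologyMap M φ (cohomologyClass M f) = cohomologyClass M f' :=
  congrArg (cohomologyClass M) (Subtype.ext h)

end Coefficients

section Graded

variable (𝒜 : ℕ → Submodule F A)

/-- The components of `A`, with `A_m = 0` for negative `m`. -/
def intWt (m : ℤ) : Submodule F A := if 0 ≤ m then 𝒜 m.toNat else ⊥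

/-- The component of total weight `t` of `H₂(A ⊗_{Aᵉ} C)`: the classes of the cycles which are
sums of elements `a ⊗ z` where the weights of `a` and `z` have sum `t`. -/
def homologyWt (C : BimodComplex F A) (t : ℕ) : Submodule F (Homology A C) :=
  ((Submodule.span F {z | ∃ (i j : ℕ) (a : A) (y : C.X 2), i + j = t ∧ a ∈ 𝒜 i ∧
    y ∈ C.gr 2 j ∧ z = EnvTensor.tmul A a y}).submoduleOf (cycles A C)).map (homologyClass A)

/-- The cochains of degree 2 and total weight `t`: they raise the weight by `t`. -/
def cochainWt (C : BimodComplex F A) (t : ℤ) : Submodule F (C.X 2 →ₗ[Env F A] A) where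
  carrier := {f | ∀ n : ℕ, ∀ z ∈ C.gr 2 n, f z ∈ intWt 𝒜 (n + t)}
  add_mem' hf hg n z hz := add_mem (hf n z hz) (hg n z hz)
  zero_mem' _ _ _ := zero_mem _
  smul_mem' c _ hf n z hz := Submodule.smul_mem _ c (hf n z hz)

/-- The component of total weight `t` of `H²(Hom_{Aᵉ}(C, A))`. -/
def cohomologyWt (C : BimodComplex F A) (t : ℤ) : Submodule F (Cohomology A C) :=
  ((cochainWt 𝒜 C t).submoduleOf (cocycles A C)).map (cohomologyClass A)

/-- The radical `A₊ N + N A₊` of an `A`-bimodule `N`. -/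
def radical (N : Type x) [AddCommGroup N] [Module F N] [Module (Env F A) N] : Submodule F N :=
  Submodule.span F {z | ∃ (m : ℕ) (a : A) (n : N), 0 < m ∧ a ∈ 𝒜 m ∧
    (z = (lact a : Env F A) • n ∨ z = (ract a : Env F A) • n)}

/-- The complex `P`, with its augmentation, is a minimal projective resolution of `A` in the
category of graded `A`-bimodules. -/
structure IsMinimalResolution (P : BimodComplex F A) : Prop where
  projective : ∀ n, Module.Projective (Env F A) (P.X n)
  isInternal : ∀ n, DirectSum.IsInternal (P.gr n)
  smul_mem : ∀ n i j m, ∀ a ∈ 𝒜 i, ∀ b ∈ 𝒜 j, ∀ z ∈ P.gr n m,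
    Env.tmul F a b • z ∈ P.gr n (i + m + j)
  d_mem : ∀ n m, ∀ z ∈ P.gr (n + 1) m, P.d n z ∈ P.gr n m
  aug_mem : ∀ m, ∀ z ∈ P.gr 0 m, P.aug z ∈ 𝒜 m
  aug_surjective : Function.Surjective P.aug
  exact_zero : Function.Exact (P.d 0) P.aug
  exact_succ : ∀ n, Function.Exact (P.d (n + 1)) (P.d n)
  minimal : ∀ n z, P.d n z ∈ radical 𝒜 (P.X n)

end Graded

end Homology

section Weights

variable {F : Type w} {Q : Type u} [Field F] [Quiver.{v} Q] [Fintype Q]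
  [∀ i j : Q, Fintype (i ⟶ j)] (R : QuadraticRelations F Q)

/-- The component `HK₂(A)_r` of coefficient weight `r`: the classes of the Koszul cycles in
`A_r ⊗_{kᵉ} W₂ ⊆ A ⊗_{Aᵉ} (A ⊗_k W₂ ⊗_k A)`. -/
def koszulHomologyWt (r : ℕ) : Submodule F (Homology (QuadAlg R) (koszulComplex R)) :=
  ((Submodule.span F {z : EnvTensor F (QuadAlg R) (QuadAlg R) ((koszulComplex R).X 2) |
    ∃ (a : QuadAlg R) (x : W R 2), a ∈ QuadAlg.wt R r ∧
      z = EnvTensor.tmul (QuadAlg R) a (KoszulTerm.gen R 2 x)}).submoduleOf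
    (cycles (QuadAlg R) (koszulComplex R))).map (homologyClass (QuadAlg R))

/-- The Koszul cochains `W₂ → A_r` of coefficient weight `r`. -/
def koszulCochainWt (r : ℤ) :
    Submodule F ((koszulComplex R).X 2 →ₗ[Env F (QuadAlg R)] QuadAlg R) where
  carrier := {f | ∀ x : W R 2, f (KoszulTerm.gen R 2 x) ∈ intWt (QuadAlg.wt R) r}
  add_mem' hf hg x := add_mem (hf x) (hg x)
  zero_mem' _ := zero_mem _
  smul_mem' c _ hf x := Submodule.smul_mem _ c (hf x)

/-- The component `HK²(A)_r` of coefficient weight `r`. -/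
def koszulCohomologyWt (r : ℤ) : Submodule F (Cohomology (QuadAlg R) (koszulComplex R)) :=
  ((koszulCochainWt R r).submoduleOf (cocycles (QuadAlg R) (koszulComplex R))).map
    (cohomologyClass (QuadAlg R))

end Weights

end QuadraticQuiver

end

open QuadraticQuiver

/-! The Koszul complex K(A) and a minimal graded resolution P of A agree in degrees 0, 1 and 2, and
in degree 3 they agree in weight 3, the lowest weight that occurs in P_3. The theorem follows from
these two facts.

In degrees up to 2, three properties are used. The kernels of the augmentation and of the
differentials of K(A) lie in the radical (`KoszulTerm.mem_radical_of_aug`,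
`KoszulTerm.mem_radical_of_d`). K(A) is exact in degrees 0 and 1 (`KoszulTerm.exact_aug`,
`KoszulTerm.exact_zero`); in degree 1 this says that R gives all the relations of A, and the proof
builds a derivation of A. Graded versions of Nakayama's lemma (`surjective_of_radical`,
`injective_of_radical`) then turn any homogeneous lift of the identity into isomorphisms in degrees
0, 1, 2 (`IsMinimalResolution.bijective_succ`).

In degree 3, minimality forces P_n to live in weights at least n and makes the differential
injective on the part of weight n (`IsMinimalResolution.eq_zero_of_lt`,
`IsMinimalResolution.eq_zero_of_d`). So an element of weight 3 of P_3 is determined by its image, a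
cycle of weight 3 in A ⊗ R ⊗ A. Such a cycle consists of u in VR and -u in RV, hence u lies in VR ∩
RV = W_3 (`KoszulTerm.exact_one_of_mem`). The same injectivity gives existence and uniqueness of ι.

Consequently M ⊗ K(A) and M ⊗ P have the same cycles in degree 2 but P may have more boundaries,
while the Hom complexes have the same coboundaries but P may have fewer cocycles. This is the
surjectivity, the injectivity, and the description of the kernel and of the image. The bar
resolution is exact with projective terms, because k is separable, so φ is a homotopy equivalence;
φι and χ are two lifts of the identity from a complex of projectives to an exact one, so they induce
the same maps.

For M = A, a boundary of total weight r + 2 ≤ 3 only involves the part of weight 3 of P_3, which is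
already in K(A). Dually, a Koszul cocycle R → A_r, carried to P_2, composes to zero with the
differential out of P_3: in weight 3 by the Koszul condition, and in weight m ≥ 4 because the values
lie in weight m + r - 2 > max.

Minimal resolutions exist because every graded bimodule has a projective cover
(`nonempty_projCover`): a basis of N modulo its radical, adapted to pairs of vertices, prescribes a
direct sum of bimodules A e_i ⊗ e_j A. -/

noncomputable section
namespace QuadraticQuiver

/-! ### Gradings of vector spaces by weights and their projections. -/

section Grading

variable {F : Type*} [Field F] {N N' : Type*} [AddCommGroup N] [Module F N]
  [AddCommGroup N'] [Module F N'] {gr : ℕ → Submodule F N} {gr' : ℕ → Submodule F N'}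

/-- The linear map out of an internally graded space with prescribed values on the components. -/
def wtLift (h : DirectSum.IsInternal gr) (g : ∀ m, gr m →ₗ[F] N') : N →ₗ[F] N' :=
  DirectSum.toModule F ℕ N' g ∘ₗ
    (LinearEquiv.ofBijective (DirectSum.coeLinearMap gr) h).symm.toLinearMap

theorem wtLift_of_mem (h : DirectSum.IsInternal gr) (g : ∀ m, gr m →ₗ[F] N') {m : ℕ} {z : N}
    (hz : z ∈ gr m) : wtLift h g z = g m ⟨z, hz⟩ := by
  have h1 : (LinearEquiv.ofBijective (DirectSum.coeLinearMap gr) h).symm z =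
      DirectSum.lof F ℕ (fun i => gr i) m ⟨z, hz⟩ := by
    rw [LinearEquiv.symm_apply_eq]
    exact (DirectSum.coeLinearMap_lof gr m ⟨z, hz⟩).symm
  rw [wtLift, LinearMap.comp_apply, LinearEquiv.coe_coe, h1, DirectSum.toModule_lof]

open Classical in
/-- The projection of an internally graded space onto the component of weight `m`. -/
def wtProj (h : DirectSum.IsInternal gr) (m : ℕ) : N →ₗ[F] N :=
  wtLift h fun n => if n = m then (gr n).subtype else 0

theorem wtProj_of_mem (h : DirectSum.IsInternal gr) {m : ℕ} {z : N} (hz : z ∈ gr m) :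
    wtProj h m z = z := by
  simp [wtProj, wtLift_of_mem h _ hz]

theorem wtProj_of_ne (h : DirectSum.IsInternal gr) {m n : ℕ} (hmn : m ≠ n) {z : N}
    (hz : z ∈ gr m) : wtProj h n z = 0 := by
  simp [wtProj, wtLift_of_mem h _ hz, hmn]

@[elab_as_elim]
theorem wt_hom_induction (h : DirectSum.IsInternal gr) {P : N → Prop} (z : N) (zero : P 0)
    (add : ∀ z z', P z → P z' → P (z + z')) (mem : ∀ m, ∀ z ∈ gr m, P z) : P z := by
  have hz : z ∈ ⨆ m, gr m := by rw [h.submodule_iSup_eq_top]; trivial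
  exact Submodule.iSup_induction gr (motive := P) hz mem zero add

theorem wtProj_mem (h : DirectSum.IsInternal gr) (m : ℕ) (z : N) : wtProj h m z ∈ gr m := by
  refine wt_hom_induction h z (by simp) (fun z z' hz hz' => by rw [map_add]; exact add_mem hz hz')
    fun n z hz => ?_
  by_cases hn : n = m
  · subst hn; rwa [wtProj_of_mem h hz]
  · rw [wtProj_of_ne h hn hz]; exact zero_mem _

/-- An element is a finite sum of its components, so membership in a subspace can be tested weight
by weight. -/
theorem eq_of_wtProj (h : DirectSum.IsInternal gr) {P : Submodule F N} {z : N}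
    (hz : ∀ m, wtProj h m z ∈ P) : z ∈ P := by
  have : ∃ k, z = ∑ m ∈ Finset.range k, wtProj h m z := by
    -- Asking for every `l ≥ k` makes the bounds of two summands compatible: their maximum serves
    -- both.
    have h2 : ∃ k, ∀ l ≥ k, z = ∑ m ∈ Finset.range l, wtProj h m z := by
      refine wt_hom_induction h z ⟨0, by simp⟩ ?_ ?_
      · rintro z z' ⟨k, hk⟩ ⟨k', hk'⟩
        refine ⟨max k k', fun l hl => ?_⟩
        simp only [map_add, Finset.sum_add_distrib]
        rw [← hk l (le_of_max_le_left hl), ← hk' l (le_of_max_le_right hl)]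
      · intro m z hz
        refine ⟨m + 1, fun l hl => ?_⟩
        rw [Finset.sum_eq_single m, wtProj_of_mem h hz]
        · intro n _ hn
          exact wtProj_of_ne h (Ne.symm hn) hz
        · intro h'; simp at h'; omega
    exact ⟨h2.choose, h2.choose_spec _ le_rfl⟩
  obtain ⟨k, hk⟩ := this
  rw [hk]
  exact Submodule.sum_mem _ fun m _ => hz m

theorem eq_zero_of_wtProj (h : DirectSum.IsInternal gr) {z : N}
    (hz : ∀ m, wtProj h m z = 0) : z = 0 :=
  (Submodule.mem_bot F).1 (eq_of_wtProj h fun m => (Submodule.mem_bot F).2 (hz m))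

theorem linearMap_ext_wt (h : DirectSum.IsInternal gr) {f g : N →ₗ[F] N'}
    (hfg : ∀ m, ∀ z ∈ gr m, f z = g z) : f = g := by
  ext z
  exact wt_hom_induction h z (by simp) (fun z z' hz hz' => by rw [map_add, map_add, hz, hz']) hfg

theorem map_wtProj (h : DirectSum.IsInternal gr) (h' : DirectSum.IsInternal gr')
    (f : N →ₗ[F] N') (hf : ∀ m, ∀ z ∈ gr m, f z ∈ gr' m) (m : ℕ) (z : N) :
    f (wtProj h m z) = wtProj h' m (f z) := by
  refine LinearMap.congr_fun (f := f ∘ₗ wtProj h m) (g := wtProj h' m ∘ₗ f)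
    (linearMap_ext_wt h fun n z hz => ?_) z
  simp only [LinearMap.comp_apply]
  by_cases hn : n = m
  · subst hn; rw [wtProj_of_mem h hz, wtProj_of_mem h' (hf _ _ hz)]
  · rw [wtProj_of_ne h hn hz, wtProj_of_ne h' hn (hf _ _ hz), map_zero]

/-- A criterion for a grading to be internal. -/
theorem isInternal_of_proj (π : ℕ → N →ₗ[F] N') (hinj : ∀ m, ∀ z ∈ gr m, π m z = 0 → z = 0)
    (hne : ∀ m n, m ≠ n → ∀ z ∈ gr m, π n z = 0) (htop : ∀ z, z ∈ ⨆ m, gr m) :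
    DirectSum.IsInternal gr := by
  constructor
  · rw [injective_iff_map_eq_zero]
    intro z hz
    have key : ∀ (z : DirectSum ℕ fun m => gr m) (m : ℕ),
        π m (DirectSum.coeAddMonoidHom gr z) = π m (z m) := by
      intro z m
      induction z using DirectSum.induction_on with
      | zero => simp
      | add z z' hz hz' => simp [map_add, hz, hz']
      | of n z =>
        rw [DirectSum.coeAddMonoidHom_of]
        by_cases h : n = m
        · subst h; rw [DirectSum.of_eq_same]
        · rw [DirectSum.of_eq_of_ne _ _ _ (Ne.symm h), hne n m h z z.2]; simp
    refine DFinsupp.ext fun m => Subtype.ext ?_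
    refine hinj m _ (z m).2 ?_
    rw [← key, hz, map_zero]
  · intro z
    refine Submodule.iSup_induction gr
      (motive := fun z => ∃ a, (DirectSum.coeAddMonoidHom gr) a = z) (htop z) ?_ ?_ ?_
    · intro m z hz
      exact ⟨DirectSum.of (fun m => gr m) m ⟨z, hz⟩, DirectSum.coeAddMonoidHom_of _ _ _⟩
    · exact ⟨0, map_zero _⟩
    · rintro z z' ⟨a, rfl⟩ ⟨b, rfl⟩
      exact ⟨a + b, map_add _ _ _⟩

/-- A homogeneous injection pulls back the independence of the components; only the spanning
property has to be supplied. -/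
theorem isInternal_of_injective (h' : DirectSum.IsInternal gr') (f : N →ₗ[F] N')
    (hinj : Function.Injective f) (hf : ∀ m, ∀ z ∈ gr m, f z ∈ gr' m)
    (htop : ∀ z, z ∈ ⨆ m, gr m) : DirectSum.IsInternal gr := by
  refine isInternal_of_proj (fun m => wtProj h' m ∘ₗ f) ?_ ?_ htop
  · intro m z hz h0
    rw [LinearMap.comp_apply, wtProj_of_mem h' (hf m z hz)] at h0
    exact hinj (h0.trans (map_zero f).symm)
  · intro m n hmn z hz
    exact wtProj_of_ne h' hmn (hf m z hz)

end Grading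

/-! ### Graded bimodules and homogeneous maps. -/

section GradedBimodules

variable {F : Type w} {A : Type x} [Field F] [Ring A] [Algebra F A]
  {𝒜 : ℕ → Submodule F A}

@[elab_as_elim]
theorem env_hom_induction (hA : DirectSum.IsInternal 𝒜) {P : Env F A → Prop} (s : Env F A)
    (add : ∀ s t, P s → P t → P (s + t))
    (tmul : ∀ i j, ∀ a ∈ 𝒜 i, ∀ b ∈ 𝒜 j, P (Env.tmul F a b)) : P s := by
  have h0 : P 0 := by
    have := tmul 0 0 0 (zero_mem _) 0 (zero_mem _)
    rwa [Env.tmul_zero_left] at this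
  induction s using Env.induction with
  | add s t hs ht => exact add s t hs ht
  | tmul a b =>
    refine wt_hom_induction hA (P := fun a => P (Env.tmul F a b)) a ?_ ?_ ?_
    · rwa [Env.tmul_zero_left]
    · intro a a' h h'; rw [Env.tmul_add_left]; exact add _ _ h h'
    intro i a ha
    refine wt_hom_induction hA (P := fun b => P (Env.tmul F a b)) b ?_ ?_ ?_
    · rwa [Env.tmul_zero_right]
    · intro a a' h h'; rw [Env.tmul_add_right]; exact add _ _ h h'
    exact fun j b hb => tmul i j a ha b hb

theorem env_smul_comm {N : Type*} [AddCommGroup N] [Module F N] [Module (Env F A) N]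
    [IsScalarTower F (Env F A) N] (c : F) (s : Env F A) (n : N) : s • c • n = c • s • n :=
  (Algebra.lsmul F F N s).map_smul c n

variable {N N' : Type*} [AddCommGroup N] [Module F N] [Module (Env F A) N]
  [IsScalarTower F (Env F A) N] [AddCommGroup N'] [Module F N'] [Module (Env F A) N']
  [IsScalarTower F (Env F A) N']

variable (𝒜) in
/-- A bimodule graded by weights compatible with those of `A`. -/
structure IsGradedBimod (gr : ℕ → Submodule F N) : Prop where
  isInternal : DirectSum.IsInternal gr
  smul_mem : ∀ i j m, ∀ a ∈ 𝒜 i, ∀ b ∈ 𝒜 j, ∀ z ∈ gr m, Env.tmul F a b • z ∈ gr (i + m + j)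

variable {gr : ℕ → Submodule F N} {gr' : ℕ → Submodule F N'}

theorem wtProj_smul (h : IsGradedBimod 𝒜 gr) {i j : ℕ} {a b : A} (ha : a ∈ 𝒜 i)
    (hb : b ∈ 𝒜 j) (m : ℕ) (z : N) : wtProj h.isInternal (i + m + j) (Env.tmul F a b • z) =
      Env.tmul F a b • wtProj h.isInternal m z := by
  refine wt_hom_induction h.isInternal z (by simp)
    (fun z z' hz hz' => by rw [smul_add, map_add, hz, hz', map_add, smul_add]) ?_
  intro n z hz
  have h1 := h.smul_mem i j n a ha b hb z hz
  by_cases hn : n = m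
  · subst hn
    rw [wtProj_of_mem _ h1, wtProj_of_mem _ hz]
  · rw [wtProj_of_ne _ (by omega) h1, wtProj_of_ne _ hn hz, smul_zero]

/-- Complements `wtProj_smul`: since weights are natural numbers, the components of weight below `i
+ j` are not covered by the form `i + m + j`. -/
theorem wtProj_smul_of_lt (h : IsGradedBimod 𝒜 gr) {i j n : ℕ} {a b : A} (ha : a ∈ 𝒜 i)
    (hb : b ∈ 𝒜 j) (hn : n < i + j) (z : N) :
    wtProj h.isInternal n (Env.tmul F a b • z) = 0 := by
  refine wt_hom_induction h.isInternal z (by simp)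
    (fun z z' hz hz' => by rw [smul_add, map_add, hz, hz', add_zero]) ?_
  intro m z hz
  exact wtProj_of_ne _ (by omega) (h.smul_mem i j m a ha b hb z hz)

/-- The part of weight zero of a map between graded bimodules. -/
theorem exists_weight_zero_part (hA : DirectSum.IsInternal 𝒜) (h : IsGradedBimod 𝒜 gr)
    (h' : IsGradedBimod 𝒜 gr') (f : N →ₗ[Env F A] N') : ∃ g : N →ₗ[Env F A] N',
      ∀ m, ∀ z ∈ gr m, g z = wtProj h'.isInternal m (f z) := by
  let g : N →ₗ[F] N' := wtLift h.isInternal fun m =>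
    wtProj h'.isInternal m ∘ₗ f.restrictScalars F ∘ₗ (gr m).subtype
  have hg (m : ℕ) (z : N) (hz : z ∈ gr m) : g z = wtProj h'.isInternal m (f z) :=
    wtLift_of_mem _ _ hz
  refine ⟨{ toFun := g, map_add' := map_add g, map_smul' := ?_ }, hg⟩
  intro s z
  rw [RingHom.id_apply]
  refine env_hom_induction hA (P := fun s => g (s • z) = s • g z) s
    (fun s t hs ht => by rw [add_smul, map_add, hs, ht, add_smul]) ?_
  intro i j a ha b hb
  refine wt_hom_induction h.isInternal z (by simp)
    (fun z z' hz hz' => by rw [smul_add, map_add, hz, hz', map_add, smul_add]) ?_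
  intro m z hz
  rw [hg _ _ (h.smul_mem i j m a ha b hb z hz), hg m z hz, map_smul, wtProj_smul h' ha hb]

theorem envMap_ext_wt (h : DirectSum.IsInternal gr) {f g : N →ₗ[Env F A] N'}
    (hfg : ∀ m, ∀ z ∈ gr m, f z = g z) : f = g := by
  ext z
  exact wt_hom_induction h z (by simp) (fun z z' hz hz' => by rw [map_add, map_add, hz, hz']) hfg

end GradedBimodules
end QuadraticQuiver
end

noncomputable section
namespace QuadraticQuiver
open PathAlg QuadAlg

/-! ### Weights in the path algebra and scalars at the vertices. -/

section PathGrading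

variable {F : Type w} {Q : Type u} [Field F] [Quiver.{v} Q] [Fintype Q]

variable (F Q) in
open Classical in
theorem PathAlg.isInternal_wt : DirectSum.IsInternal (PathAlg.wt (F := F) (Q := Q)) := by
  let π (m : ℕ) : PathAlg F Q →ₗ[F] PathAlg F Q :=
    PathAlg.lift fun _ _ p => if p.length = m then PathAlg.of p else 0
  refine isInternal_of_proj π ?_ ?_ ?_
  · intro m z hz h0
    have h1 : π m z = z := wt_induction (P := fun z => π m z = z) hz (by simp)
      (fun x y hx hy => by rw [map_add, hx, hy]) (fun c x hx => by rw [map_smul, hx])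
      (fun i j p hp => by simp [π, hp])
    rw [← h1, h0]
  · intro m n hmn z hz
    exact wt_induction (P := fun z => π n z = 0) hz (by simp)
      (fun x y hx hy => by rw [map_add, hx, hy, add_zero])
      (fun c x hx => by rw [map_smul, hx, smul_zero])
      (fun i j p hp => by simp [π, hp, hmn])
  · intro z
    induction z using PathAlg.induction with
    | zero => exact zero_mem _
    | add x y hx hy => exact add_mem hx hy
    | smul c x hx => exact Submodule.smul_mem _ c hx
    | of i j p => exact Submodule.mem_iSup_of_mem p.length (of_mem_wt p)

theorem PathAlg.mul_mem_wt {i j : ℕ} {x y : PathAlg F Q} (hx : x ∈ PathAlg.wt i)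
    (hy : y ∈ PathAlg.wt j) : x * y ∈ PathAlg.wt (i + j) :=
  wt_mul_le i j (Submodule.mul_mem_mul hx hy)

theorem PathAlg.vertex_mul_mem_wt {j : ℕ} {x y : PathAlg F Q} (hx : x ∈ PathAlg.wt 0)
    (hy : y ∈ PathAlg.wt j) : x * y ∈ PathAlg.wt j := by
  have h := PathAlg.mul_mem_wt hx hy
  rwa [zero_add] at h

theorem PathAlg.mul_vertex_mem_wt {j : ℕ} {x y : PathAlg F Q} (hx : x ∈ PathAlg.wt j)
    (hy : y ∈ PathAlg.wt 0) : x * y ∈ PathAlg.wt j := by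
  have h := PathAlg.mul_mem_wt hx hy
  rwa [add_zero] at h

theorem PathAlg.e_mem_wt (i : Q) : (e i : PathAlg F Q) ∈ PathAlg.wt 0 :=
  Submodule.subset_span ⟨i, i, .nil, rfl, rfl⟩

theorem PathAlg.one_mem_wt_zero : (1 : PathAlg F Q) ∈ PathAlg.wt 0 := by
  rw [one_def]
  exact Submodule.sum_mem _ fun i _ => PathAlg.e_mem_wt i

theorem PathAlg.e_mul_e_self (i : Q) : (e i * e i : PathAlg F Q) = e i := e_mul_of _

/-- The algebra k is a product of copies of F indexed by the vertices, so `l` acts on `e i` by its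
coordinate, on either side. All uses of the semisimplicity of k go through these scalars. -/
theorem PathAlg.vertex_scalars {l : PathAlg F Q} (hl : l ∈ PathAlg.wt 0) :
    ∃ c : Q → F, ∀ i, l * e i = c i • e i ∧ e i * l = c i • e i := by
  classical
  refine wt_induction (P := fun l => ∃ c : Q → F, ∀ i, l * e i = c i • e i ∧ e i * l = c i • e i)
    hl ⟨0, by simp⟩ ?_ ?_ ?_
  · rintro x y ⟨c, hc⟩ ⟨c', hc'⟩
    exact ⟨c + c', fun i => by simp [add_mul, mul_add, add_smul, hc, hc']⟩
  · rintro a x ⟨c, hc⟩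
    exact ⟨a • c, fun i => by simp [hc, smul_smul]⟩
  · intro i j p hp
    cases p with
    | cons => simp at hp
    | nil =>
      refine ⟨Pi.single i 1, fun k => ?_⟩
      by_cases h : i = k
      · subst h; simp only [Pi.single_eq_same, one_smul]; exact ⟨of_mul_e _, e_mul_of _⟩
      · rw [Pi.single_eq_of_ne (Ne.symm h), zero_smul]
        exact ⟨of_mul_of_ne _ _ (Ne.symm h), of_mul_of_ne _ _ h⟩

end PathGrading

/-! ### Weights in the quadratic algebra A. -/

namespace QuadAlg

variable {F : Type w} {Q : Type u} [Field F] [Quiver.{v} Q] [Fintype Q]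
  (R : QuadraticRelations F Q)

theorem proj_surjective : Function.Surjective (proj R) := RingCon.mk'_surjective _

section Factor

variable {R} {N : Type*} [AddCommGroup N] [Module F N]

/-- The ideal (R) is additively generated by products `a * r * b`, and by bilinearity the outer
factors may be taken homogeneous. -/
theorem map_eq_zero_of_proj_eq_zero (f : PathAlg F Q →ₗ[F] N)
    (hf : ∀ i j, ∀ a ∈ PathAlg.wt i, ∀ r ∈ R.carrier, ∀ b ∈ PathAlg.wt j, f (a * r * b) = 0)
    {x : PathAlg F Q} (hx : proj R x = 0) : f x = 0 := by
  have h1 : x ∈ TwoSidedIdeal.span (R.carrier : Set (PathAlg F Q)) :=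
    (TwoSidedIdeal.mem_iff _ _).2 ((RingCon.eq _).1 (hx.trans (map_zero (proj R)).symm))
  rw [TwoSidedIdeal.mem_span_iff_mem_addSubgroup_closure] at h1
  refine AddSubgroup.closure_induction (p := fun x _ => f x = 0) ?_ (map_zero f)
    (fun x y _ _ hx hy => by rw [map_add, hx, hy, add_zero])
    (fun x _ hx => by rw [map_neg, hx, neg_zero]) h1
  rintro _ ⟨_, ⟨a, -, r, hr, rfl⟩, b, -, rfl⟩
  change f (a * r * b) = 0
  induction a using wt_hom_induction (PathAlg.isInternal_wt F Q) with
  | zero => simp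
  | add a a' h h' => rw [add_mul, add_mul, map_add, h, h', add_zero]
  | mem i a ha =>
    induction b using wt_hom_induction (PathAlg.isInternal_wt F Q) with
    | zero => simp
    | add a a' h h' => rw [mul_add, map_add, h, h', add_zero]
    | mem j b hb => exact hf i j a ha r hr b hb

theorem exists_factor (f : PathAlg F Q →ₗ[F] N)
    (hf : ∀ i j, ∀ a ∈ PathAlg.wt i, ∀ r ∈ R.carrier, ∀ b ∈ PathAlg.wt j, f (a * r * b) = 0) :
    ∃ g : QuadAlg R →ₗ[F] N, ∀ x, g (proj R x) = f x := by
  -- The factorization is defined through a linear section of the projection; its value does not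
  -- depend on the section, because `f` kills the kernel.
  obtain ⟨s, hs⟩ := (proj R).toLinearMap.exists_rightInverse_of_surjective
    (LinearMap.range_eq_top.2 (proj_surjective R))
  have hs' (a : QuadAlg R) : proj R (s a) = a := LinearMap.congr_fun hs a
  refine ⟨f ∘ₗ s, fun x => ?_⟩
  have h : f (s (proj R x) - x) = 0 := map_eq_zero_of_proj_eq_zero f hf (by
    rw [map_sub, hs', sub_self])
  rwa [map_sub, sub_eq_zero] at h

end Factor

theorem mul_relation_mul_mem {i j : ℕ} {a r b : PathAlg F Q} (ha : a ∈ PathAlg.wt i)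
    (hr : r ∈ R.carrier) (hb : b ∈ PathAlg.wt j) : a * r * b ∈ PathAlg.wt (i + 2 + j) :=
  PathAlg.mul_mem_wt (PathAlg.mul_mem_wt ha (R.le_wt hr)) hb

theorem isInternal_wt : DirectSum.IsInternal (QuadAlg.wt R) := by
  have h (m : ℕ) : ∃ g : QuadAlg R →ₗ[F] QuadAlg R, ∀ x, g (proj R x) =
      proj R (wtProj (PathAlg.isInternal_wt F Q) m x) := by
    refine exists_factor ((proj R).toLinearMap ∘ₗ wtProj (PathAlg.isInternal_wt F Q) m) ?_
    intro i j a ha r hr b hb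
    have h1 := mul_relation_mul_mem R ha hr hb
    by_cases hm : i + 2 + j = m
    · subst hm
      simp [wtProj_of_mem _ h1, proj_eq_zero R hr]
    · simp [wtProj_of_ne _ hm h1]
  choose g hg using h
  refine isInternal_of_proj g ?_ ?_ ?_
  · rintro m _ ⟨x, hx, rfl⟩ h0
    rw [AlgHom.toLinearMap_apply, hg, wtProj_of_mem _ hx] at h0
    exact h0
  · rintro m n hmn _ ⟨x, hx, rfl⟩
    rw [AlgHom.toLinearMap_apply, hg, wtProj_of_ne _ hmn hx, map_zero]
  · intro z
    obtain ⟨x, rfl⟩ := proj_surjective R z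
    induction x using wt_hom_induction (PathAlg.isInternal_wt F Q) with
    | zero => rw [map_zero]; exact zero_mem _
    | add x y hx hy => rw [map_add]; exact add_mem hx hy
    | mem m x hx => exact Submodule.mem_iSup_of_mem m (proj_mem R hx)

variable {R} in
theorem mul_mem_wt {i j : ℕ} {a b : QuadAlg R} (ha : a ∈ QuadAlg.wt R i)
    (hb : b ∈ QuadAlg.wt R j) : a * b ∈ QuadAlg.wt R (i + j) := by
  obtain ⟨x, hx, rfl⟩ := ha
  obtain ⟨y, hy, rfl⟩ := hb
  exact ⟨x * y, PathAlg.mul_mem_wt hx hy, map_mul (proj R) x y⟩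

theorem one_mem_wt : (1 : QuadAlg R) ∈ QuadAlg.wt R 0 :=
  ⟨1, PathAlg.one_mem_wt_zero, map_one (proj R)⟩

theorem isGradedBimod : IsGradedBimod (QuadAlg.wt R) (QuadAlg.wt R) where
  isInternal := isInternal_wt R
  smul_mem i j m a ha b hb z hz := by
    rw [Env.tmul_smul]
    exact mul_mem_wt (mul_mem_wt ha hz) hb

/-- The ideal (R) starts in weight 2, so elements of A of weight 0 and 1 have a unique
representative in the path algebra. -/
theorem exists_lowRep (m : Fin 2) : ∃ g : QuadAlg R →ₗ[F] PathAlg F Q, ∀ x, g (proj R x) =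
    wtProj (PathAlg.isInternal_wt F Q) m x := by
  refine exists_factor (wtProj (PathAlg.isInternal_wt F Q) m) ?_
  intro i j a ha r hr b hb
  exact wtProj_of_ne _ (by omega) (mul_relation_mul_mem R ha hr hb)

/-- The identification of the components of `A` of weight `0` and `1` with those of the path
algebra, composed with the projection onto these components. -/
def lowRep (m : Fin 2) : QuadAlg R →ₗ[F] PathAlg F Q := (exists_lowRep R m).choose

theorem lowRep_proj (m : Fin 2) (x : PathAlg F Q) : lowRep R m (proj R x) =
    wtProj (PathAlg.isInternal_wt F Q) m x := (exists_lowRep R m).choose_spec x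

theorem lowRep_of_mem (m : Fin 2) {x : PathAlg F Q} (hx : x ∈ PathAlg.wt m) :
    lowRep R m (proj R x) = x := by
  rw [lowRep_proj, wtProj_of_mem _ hx]

theorem lowRep_of_ne (m : Fin 2) {n : ℕ} (hn : n ≠ m) {a : QuadAlg R} (ha : a ∈ QuadAlg.wt R n) :
    lowRep R m a = 0 := by
  obtain ⟨x, hx, rfl⟩ := ha
  rw [AlgHom.toLinearMap_apply, lowRep_proj, wtProj_of_ne _ hn hx]

theorem lowRep_mul_vertex (m : Fin 2) {l : PathAlg F Q} (hl : l ∈ PathAlg.wt 0) (a : QuadAlg R) :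
    lowRep R m (a * proj R l) = lowRep R m a * l := by
  obtain ⟨x, rfl⟩ := proj_surjective R a
  rw [← map_mul (proj R), lowRep_proj, lowRep_proj]
  induction x using wt_hom_induction (PathAlg.isInternal_wt F Q) with
  | zero => simp
  | add x y hx hy => simp only [add_mul, map_add, hx, hy]
  | mem n x hx =>
    have h : x * l ∈ PathAlg.wt n := PathAlg.mul_vertex_mem_wt hx hl
    by_cases hn : n = m
    · subst hn; rw [wtProj_of_mem _ h, wtProj_of_mem _ hx]
    · rw [wtProj_of_ne _ hn h, wtProj_of_ne _ hn hx, zero_mul]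

theorem lowRep_vertex_mul (m : Fin 2) {l : PathAlg F Q} (hl : l ∈ PathAlg.wt 0) (a : QuadAlg R) :
    lowRep R m (proj R l * a) = l * lowRep R m a := by
  obtain ⟨x, rfl⟩ := proj_surjective R a
  rw [← map_mul (proj R), lowRep_proj, lowRep_proj]
  induction x using wt_hom_induction (PathAlg.isInternal_wt F Q) with
  | zero => simp
  | add x y hx hy => rw [mul_add, map_add, hx, hy, map_add, mul_add]
  | mem n x hx =>
    have h : l * x ∈ PathAlg.wt n := PathAlg.vertex_mul_mem_wt hl hx
    by_cases hn : n = m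
    · subst hn; rw [wtProj_of_mem _ h, wtProj_of_mem _ hx]
    · rw [wtProj_of_ne _ hn h, wtProj_of_ne _ hn hx, mul_zero]

theorem sum_proj_e : ∑ i : Q, proj R (e i) = 1 := by
  rw [← map_sum, ← PathAlg.one_def, map_one]

/-- A sum of tensors over the vertices, as a consequence of the semisimplicity of `k`. -/
theorem sum_vertex_balanced {N N' : Type*} [AddCommGroup N] [Module F N] [AddCommGroup N']
    [Module F N'] [Module (Env F (QuadAlg R)) N'] [IsScalarTower F (Env F (QuadAlg R)) N']
    (f : QuadAlg R →ₗ[F] N' →ₗ[F] N) (a : QuadAlg R) {l : QuadAlg R} (hl : l ∈ QuadAlg.wt R 0)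
    (y : N') :
    ∑ i : Q, f (a * l * proj R (e i)) ((lact (proj R (e i)) : Env F (QuadAlg R)) • y) =
    ∑ i : Q, f (a * proj R (e i))
      ((lact (proj R (e i)) : Env F (QuadAlg R)) • (lact l : Env F (QuadAlg R)) • y) := by
  obtain ⟨l, hl, rfl⟩ := hl
  obtain ⟨c, hc⟩ := PathAlg.vertex_scalars hl
  refine Finset.sum_congr rfl fun i _ => ?_
  have h1 : proj R l * proj R (e i) = c i • proj R (e i) := by
    rw [← map_mul (proj R), (hc i).1, map_smul (proj R)]
  have h2 : proj R (e i) * proj R l = c i • proj R (e i) := by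
    rw [← map_mul (proj R), (hc i).2, map_smul (proj R)]
  rw [AlgHom.toLinearMap_apply, smul_smul, ← Env.lact_mul, mul_assoc, h1, h2, mul_smul_comm,
    lact, lact, Env.tmul_smul_left, smul_assoc (c i), map_smul f, LinearMap.smul_apply,
    map_smul (f _)]

end QuadAlg
end QuadraticQuiver
end

noncomputable section
namespace QuadraticQuiver
open PathAlg QuadAlg

/-! ### The grading of the enveloping algebra. -/

section EnvGrading

variable {F : Type w} {A : Type x} [Field F] [Ring A] [Algebra F A]

variable (F A) in
/-- The universal bilinear map to the enveloping algebra. -/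
def Env.tmulBil : A →ₗ[F] A →ₗ[F] Env F A :=
  LinearMap.mk₂ F (Env.tmul F) Env.tmul_add_left Env.tmul_smul_left Env.tmul_add_right
    (fun c a b => Env.tmul_smul_right c a b)

theorem Env.tmulBil_apply (a b : A) : Env.tmulBil F A a b = Env.tmul F a b := rfl

/-- The linear map out of the enveloping algebra given by a bilinear map. -/
def Env.liftLinear {N : Type*} [AddCommGroup N] [Module F N] (f : A →ₗ[F] A →ₗ[F] N) :
    Env F A →ₗ[F] N :=
  (TensorProduct.lift (f.compl₂ (opLinearEquiv F).symm.toLinearMap) : A ⊗[F] Aᵐᵒᵖ →ₗ[F] N)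

theorem Env.liftLinear_tmul {N : Type*} [AddCommGroup N] [Module F N]
    (f : A →ₗ[F] A →ₗ[F] N) (a b : A) : Env.liftLinear f (Env.tmul F a b) = f a b :=
  TensorProduct.lift.tmul _ _

variable {𝒜 : ℕ → Submodule F A}

variable (𝒜) in
/-- The grading of the enveloping algebra by the total weight. -/
def envGr (n : ℕ) : Submodule F (Env F A) :=
  Submodule.span F {s | ∃ (i j : ℕ) (a b : A), i + j = n ∧ a ∈ 𝒜 i ∧ b ∈ 𝒜 j ∧
    s = Env.tmul F a b}

theorem tmul_mem_envGr {i j : ℕ} {a b : A} (ha : a ∈ 𝒜 i) (hb : b ∈ 𝒜 j) :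
    Env.tmul F a b ∈ envGr 𝒜 (i + j) :=
  Submodule.subset_span ⟨i, j, a, b, rfl, ha, hb, rfl⟩

theorem envGr_isInternal (hA : DirectSum.IsInternal 𝒜) : DirectSum.IsInternal (envGr 𝒜) := by
  let π (n : ℕ) : Env F A →ₗ[F] Env F A := ∑ ij ∈ Finset.HasAntidiagonal.antidiagonal n,
    Env.liftLinear ((Env.tmulBil F A).compl₁₂ (wtProj hA ij.1) (wtProj hA ij.2))
  have hπ (n : ℕ) (a b : A) : π n (Env.tmul F a b) = ∑ ij ∈ Finset.HasAntidiagonal.antidiagonal n,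
      Env.tmul F (wtProj hA ij.1 a) (wtProj hA ij.2 b) := by
    rw [LinearMap.sum_apply]
    exact Finset.sum_congr rfl fun ij _ => Env.liftLinear_tmul _ _ _
  refine isInternal_of_proj π ?_ ?_ ?_
  · intro n z hz h0
    suffices h : π n z = z by rw [← h, h0]
    refine Submodule.span_induction (p := fun z _ => π n z = z) ?_ (map_zero _)
      (fun x y _ _ hx hy => by rw [map_add, hx, hy]) (fun c x _ hx => by rw [map_smul, hx]) hz
    rintro _ ⟨i, j, a, b, rfl, ha, hb, rfl⟩
    rw [hπ, Finset.sum_eq_single (i, j), wtProj_of_mem hA ha, wtProj_of_mem hA hb]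
    · rintro ⟨k, l⟩ - h
      by_cases hk : i = k
      · subst hk
        rw [wtProj_of_ne hA (fun h' => h (by rw [h'])) hb, Env.tmul_zero_right]
      · rw [wtProj_of_ne hA hk ha, Env.tmul_zero_left]
    · simp
  · intro m n hmn z hz
    refine Submodule.span_induction (p := fun z _ => π n z = 0) ?_ (map_zero _)
      (fun x y _ _ hx hy => by rw [map_add, hx, hy, add_zero])
      (fun c x _ hx => by rw [map_smul, hx, smul_zero]) hz
    rintro _ ⟨i, j, a, b, rfl, ha, hb, rfl⟩
    rw [hπ]
    refine Finset.sum_eq_zero fun ⟨k, l⟩ hkl => ?_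
    rw [Finset.HasAntidiagonal.mem_antidiagonal] at hkl
    by_cases hk : i = k
    · rw [wtProj_of_ne hA (fun h' => hmn (by rw [← hkl, hk, h'])) hb, Env.tmul_zero_right]
    · rw [wtProj_of_ne hA hk ha, Env.tmul_zero_left]
  · intro z
    induction z using env_hom_induction hA with
    | add s t hs ht => exact add_mem hs ht
    | tmul i j a ha b hb => exact Submodule.mem_iSup_of_mem (i + j) (tmul_mem_envGr ha hb)

theorem env_isGradedBimod (h : IsGradedBimod 𝒜 𝒜) (h1 : (1 : A) ∈ 𝒜 0) :
    IsGradedBimod 𝒜 (envGr 𝒜) where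
  isInternal := envGr_isInternal h.isInternal
  smul_mem i j m a ha b hb z hz := by
    refine Submodule.span_induction (p := fun z _ => Env.tmul F a b • z ∈ envGr 𝒜 (i + m + j))
      ?_ (by simp) (fun x y _ _ hx hy => by rw [smul_add]; exact add_mem hx hy)
      (fun c x _ hx => by rw [env_smul_comm]; exact Submodule.smul_mem _ c hx) hz
    rintro _ ⟨k, l, c, d, rfl, hc, hd, rfl⟩
    rw [smul_eq_mul, Env.tmul_mul_tmul]
    have h2 := h.smul_mem i 0 k a ha 1 h1 c hc
    have h3 := h.smul_mem l 0 j d hd 1 h1 b hb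
    rw [Env.tmul_smul, mul_one] at h2 h3
    have h4 := tmul_mem_envGr h2 h3
    rwa [show i + k + 0 + (l + j + 0) = i + (k + l) + j by omega] at h4

end EnvGrading

/-! ### Projectivity and grading of the terms of K(A). -/

namespace KoszulTerm

variable {F : Type w} {Q : Type u} [Field F] [Quiver.{v} Q] [Fintype Q]
  [∀ i j : Q, Fintype (i ⟶ j)] (R : QuadraticRelations F Q) (p : ℕ)

/-- The map `x ↦ eᵢ x eⱼ` of `W_p`. -/
def cut (i j : Q) : W R p →ₗ[F] W R p :=
  (LinearMap.mulLeft F (e i : PathAlg F Q) ∘ₗ LinearMap.mulRight F (e j : PathAlg F Q)).restrict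
    fun x hx => by
      have h := W_mul_mem R (PathAlg.e_mem_wt i) (PathAlg.e_mem_wt j) hx
      rwa [mul_assoc] at h

theorem coe_cut (i j : Q) (x : W R p) : (cut R p i j x : PathAlg F Q) = e i * (x : PathAlg F Q) * e j :=
  (mul_assoc _ _ _).symm

theorem tmul_vertex {l m : PathAlg F Q} {i j : Q} {c d : F} (hl : l * e i = c • e i)
    (hm : e j * m = d • e j) :
    Env.tmul F (proj R l) (proj R m) * Env.tmul F (proj R (e i)) (proj R (e j)) =
      (c * d) • Env.tmul F (proj R (e i)) (proj R (e j)) := by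
  rw [Env.tmul_mul_tmul, ← map_mul (proj R), ← map_mul (proj R), hl, hm, map_smul (proj R),
    map_smul (proj R), Env.tmul_smul_left, Env.tmul_smul_right, smul_smul]

/-- The embedding of `A ⊗_k W_p ⊗_k A` in `A ⊗ W_p ⊗ A` given by the idempotents of the
vertices. -/
def split : KoszulTerm R p →ₗ[Env F (QuadAlg R)] Env F (QuadAlg R) ⊗[F] W R p :=
  lift R p (∑ i : Q, ∑ j : Q, TensorProduct.mk F (Env F (QuadAlg R)) (W R p)
      (Env.tmul F (proj R (e i)) (proj R (e j))) ∘ₗ cut R p i j) (by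
    intro l m x y hl hm hy
    obtain ⟨c, hc⟩ := PathAlg.vertex_scalars hl
    obtain ⟨d, hd⟩ := PathAlg.vertex_scalars hm
    simp only [LinearMap.sum_apply, LinearMap.comp_apply, TensorProduct.mk_apply, Finset.smul_sum]
    refine Finset.sum_congr rfl fun i _ => Finset.sum_congr rfl fun j _ => ?_
    have h1 : cut R p i j y = (c i * d j) • cut R p i j x := by
      refine Subtype.ext ?_
      rw [Submodule.coe_smul, coe_cut, coe_cut, hy, ← mul_assoc, ← mul_assoc, (hc i).2, mul_assoc,
        (hd j).1, mul_smul_comm, smul_mul_assoc, smul_mul_assoc, smul_smul, mul_comm]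
    rw [h1, TensorProduct.smul_tmul', smul_eq_mul, tmul_vertex R (hc i).1 (hd j).2,
      TensorProduct.smul_tmul])

theorem split_gen (x : W R p) : split R p (gen R p x) =
    ∑ i : Q, ∑ j : Q, Env.tmul F (proj R (e i)) (proj R (e j)) ⊗ₜ[F] cut R p i j x := by
  rw [split, lift_gen]
  simp only [LinearMap.sum_apply, LinearMap.comp_apply, TensorProduct.mk_apply]

theorem mkQ_tmul (s : Env F (QuadAlg R)) (x : W R p) :
    ((koszulRel R p).mkQ (s ⊗ₜ[F] x) : KoszulTerm R p) = s • gen R p x := by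
  symm
  change (koszulRel R p).mkQ (s • ((1 : Env F (QuadAlg R)) ⊗ₜ[F] x)) = _
  rw [TensorProduct.smul_tmul', smul_eq_mul, mul_one]

theorem sum_sum_tmul_e : ∑ i : Q, ∑ j : Q, Env.tmul F (proj R (e i)) (proj R (e j)) =
    (1 : Env F (QuadAlg R)) := by
  simp only [← Env.tmulBil_apply, ← map_sum, ← LinearMap.sum_apply]
  rw [← PathAlg.one_def, map_one (proj R)]
  rfl

/-- The projection of `A ⊗ W_p ⊗ A` onto `A ⊗_k W_p ⊗_k A`. -/
def collapse : Env F (QuadAlg R) ⊗[F] W R p →ₗ[Env F (QuadAlg R)] KoszulTerm R p :=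
  (koszulRel R p).mkQ

/-- The element Σ e_i ⊗ e_j is the unit of the enveloping algebra, so cutting `x` into the pieces
e_i x e_j and gluing them again gives `x`. Thus the Koszul term is a direct summand of the free
module on `W R p`. -/
theorem collapse_comp_split : collapse R p ∘ₗ split R p = LinearMap.id := by
  refine hom_ext fun x => ?_
  rw [LinearMap.comp_apply, split_gen]
  simp only [map_sum]
  have h (i j : Q) : collapse R p
      (Env.tmul F (proj R (e i)) (proj R (e j)) ⊗ₜ[F] cut R p i j x) =
      Env.tmul F (proj R (e i)) (proj R (e j)) • gen R p x := by
    refine (mkQ_tmul R p _ _).trans ?_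
    rw [gen_rel R p (PathAlg.e_mem_wt i) (PathAlg.e_mem_wt j) x (cut R p i j x) (coe_cut R p i j x),
      smul_smul, Env.tmul_mul_tmul, ← map_mul (proj R), ← map_mul (proj R), PathAlg.e_mul_e_self,
      PathAlg.e_mul_e_self]
  simp only [h, ← Finset.sum_smul]
  rw [sum_sum_tmul_e R, one_smul, LinearMap.id_apply]

theorem split_injective : Function.Injective (split R p) :=
  Function.LeftInverse.injective (LinearMap.congr_fun (collapse_comp_split R p))

theorem projective : Module.Projective (Env F (QuadAlg R)) (KoszulTerm R p) :=
  Module.Projective.of_split _ _ (collapse_comp_split R p)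

/-- The grading of `A ⊗_k W_p ⊗_k A` by the total weight. -/
def gr (m : ℕ) : Submodule F (KoszulTerm R p) :=
  Submodule.span F {z | ∃ (i j : ℕ) (a b : QuadAlg R) (x : W R p), i + p + j = m ∧
    a ∈ QuadAlg.wt R i ∧ b ∈ QuadAlg.wt R j ∧ z = Env.tmul F a b • KoszulTerm.gen R p x}

/-- Independence of the components is checked after the embedding `split` into `Env ⊗ W R p`, where
the weight can be read on the first factor. -/
theorem gr_isInternal : DirectSum.IsInternal (gr R p) := by
  let hE := envGr_isInternal (QuadAlg.isInternal_wt R)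
  -- `W R p` contributes weight `p`, so the enveloping algebra contributes `n - p`. The case `n < p`
  -- has to be excluded, since truncated subtraction would return the component of weight 0.
  let π (n : ℕ) : KoszulTerm R p →ₗ[F] Env F (QuadAlg R) ⊗[F] W R p :=
    if p ≤ n then (wtProj hE (n - p)).rTensor (W R p) ∘ₗ (split R p).restrictScalars F else 0
  have key (i j : ℕ) (a b : QuadAlg R) (x : W R p) (ha : a ∈ QuadAlg.wt R i)
      (hb : b ∈ QuadAlg.wt R j) (n : ℕ) :
      π n (Env.tmul F a b • gen R p x) =
        if i + p + j = n then split R p (Env.tmul F a b • gen R p x) else 0 := by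
    have h2 (k l : Q) : Env.tmul F a b * Env.tmul F (proj R (e k)) (proj R (e l)) ∈
        envGr (QuadAlg.wt R) (i + j) := by
      rw [Env.tmul_mul_tmul]
      have h3 := QuadAlg.mul_mem_wt ha (proj_mem R (PathAlg.e_mem_wt k))
      have h4 := QuadAlg.mul_mem_wt (proj_mem R (PathAlg.e_mem_wt l)) hb
      rw [add_zero] at h3
      rw [zero_add] at h4
      exact tmul_mem_envGr h3 h4
    by_cases hp : p ≤ n
    · simp only [π, if_pos hp, LinearMap.comp_apply, LinearMap.restrictScalars_apply, map_smul,
        split_gen, Finset.smul_sum, TensorProduct.smul_tmul', smul_eq_mul, map_sum,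
        LinearMap.rTensor_tmul]
      split_ifs with h
      · refine Finset.sum_congr rfl fun k _ => Finset.sum_congr rfl fun l _ => ?_
        rw [show n - p = i + j by omega, wtProj_of_mem hE (h2 k l)]
      · refine Finset.sum_eq_zero fun k _ => Finset.sum_eq_zero fun l _ => ?_
        rw [wtProj_of_ne hE (by omega) (h2 k l), TensorProduct.zero_tmul]
    · rw [if_neg (by omega)]
      simp only [π, if_neg hp, LinearMap.zero_apply]
  refine isInternal_of_proj π ?_ ?_ ?_
  · intro n z hz h0
    suffices h : π n z = split R p z from
      split_injective R p ((h.symm.trans h0).trans (map_zero _).symm)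
    refine Submodule.span_induction (p := fun z _ => π n z = split R p z) ?_
      ((map_zero _).trans (map_zero _).symm)
      (fun x y _ _ hx hy => (map_add _ x y).trans ((congrArg₂ (· + ·) hx hy).trans
        (map_add _ x y).symm))
      (fun c x _ hx => (map_smul _ c x).trans ((congrArg (c • ·) hx).trans
        (((split R p).restrictScalars F).map_smul c x).symm)) hz
    rintro _ ⟨i, j, a, b, x, h, ha, hb, rfl⟩
    exact (key i j a b x ha hb n).trans (if_pos h)
  · intro m n hmn z hz
    refine Submodule.span_induction (p := fun z _ => π n z = 0) ?_ (map_zero _)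
      (fun x y _ _ hx hy => (map_add _ x y).trans (by rw [hx, hy, add_zero]))
      (fun c x _ hx => (map_smul _ c x).trans (by rw [hx, smul_zero])) hz
    rintro _ ⟨i, j, a, b, x, h, ha, hb, rfl⟩
    exact (key i j a b x ha hb n).trans (if_neg (by omega))
  · intro z
    refine KoszulTerm.induction R p (P := fun z => z ∈ ⨆ m, gr R p m) z
      (zero_mem _) (fun x y hx hy => add_mem hx hy) ?_
    intro s x
    induction s using env_hom_induction (QuadAlg.isInternal_wt R) with
    | add s t hs ht => rw [add_smul]; exact add_mem hs ht
    | tmul i j a ha b hb =>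
      exact Submodule.mem_iSup_of_mem (i + p + j)
        (Submodule.subset_span ⟨i, j, a, b, x, rfl, ha, hb, rfl⟩)

theorem isGradedBimod : IsGradedBimod (QuadAlg.wt R) (gr R p) where
  isInternal := gr_isInternal R p
  smul_mem i j m a ha b hb z hz := by
    refine Submodule.span_induction
      (p := fun z _ => Env.tmul F a b • z ∈ gr R p (i + m + j))
      ?_ (by simp) (fun x y _ _ hx hy => by rw [smul_add]; exact add_mem hx hy)
      (fun c x _ hx => by rw [env_smul_comm]; exact Submodule.smul_mem _ c hx) hz
    rintro _ ⟨k, l, c, d, x, rfl, hc, hd, rfl⟩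
    rw [smul_smul, Env.tmul_mul_tmul]
    exact Submodule.subset_span ⟨i + k, l + j, a * c, d * b, x, by omega,
      QuadAlg.mul_mem_wt ha hc, QuadAlg.mul_mem_wt hd hb, rfl⟩

/-- The projection of `A ⊗_k W_p ⊗_k A` onto `A_i ⊗_k W_p ⊗_k A_j` for `i, j ≤ 1`, followed by the
map to the path algebra. -/
def low (i j : Fin 2) : KoszulTerm R p →ₗ[F] PathAlg F Q :=
  TensorProduct.lift ((Env.liftLinear (LinearMap.mk₂ F (fun a b =>
      LinearMap.mulLeft F (lowRep R i a) ∘ₗ LinearMap.mulRight F (lowRep R j b))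
    (fun a a' b => by ext; simp [add_mul]) (fun c a b => by ext; simp)
    (fun a b b' => by ext; simp [mul_add]) (fun c a b => by ext; simp))).compl₂
      (W R p).subtype : Env F (QuadAlg R) →ₗ[F] W R p →ₗ[F] PathAlg F Q) ∘ₗ (split R p).restrictScalars F

theorem low_tmul (i j : Fin 2) (a b : QuadAlg R) (x : W R p) :
    low R p i j (Env.tmul F a b • gen R p x) = lowRep R i a * x * lowRep R j b := by
  simp only [low, LinearMap.comp_apply, LinearMap.restrictScalars_apply, map_smul, split_gen,
    Finset.smul_sum, map_sum, TensorProduct.smul_tmul', smul_eq_mul, Env.tmul_mul_tmul,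
    TensorProduct.lift.tmul, LinearMap.compl₂_apply, Env.liftLinear_tmul, LinearMap.mk₂_apply,
    LinearMap.mulLeft_apply, LinearMap.mulRight_apply, Submodule.subtype_apply, coe_cut,
    lowRep_mul_vertex R i (PathAlg.e_mem_wt _), lowRep_vertex_mul R j (PathAlg.e_mem_wt _)]
  -- The idempotents coming from `split` and from `cut` merge; their sums over the vertices are then
  -- 1.
  have h (k : Q) (y : PathAlg F Q) : e k * (e k * y) = e k * y := by
    rw [← mul_assoc, PathAlg.e_mul_e_self]
  simp only [mul_assoc, h]
  simp only [← Finset.mul_sum, ← Finset.sum_mul, ← PathAlg.one_def, one_mul]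

end KoszulTerm
end QuadraticQuiver
end

noncomputable section
namespace QuadraticQuiver
open PathAlg QuadAlg

/-! ### Additivity of the left and right actions. -/

section Actions

variable {F : Type w} {A : Type x} [Field F] [Ring A] [Algebra F A]

theorem Env.lact_zero : (lact (0 : A) : Env F A) = 0 := Env.tmul_zero_left _
theorem Env.ract_zero : (ract (0 : A) : Env F A) = 0 := Env.tmul_zero_right _
theorem Env.lact_add (a b : A) : (lact (a + b) : Env F A) = lact a + lact b :=
  Env.tmul_add_left _ _ _
theorem Env.ract_add (a b : A) : (ract (a + b) : Env F A) = ract a + ract b :=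
  Env.tmul_add_right _ _ _
theorem Env.lact_smul (c : F) (a : A) : (lact (c • a) : Env F A) = c • lact a :=
  Env.tmul_smul_left _ _ _
theorem Env.ract_smul (c : F) (a : A) : (ract (c • a) : Env F A) = c • ract a :=
  Env.tmul_smul_right _ _ _

end Actions

/-! ### Derivations with prescribed values on arrows. -/

section Derivation

variable {F : Type w} {Q : Type u} [Field F] [Quiver.{v} Q] [Fintype Q]
  [∀ i j : Q, Fintype (i ⟶ j)] {R : QuadraticRelations F Q}
  {N : Type*} [AddCommGroup N] [Module F N] [Module (Env F (QuadAlg R)) N]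
  [IsScalarTower F (Env F (QuadAlg R)) N]

variable (R) in
/-- The value on a path of the derivation of the path algebra with prescribed values on arrows. -/
def pathDer (g : PathAlg F Q →ₗ[F] N) {i : Q} : ∀ {j : Q}, Quiver.Path i j → N
  | _, .nil => 0
  | _, .cons q b => (ract (proj R (of q)) : Env F (QuadAlg R)) • g (of b.toPath) +
      (lact (proj R (of b.toPath)) : Env F (QuadAlg R)) • pathDer g q

variable (R) in
/-- The derivation of the path algebra with prescribed values on arrows. -/
def derivation (g : PathAlg F Q →ₗ[F] N) : PathAlg F Q →ₗ[F] N :=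
  PathAlg.lift fun _ _ p => pathDer R g p

variable (R) in
/-- Compatibility with the actions of `k` of a map on the span of the arrows. -/
def IsVertexLinear (g : PathAlg F Q →ₗ[F] N) : Prop :=
  ∀ l ∈ PathAlg.wt 0, ∀ x ∈ PathAlg.wt 1,
    g (l * x) = (lact (proj R l) : Env F (QuadAlg R)) • g x ∧
    g (x * l) = (ract (proj R l) : Env F (QuadAlg R)) • g x

variable {g : PathAlg F Q →ₗ[F] N}

theorem of_toPath_mem {i j : Q} (b : i ⟶ j) : (of b.toPath : PathAlg F Q) ∈ PathAlg.wt 1 :=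
  of_mem_wt b.toPath

/-- The derivative of a path keeps its endpoints. This is what makes the Leibniz rule hold for paths
that cannot be composed, where each of its two terms must vanish. -/
theorem lact_e_pathDer (hg : IsVertexLinear R g) {i j : Q} (p : Quiver.Path i j) :
    (lact (proj R (e j)) : Env F (QuadAlg R)) • pathDer R g p = pathDer R g p := by
  cases p with
  | nil => exact smul_zero _
  | cons q b =>
    rw [pathDer, smul_add, smul_smul, smul_smul, Env.lact_mul_ract, ← Env.ract_mul_lact, mul_smul,
      ← (hg _ (PathAlg.e_mem_wt _) _ (of_toPath_mem b)).1, ← Env.lact_mul, ← map_mul (proj R),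
      e_mul_of]

theorem ract_e_pathDer (hg : IsVertexLinear R g) {i j : Q} (p : Quiver.Path i j) :
    (ract (proj R (e i)) : Env F (QuadAlg R)) • pathDer R g p = pathDer R g p := by
  induction p with
  | nil => exact smul_zero _
  | cons q b ih =>
    rw [pathDer, smul_add, smul_smul, smul_smul, Env.ract_mul_lact, ← Env.lact_mul_ract, mul_smul _ _ (pathDer R g q),
      ih, ← Env.ract_mul, ← map_mul (proj R), of_mul_e]

theorem derivation_of_mul_of (hg : IsVertexLinear R g) {i j k l : Q} (p : Quiver.Path k l)
    (q : Quiver.Path i j) : derivation R g (of p * of q) =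
      (lact (proj R (of p)) : Env F (QuadAlg R)) • derivation R g (of q) +
      (ract (proj R (of q)) : Env F (QuadAlg R)) • derivation R g (of p) := by
  simp only [derivation, PathAlg.lift_of]
  by_cases h : j = k
  · subst h
    rw [of_mul_of_comp, PathAlg.lift_of]
    induction p with
    | nil =>
      rw [Quiver.Path.comp_nil, pathDer, smul_zero, add_zero]
      exact (lact_e_pathDer hg q).symm
    | cons p b ih =>
      rw [Quiver.Path.comp_cons, pathDer, ih, pathDer, ← of_mul_of_comp p q,
        show (of (p.cons b) : PathAlg F Q) = of b.toPath * of p from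
          (of_mul_of_comp b.toPath p).symm,
        map_mul (proj R), map_mul (proj R)]
      simp only [smul_add, smul_smul, Env.lact_mul, Env.ract_mul, Env.lact_mul_ract,
        Env.ract_mul_lact]
      abel
  -- For paths that do not compose, inserting the endpoint idempotent of one factor next to the
  -- other path produces a zero product in each term.
  · rw [of_mul_of_ne _ _ h, map_zero, ← lact_e_pathDer hg q, ← ract_e_pathDer hg p, smul_smul,
      smul_smul, ← Env.lact_mul, ← Env.ract_mul, ← map_mul (proj R), ← map_mul (proj R), e, e,
      of_mul_of_ne _ _ h, of_mul_of_ne _ _ h, map_zero (proj R), Env.lact_zero,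
      Env.ract_zero, zero_smul, zero_smul, add_zero]

theorem derivation_mul (hg : IsVertexLinear R g) (x y : PathAlg F Q) :
    derivation R g (x * y) =
      (lact (proj R x) : Env F (QuadAlg R)) • derivation R g y +
      (ract (proj R y) : Env F (QuadAlg R)) • derivation R g x := by
  induction x using PathAlg.induction with
  | zero => simp [Env.lact_zero]
  | add x x' h h' =>
    rw [add_mul, map_add, h, h', map_add (proj R), Env.lact_add, add_smul, map_add,
      smul_add]
    abel
  | smul c x h =>
    rw [smul_mul_assoc, map_smul, h, map_smul (proj R), Env.lact_smul, smul_assoc,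
      map_smul, env_smul_comm c, smul_add]
  | of i j p =>
  induction y using PathAlg.induction with
  | zero => simp [Env.ract_zero]
  | add x x' h h' =>
    rw [mul_add, map_add, h, h', map_add (proj R), Env.ract_add, add_smul, map_add,
      smul_add]
    abel
  | smul c x h =>
    rw [mul_smul_comm, map_smul, h, map_smul (proj R), Env.ract_smul, smul_assoc,
      map_smul, env_smul_comm c, smul_add]
  | of k l q => exact derivation_of_mul_of hg p q

theorem derivation_vertex {l : PathAlg F Q} (hl : l ∈ PathAlg.wt 0) :
    derivation R g l = 0 := by
  refine wt_induction (P := fun l => derivation R g l = 0) hl (map_zero _)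
    (fun x y hx hy => by rw [map_add, hx, hy, add_zero])
    (fun c x hx => by rw [map_smul, hx, smul_zero]) ?_
  intro i j p hp
  cases p with
  | cons => simp at hp
  | nil => exact PathAlg.lift_of _ _

theorem derivation_arrow (hg : IsVertexLinear R g) {x : PathAlg F Q} (hx : x ∈ PathAlg.wt 1) :
    derivation R g x = g x := by
  refine wt_induction (P := fun l => derivation R g l = g l) hx
    ((map_zero _).trans (map_zero _).symm)
    (fun x y hx hy => by rw [map_add, hx, hy, map_add])
    (fun c x hx => by rw [map_smul, hx, map_smul]) ?_
  intro i j p hp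
  obtain ⟨k, q, b, rfl, hq⟩ := exists_cons p hp
  cases q with
  | cons => simp at hq
  | nil =>
    refine (PathAlg.lift_of _ _).trans ?_
    rw [pathDer, pathDer, smul_zero, add_zero]
    exact ((hg _ (PathAlg.e_mem_wt _) _ (of_toPath_mem b)).2).symm.trans (congrArg g (of_mul_e _))

/-- On a path of length 2 each sum has a single nonzero term, given by the two arrows of the path.
-/
theorem sum_leftDiv_eq_sum_rightDiv {N : Type*} [AddCommGroup N] [Module F N]
    (B : PathAlg F Q →ₗ[F] PathAlg F Q →ₗ[F] N) {x : PathAlg F Q} (hx : x ∈ PathAlg.wt 2) :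
    ∑ a : Arrow Q, B (arr a) (leftDiv a x) = ∑ a : Arrow Q, B (rightDiv a x) (arr a) := by
  refine wt_induction (P := fun x => ∑ a : Arrow Q, B (arr a) (leftDiv a x) =
      ∑ a : Arrow Q, B (rightDiv a x) (arr a)) hx (by simp)
    (fun x x' h h' => by
      simp only [map_add, LinearMap.add_apply, Finset.sum_add_distrib, h, h'])
    (fun c x h => by simp only [map_smul, LinearMap.smul_apply, ← Finset.smul_sum, h]) ?_
  intro i j p hp
  obtain ⟨k, q, b, rfl, hq⟩ := exists_cons p hp
  obtain ⟨l, r, d, rfl, hr⟩ := exists_cons q hq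
  cases r with
  | cons => simp at hr
  | nil => exact (sum_leftDiv_cons B _ b).trans (sum_rightDiv_comp B d (.cons .nil b)).symm

/-- The right side has the form of the Koszul differential K_2 → K_1, whose sign is +1. So a
derivation with values in the cokernel of this differential kills R. -/
theorem derivation_quadratic (hg : IsVertexLinear R g) {x : PathAlg F Q} (hx : x ∈ PathAlg.wt 2) :
    derivation R g x =
      ∑ a : Arrow Q, (lact (proj R (arr a)) : Env F (QuadAlg R)) • g (leftDiv a x) +
      ∑ a : Arrow Q, (ract (proj R (arr a)) : Env F (QuadAlg R)) • g (rightDiv a x) := by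
  have h := sum_leftDiv_eq_sum_rightDiv (rightBil R g) hx
  simp only [rightBil_apply] at h
  conv_lhs => rw [← sum_arr_mul_leftDiv hx]
  rw [← h, map_sum, ← Finset.sum_add_distrib]
  refine Finset.sum_congr rfl fun a _ => ?_
  rw [derivation_mul hg, derivation_arrow hg (leftDiv_mem a hx),
    derivation_arrow hg (arr_mem a)]

/-- The derivation of `A` with prescribed values on arrows. -/
theorem exists_derivation (hg : IsVertexLinear R g)
    (hR : ∀ r ∈ R.carrier, derivation R g r = 0) : ∃ D : QuadAlg R →ₗ[F] N,
      (∀ a b, D (a * b) = (lact a : Env F (QuadAlg R)) • D b +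
        (ract b : Env F (QuadAlg R)) • D a) ∧
      (∀ x ∈ PathAlg.wt 0, D (proj R x) = 0) ∧ ∀ x ∈ PathAlg.wt 1, D (proj R x) = g x := by
  obtain ⟨D, hD⟩ := exists_factor (derivation R g) (by
    intro i j a ha r hr b hb
    rw [derivation_mul hg, derivation_mul hg, hR r hr, map_mul (proj R), proj_eq_zero R hr,
      mul_zero, Env.lact_zero, Env.ract_zero, zero_smul, zero_smul, smul_zero, add_zero,
      smul_zero, add_zero])
  refine ⟨D, fun a b => ?_, fun x hx => (hD x).trans (derivation_vertex hx),
    fun x hx => (hD x).trans (derivation_arrow hg hx)⟩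
  obtain ⟨x, rfl⟩ := proj_surjective R a
  obtain ⟨y, rfl⟩ := proj_surjective R b
  rw [← map_mul (proj R), hD, hD, hD, derivation_mul hg]

end Derivation
end QuadraticQuiver
end

noncomputable section
namespace QuadraticQuiver
open PathAlg QuadAlg

/-! ### The Koszul differential: homogeneity, kernels in the radical, low degrees. -/

namespace KoszulTerm

variable {F : Type w} {Q : Type u} [Field F] [Quiver.{v} Q] [Fintype Q]
  [∀ i j : Q, Fintype (i ⟶ j)] {R : QuadraticRelations F Q}

theorem gr_induction {p m : ℕ} {P : KoszulTerm R p → Prop} {z : KoszulTerm R p}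
    (hz : z ∈ gr R p m) (zero : P 0) (add : ∀ z z', P z → P z' → P (z + z'))
    (smul : ∀ (c : F) z, P z → P (c • z))
    (mem : ∀ i j, i + p + j = m → ∀ a ∈ QuadAlg.wt R i, ∀ b ∈ QuadAlg.wt R j, ∀ x : W R p,
      P (Env.tmul F a b • gen R p x)) : P z := by
  refine Submodule.span_induction (p := fun z _ => P z) ?_ zero (fun x y _ _ => add x y)
    (fun c x _ => smul c x) hz
  rintro _ ⟨i, j, a, b, x, h, ha, hb, rfl⟩
  exact mem i j h a ha b hb x

theorem tmul_gen_mem {p i j m : ℕ} (h : i + p + j = m) {a b : QuadAlg R}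
    (ha : a ∈ QuadAlg.wt R i) (hb : b ∈ QuadAlg.wt R j) (x : W R p) :
    Env.tmul F a b • gen R p x ∈ gr R p m :=
  Submodule.subset_span ⟨i, j, a, b, x, h, ha, hb, rfl⟩

theorem gen_mem {p : ℕ} (x : W R p) : gen R p x ∈ gr R p p := by
  have h := tmul_gen_mem (i := 0) (j := 0) (m := p) (by omega) (QuadAlg.one_mem_wt R)
    (QuadAlg.one_mem_wt R) x
  rwa [Env.tmul_one_one, one_smul] at h

theorem d_map_smul (p : ℕ) (c : F) (z : KoszulTerm R (p + 1)) : d R p (c • z) = c • d R p z :=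
  ((d R p).restrictScalars F).map_smul c z

theorem d_tmul_gen (p : ℕ) (a b : QuadAlg R) (x : W R (p + 1)) :
    d R p (Env.tmul F a b • gen R (p + 1) x) =
    ∑ c : Arrow Q, Env.tmul F (a * proj R (arr c)) b • gen R p (leftDivW R c p x) +
    (-1 : F) ^ (p + 1) • ∑ c : Arrow Q,
      Env.tmul F a (proj R (arr c) * b) • gen R p (rightDivW R c p x) := by
  rw [map_smul, d_gen, dGen_apply, smul_add, env_smul_comm]
  simp only [Finset.smul_sum, smul_smul, Env.tmul_mul_tmul, one_mul, mul_one]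

theorem d_mem {p m : ℕ} {z : KoszulTerm R (p + 1)} (hz : z ∈ gr R (p + 1) m) :
    d R p z ∈ gr R p m := by
  refine gr_induction (P := fun z => d R p z ∈ gr R p m) hz (by rw [map_zero]; exact zero_mem _)
    (fun z z' h h' => by rw [map_add]; exact add_mem h h')
    (fun c z h => by rw [d_map_smul]; exact Submodule.smul_mem _ c h) ?_
  intro i j h a ha b hb x
  rw [d_tmul_gen]
  refine add_mem (Submodule.sum_mem _ fun c _ => ?_)
    (Submodule.smul_mem _ _ (Submodule.sum_mem _ fun c _ => ?_))
  · exact tmul_gen_mem (by omega) (QuadAlg.mul_mem_wt ha (proj_mem R (arr_mem c))) hb _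
  · exact tmul_gen_mem (by omega) ha (QuadAlg.mul_mem_wt (proj_mem R (arr_mem c)) hb) _

theorem aug_tmul_gen (a b : QuadAlg R) (x : W R 0) :
    aug R (Env.tmul F a b • gen R 0 x) = a * proj R x * b := by
  rw [map_smul, aug_gen, Env.tmul_smul]

theorem aug_mem {m : ℕ} {z : KoszulTerm R 0} (hz : z ∈ gr R 0 m) :
    aug R z ∈ QuadAlg.wt R m := by
  refine gr_induction (P := fun z => aug R z ∈ QuadAlg.wt R m) hz
    (by rw [map_zero]; exact zero_mem _)
    (fun z z' h h' => by rw [map_add]; exact add_mem h h')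
    (fun c z h => by
      rw [show aug R (c • z) = c • aug R z from ((aug R).restrictScalars F).map_smul c z]
      exact Submodule.smul_mem _ c h) ?_
  intro i j h a ha b hb x
  rw [aug_tmul_gen]
  have h1 := QuadAlg.mul_mem_wt (QuadAlg.mul_mem_wt ha (proj_mem R ((mem_W R).1 x.2).1)) hb
  rwa [h] at h1

/-- In the lowest weight, every element of the Koszul complex is of the form `1 ⊗ x ⊗ 1`. -/
theorem exists_gen_of_mem {p : ℕ} {z : KoszulTerm R p} (hz : z ∈ gr R p p) :
    ∃ x, z = gen R p x := by
  refine gr_induction (P := fun z => ∃ x, z = gen R p x) hz ⟨0, (map_zero _).symm⟩ ?_ ?_ ?_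
  · rintro _ _ ⟨x, rfl⟩ ⟨y, rfl⟩
    exact ⟨x + y, (map_add _ _ _).symm⟩
  · rintro c _ ⟨x, rfl⟩
    exact ⟨c • x, (map_smul _ _ _).symm⟩
  · intro i j h a ha b hb x
    obtain rfl : i = 0 := by omega
    obtain rfl : j = 0 := by omega
    obtain ⟨l, hl, rfl⟩ := ha
    obtain ⟨m, hm, rfl⟩ := hb
    exact ⟨⟨l * x * m, W_mul_mem R hl hm x.2⟩, (gen_rel R p hl hm _ _ rfl).symm⟩

theorem low_one (i : Fin 2) : lowRep R i 1 = if i = 0 then 1 else 0 := by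
  fin_cases i
  · have h := lowRep_of_mem R 0 (x := (1 : PathAlg F Q)) PathAlg.one_mem_wt_zero
    rwa [map_one (proj R)] at h
  · exact lowRep_of_ne R 1 (n := 0) (by decide) (QuadAlg.one_mem_wt R)

/-- The component of the differential in A_1 ⊗ W_p ⊗ A_0 splits off the first letter of `x`, and
multiplying back recovers `x`. Hence the differential is injective on the elements 1 ⊗ x ⊗ 1, in
every positive degree. -/
theorem low_d_gen (p : ℕ) (x : W R (p + 1)) :
    low R p 1 0 (d R p (gen R (p + 1) x)) = x := by
  have h := d_tmul_gen p 1 1 x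
  rw [Env.tmul_one_one, one_smul] at h
  rw [h, map_add, map_smul, map_sum, map_sum]
  simp only [low_tmul, one_mul, mul_one, low_one, if_pos, lowRep_of_mem R 1 (arr_mem _)]
  rw [if_neg (by decide)]
  simp only [zero_mul, Finset.sum_const_zero, smul_zero, add_zero]
  exact sum_arr_mul_leftDiv ((mem_W R).1 x.2).1

theorem gen_eq_zero_of_d {p : ℕ} {x : W R (p + 1)} (h : d R p (gen R (p + 1) x) = 0) : x = 0 := by
  have h1 := low_d_gen p x
  rw [h, map_zero] at h1
  exact Subtype.ext h1.symm

theorem gen_eq_zero_of_aug {x : W R 0} (h : aug R (gen R 0 x) = 0) : x = 0 := by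
  rw [aug_gen] at h
  have h1 := lowRep_of_mem R 0 (x := (x : PathAlg F Q)) ((mem_W R).1 x.2).1
  rw [h, map_zero] at h1
  exact Subtype.ext h1.symm

/-- In an element a ⊗ x ⊗ b of weight different from `p`, one of the homogeneous factors a and b has
positive weight. -/
theorem mem_radical {p : ℕ} {z : KoszulTerm R p} (hz : wtProj (gr_isInternal R p) p z = 0) :
    z ∈ radical (QuadAlg.wt R) (KoszulTerm R p) := by
  refine eq_of_wtProj (gr_isInternal R p) fun m => ?_
  by_cases hm : m = p
  · subst hm; rw [hz]; exact zero_mem _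
  refine gr_induction (P := fun z => z ∈ radical (QuadAlg.wt R) (KoszulTerm R p))
    (wtProj_mem (gr_isInternal R p) m z) (zero_mem _)
    (fun _ _ => add_mem) (fun c _ => Submodule.smul_mem _ c) ?_
  intro i j h a ha b hb x
  by_cases hi : i = 0
  · refine Submodule.subset_span ⟨j, b, (lact a : Env F (QuadAlg R)) • gen R p x, by omega, hb,
      Or.inr ?_⟩
    rw [smul_smul, Env.ract_mul_lact]
  · refine Submodule.subset_span ⟨i, a, (ract b : Env F (QuadAlg R)) • gen R p x, by omega, ha,
      Or.inl ?_⟩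
    rw [smul_smul, Env.lact_mul_ract]

/-- The component of lowest weight of a cycle has the form 1 ⊗ x ⊗ 1 and is itself a cycle, so it
vanishes by injectivity of the differential on such elements. -/
theorem mem_radical_of_d {p : ℕ} {z : KoszulTerm R (p + 1)} (hz : d R p z = 0) :
    z ∈ radical (QuadAlg.wt R) (KoszulTerm R (p + 1)) := by
  refine mem_radical ?_
  obtain ⟨x, hx⟩ := exists_gen_of_mem (wtProj_mem (gr_isInternal R (p + 1)) (p + 1) z)
  have h := map_wtProj (gr_isInternal R (p + 1)) (gr_isInternal R p)
    ((d R p).restrictScalars F) (fun m z hz => d_mem hz) (p + 1) z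
  simp only [LinearMap.restrictScalars_apply] at h
  rw [hz, map_zero, hx] at h
  rw [hx, gen_eq_zero_of_d h, map_zero]

theorem mem_radical_of_aug {z : KoszulTerm R 0} (hz : aug R z = 0) :
    z ∈ radical (QuadAlg.wt R) (KoszulTerm R 0) := by
  refine mem_radical ?_
  obtain ⟨x, hx⟩ := exists_gen_of_mem (wtProj_mem (gr_isInternal R 0) 0 z)
  have h := map_wtProj (gr_isInternal R 0) (QuadAlg.isInternal_wt R)
    ((aug R).restrictScalars F) (fun m z hz => aug_mem hz) 0 z
  simp only [LinearMap.restrictScalars_apply] at h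
  rw [hz, map_zero, hx] at h
  rw [hx, gen_eq_zero_of_aug h, map_zero]

/-! ### Exactness in low degrees -/

theorem mem_W_zero {x : PathAlg F Q} (hx : x ∈ PathAlg.wt 0) : x ∈ W R 0 :=
  (mem_W R).2 ⟨hx, fun i j h => by omega⟩

theorem mem_W_one {x : PathAlg F Q} (hx : x ∈ PathAlg.wt 1) : x ∈ W R 1 :=
  (mem_W R).2 ⟨hx, fun i j h => by omega⟩

theorem mem_W_two {x : PathAlg F Q} (hx : x ∈ R.carrier) : x ∈ W R 2 := by
  refine (mem_W R).2 ⟨R.le_wt hx, fun i j h => ?_⟩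
  obtain rfl : i = 0 := by omega
  obtain rfl : j = 0 := by omega
  have h := Submodule.mul_mem_mul (Submodule.mul_mem_mul
    (PathAlg.one_mem_wt_zero (F := F) (Q := Q)) hx) (PathAlg.one_mem_wt_zero (F := F) (Q := Q))
  rwa [one_mul, mul_one] at h

variable (R) in
/-- The element `1 ⊗ 1` of `A ⊗_k A`. -/
def genOne : KoszulTerm R 0 := gen R 0 ⟨1, mem_W_zero PathAlg.one_mem_wt_zero⟩

theorem gen_zero_eq (x : W R 0) : gen R 0 x =
    (lact (proj R x) : Env F (QuadAlg R)) • genOne R ∧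
    gen R 0 x = (ract (proj R x) : Env F (QuadAlg R)) • genOne R := by
  have hx := ((mem_W R).1 x.2).1
  constructor
  · have h := gen_rel R 0 hx PathAlg.one_mem_wt_zero ⟨1, mem_W_zero PathAlg.one_mem_wt_zero⟩ x
      (by simp)
    rwa [map_one (proj R)] at h
  · have h := gen_rel R 0 PathAlg.one_mem_wt_zero hx ⟨1, mem_W_zero PathAlg.one_mem_wt_zero⟩ x
      (by simp)
    rwa [map_one (proj R)] at h

theorem tmul_gen_zero (a b : QuadAlg R) (x : W R 0) :
    Env.tmul F a b • gen R 0 x = Env.tmul F (a * proj R x) b • genOne R := by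
  rw [(gen_zero_eq x).1, smul_smul, Env.tmul_mul_tmul, one_mul]

theorem aug_tmul_genOne (a b : QuadAlg R) : aug R (Env.tmul F a b • genOne R) = a * b := by
  rw [genOne, aug_tmul_gen, map_one (proj R), mul_one]

theorem d_tmul_gen_one (a b : QuadAlg R) (x : W R 1) :
    d R 0 (Env.tmul F a b • gen R 1 x) =
      Env.tmul F (a * proj R x) b • genOne R - Env.tmul F a (proj R x * b) • genOne R := by
  have hx := ((mem_W R).1 x.2).1
  have hs : (-1 : F) ^ (0 + 1) = -1 := by simp
  rw [d_tmul_gen, hs, neg_one_smul, ← sub_eq_add_neg]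
  congr 1
  · have h : proj R (x : PathAlg F Q) = ∑ c : Arrow Q, proj R (arr c) * proj R (leftDiv c x) := by
      simp only [← map_mul (proj R), ← map_sum]
      rw [sum_arr_mul_leftDiv hx]
    rw [h, Finset.mul_sum, ← Env.tmulBil_apply, map_sum, LinearMap.sum_apply, Finset.sum_smul]
    refine Finset.sum_congr rfl fun c _ => ?_
    rw [tmul_gen_zero, mul_assoc]
    rfl
  · have h : proj R (x : PathAlg F Q) = ∑ c : Arrow Q, proj R (rightDiv c x) * proj R (arr c) := by
      simp only [← map_mul (proj R), ← map_sum]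
      rw [sum_rightDiv_mul_arr hx]
    rw [h, Finset.sum_mul, ← Env.tmulBil_apply, map_sum, Finset.sum_smul]
    refine Finset.sum_congr rfl fun c _ => ?_
    rw [(gen_zero_eq _).2, smul_smul, Env.tmul_mul_tmul, mul_one, mul_assoc]
    rfl

/-- The arrows of a path are carried across the tensor sign one at a time; each move changes the
tensor by a boundary, and the differences telescope. -/
theorem tmul_genOne_sub_mem (y : PathAlg F Q) (a : QuadAlg R) :
    Env.tmul F a (proj R y) • genOne R - Env.tmul F (a * proj R y) 1 • genOne R ∈
      LinearMap.range (d R 0) := by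
  induction y using PathAlg.induction with
  | zero => rw [map_zero (proj R), mul_zero, Env.tmul_zero_right, Env.tmul_zero_left]; simp
  | add y y' h h' =>
    have h2 := add_mem h h'
    rw [map_add (proj R), mul_add, Env.tmul_add_right, Env.tmul_add_left, add_smul, add_smul]
    rwa [add_sub_add_comm]
  | smul c y h =>
    rw [map_smul (proj R), mul_smul_comm, Env.tmul_smul_left, Env.tmul_smul_right, smul_assoc,
      smul_assoc, ← smul_sub]
    obtain ⟨t, ht⟩ := h
    exact ⟨c • t, by rw [d_map_smul, ht]⟩
  | of i j p =>
    -- The left factor must vary, since it absorbs the arrow that has been moved.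
    induction p generalizing a with
    | nil =>
      have h : Env.tmul F a (proj R (of (.nil : Quiver.Path i i))) • genOne R =
          Env.tmul F (a * proj R (of (.nil : Quiver.Path i i))) 1 • genOne R := by
        have h1 := gen_zero_eq (R := R) ⟨of (.nil : Quiver.Path i i),
          mem_W_zero (PathAlg.e_mem_wt i)⟩
        have h2 := congrArg (fun z => (lact a : Env F (QuadAlg R)) • z) (h1.1.symm.trans h1.2)
        simp only [smul_smul, Env.tmul_mul_tmul, mul_one] at h2
        exact h2.symm
      rw [h, sub_self]
      exact zero_mem _
    | cons q b ih =>
      have h1 : (of (q.cons b) : PathAlg F Q) = of b.toPath * of q :=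
        (of_mul_of_comp b.toPath q).symm
      have h2 : Env.tmul F a (proj R (of b.toPath) * proj R (of q)) • genOne R -
          Env.tmul F (a * proj R (of b.toPath)) (proj R (of q)) • genOne R ∈
          LinearMap.range (d R 0) := by
        refine ⟨-(Env.tmul F a (proj R (of q)) •
          gen R 1 ⟨of b.toPath, mem_W_one (of_toPath_mem b)⟩), ?_⟩
        rw [map_neg, d_tmul_gen_one, neg_sub]
      have h3 := add_mem h2 (ih (a * proj R (of b.toPath)))
      rwa [sub_add_sub_cancel, ← map_mul (proj R), mul_assoc, ← map_mul (proj R), ← h1] at h3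

/-- Modulo boundaries every element of A ⊗_k A equals its product tensored with 1, so an element of
the kernel of the multiplication is a boundary. -/
theorem exact_aug {z : KoszulTerm R 0} (hz : aug R z = 0) : ∃ y, d R 0 y = z := by
  have h (z : KoszulTerm R 0) : z - (lact (aug R z) : Env F (QuadAlg R)) • genOne R ∈
      LinearMap.range (d R 0) := by
    refine KoszulTerm.induction R 0
      (P := fun z => z - (lact (aug R z) : Env F (QuadAlg R)) • genOne R ∈
        LinearMap.range (d R 0)) z ?_ ?_ ?_
    · rw [map_zero, Env.lact_zero, zero_smul, sub_zero]
      exact zero_mem _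
    · intro z z' h h'
      have h2 := add_mem h h'
      rw [map_add, Env.lact_add, add_smul]
      rwa [add_sub_add_comm]
    · intro s x
      induction s using Env.induction with
      | add s t hs ht =>
        have h2 := add_mem hs ht
        rw [add_smul, map_add, Env.lact_add, add_smul]
        rwa [add_sub_add_comm]
      | tmul a b =>
        obtain ⟨y, rfl⟩ := proj_surjective R b
        rw [aug_tmul_gen, tmul_gen_zero]
        exact tmul_genOne_sub_mem y (a * proj R x)
  have h1 := h z
  rwa [hz, Env.lact_zero, zero_smul, sub_zero] at h1

variable (R) in
/-- The map `A ⊗_k A → A ⊗ A` given by the idempotents of the vertices. -/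
def toEnv : KoszulTerm R 0 →ₗ[Env F (QuadAlg R)] Env F (QuadAlg R) :=
  lift R 0 (∑ i : Q, (Env.tmulBil F (QuadAlg R)).flip (proj R (e i)) ∘ₗ (proj R).toLinearMap ∘ₗ
      LinearMap.mulRight F (e i) ∘ₗ (W R 0).subtype) (by
    intro l m x y hl hm hy
    obtain ⟨c, hc⟩ := PathAlg.vertex_scalars hm
    simp only [LinearMap.sum_apply, LinearMap.comp_apply, LinearMap.flip_apply,
      Env.tmulBil_apply, Finset.mul_sum, AlgHom.toLinearMap_apply, LinearMap.mulRight_apply,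
      Submodule.subtype_apply, smul_eq_mul, Env.tmul_mul_tmul, ← map_mul (proj R)]
    refine Finset.sum_congr rfl fun i _ => ?_
    rw [hy, mul_assoc, (hc i).1, (hc i).2, mul_smul_comm, map_smul (proj R), map_smul (proj R),
      Env.tmul_smul_left, Env.tmul_smul_right, mul_assoc])

theorem toEnv_genOne : toEnv R (genOne R) =
    ∑ i : Q, Env.tmul F (proj R (e i)) (proj R (e i)) := by
  rw [toEnv, genOne, lift_gen]
  simp only [LinearMap.sum_apply, LinearMap.comp_apply, LinearMap.flip_apply,
      Env.tmulBil_apply, AlgHom.toLinearMap_apply, LinearMap.mulRight_apply,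
      Submodule.subtype_apply, one_mul]

/-- Let C be the cokernel of K_2 → K_1. The map V → C extends to a derivation of the path algebra,
which kills R and so descends to D : A → C. The map a ⊗ b ↦ D(a) b sends the boundary ax ⊗ b - a ⊗
xb of a ⊗ x ⊗ b to a D(x) b, the class of a ⊗ x ⊗ b in C. So a cycle of K_1 has class zero in C. -/
theorem exact_zero {z : KoszulTerm R 1} (hz : d R 0 z = 0) : ∃ y, d R 1 y = z := by
  obtain ⟨g, hg⟩ := exists_genExt R 1
  let C := KoszulTerm R 1 ⧸ LinearMap.range (d R 1)
  let π : KoszulTerm R 1 →ₗ[Env F (QuadAlg R)] C := Submodule.mkQ _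
  let g' : PathAlg F Q →ₗ[F] C := π.restrictScalars F ∘ₗ g
  have hg' : IsVertexLinear R g' := by
    intro l hl x hx
    constructor
    · exact (congrArg π (genExt_lact R hg hl (mem_W_one hx))).trans (map_smul π _ _)
    · exact (congrArg π (genExt_ract R hg hl (mem_W_one hx))).trans (map_smul π _ _)
  -- On a relation `r` the derivation takes the value of the boundary of 1 ⊗ r ⊗ 1, which is zero in
  -- the cokernel.
  obtain ⟨D, hD, hD0, hD1⟩ := exists_derivation hg' (by
    intro r hr
    rw [derivation_quadratic hg' (R.le_wt hr)]
    have h1 := d_gen R 1 ⟨r, mem_W_two hr⟩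
    rw [dGen_eq R hg, neg_one_sq, one_smul] at h1
    have h2 : π (d R 1 (gen R 2 ⟨r, mem_W_two hr⟩)) = 0 :=
      (Submodule.Quotient.mk_eq_zero _).2 ⟨_, rfl⟩
    rw [h1, map_add, map_sum, map_sum] at h2
    simp only [map_smul] at h2
    exact h2)
  -- The map a ⊗ b ↦ D(a) b is not left linear, so it cannot be obtained from `KoszulTerm.lift`. It
  -- is defined on A ⊗ A and composed with `toEnv`; the idempotents inserted there disappear because
  -- D vanishes on k.
  let h : Env F (QuadAlg R) →ₗ[F] C := Env.liftLinear
    (LinearMap.mk₂ F (fun a b => (ract b : Env F (QuadAlg R)) • D a)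
      (fun a a' b => by rw [map_add, smul_add])
      (fun c a b => by rw [map_smul, env_smul_comm])
      (fun a b b' => by rw [Env.ract_add, add_smul])
      (fun c a b => by rw [Env.ract_smul, smul_assoc]))
  have hh (a b : QuadAlg R) : h (Env.tmul F a b) = (ract b : Env F (QuadAlg R)) • D a :=
    Env.liftLinear_tmul _ _ _
  have hH (a b : QuadAlg R) : h (toEnv R (Env.tmul F a b • genOne R)) =
      (ract b : Env F (QuadAlg R)) • D a := by
    rw [map_smul, toEnv_genOne, Finset.smul_sum, map_sum]
    simp only [smul_eq_mul, Env.tmul_mul_tmul, hh, hD, hD0 _ (PathAlg.e_mem_wt _), smul_zero,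
      zero_add, smul_smul, ← mul_assoc, ← map_mul (proj R),
      PathAlg.e_mul_e_self, mul_one]
    rw [← Finset.sum_smul]
    congr 1
    have h3 := map_sum ((Env.tmulBil F (QuadAlg R)) 1) (fun i : Q => proj R (e i) * b) Finset.univ
    rw [← Finset.sum_mul, sum_proj_e, one_mul] at h3
    exact h3.symm
  have key (w : KoszulTerm R 1) : h (toEnv R (d R 0 w)) = π w := by
    refine KoszulTerm.induction R 1 (P := fun w => h (toEnv R (d R 0 w)) = π w) w ?_ ?_ ?_
    · simp only [map_zero]
    · intro z z' h h'
      simp only [map_add, h, h']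
    · intro s x
      induction s using Env.induction with
      | add s t hs ht => simp only [add_smul, map_add, hs, ht]
      | tmul a b =>
        have hx := ((mem_W R).1 x.2).1
        rw [d_tmul_gen_one, map_sub, map_sub, hH, hH, hD, hD1 _ hx, Env.ract_mul, mul_smul,
          smul_add, add_sub_cancel_right, smul_smul, Env.ract_mul_lact, map_smul]
        congr 1
        exact congrArg π (hg x)
  have h1 := key z
  rw [hz, map_zero, map_zero] at h1
  exact (Submodule.Quotient.mk_eq_zero _).1 h1.symm

/-! ### Diagonal exactness at `A ⊗_k R ⊗_k A` -/

/-- Left division of `α * y` by an arrow only affects `α`, leaving vertex coefficients that are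
moved to the left; the arrows then recombine to `α`. -/
theorem sum_lact_gen_leftDiv {p : ℕ} {α y : PathAlg F Q} (hα : α ∈ PathAlg.wt 1)
    {g : PathAlg F Q →ₗ[F] KoszulTerm R p} (hg : ∀ x : W R p, g x = gen R p x)
    (hy : y ∈ W R p) : ∑ c : Arrow Q, (lact (proj R (arr c)) : Env F (QuadAlg R)) •
      g (leftDiv c (α * y)) = (lact (proj R α) : Env F (QuadAlg R)) • g y := by
  have h (c : Arrow Q) : (lact (proj R (arr c)) : Env F (QuadAlg R)) • g (leftDiv c (α * y)) =
      (lact (proj R (arr c * leftDiv c α)) : Env F (QuadAlg R)) • g y := by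
    rw [leftDiv_mul c hα, genExt_lact R hg (leftDiv_mem c hα) hy, smul_smul, ← Env.lact_mul,
      map_mul (proj R)]
  have h2 := map_sum (Env.lactHom F (QuadAlg R)) (fun c => proj R (arr c * leftDiv c α))
    Finset.univ
  rw [← map_sum, sum_arr_mul_leftDiv hα] at h2
  simp only [h, ← Finset.sum_smul]
  exact congrArg (· • g y) h2.symm

theorem sum_ract_gen_rightDiv {p : ℕ} {β y : PathAlg F Q} (hβ : β ∈ PathAlg.wt 1)
    {g : PathAlg F Q →ₗ[F] KoszulTerm R p} (hg : ∀ x : W R p, g x = gen R p x)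
    (hy : y ∈ W R p) : ∑ c : Arrow Q, (ract (proj R (arr c)) : Env F (QuadAlg R)) •
      g (rightDiv c (y * β)) = (ract (proj R β) : Env F (QuadAlg R)) • g y := by
  have h (c : Arrow Q) : (ract (proj R (arr c)) : Env F (QuadAlg R)) • g (rightDiv c (y * β)) =
      (ract (proj R (rightDiv c β * arr c)) : Env F (QuadAlg R)) • g y := by
    rw [rightDiv_mul c hβ, genExt_ract R hg (rightDiv_mem c hβ) hy, smul_smul, ← Env.ract_mul,
      map_mul (proj R)]
  have h2 := map_sum (Env.tmulBil F (QuadAlg R) 1) (fun c => proj R (rightDiv c β * arr c))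
    Finset.univ
  rw [← map_sum (proj R), sum_rightDiv_mul_arr hβ] at h2
  simp only [h, ← Finset.sum_smul]
  exact congrArg (· • g y) h2.symm

/-- In weight `p + 1`, an element of `A ⊗_k W_p ⊗_k A` is determined by its components in
`V ⊗_k W_p` and `W_p ⊗_k V`. -/
theorem eq_sum_low {p : ℕ} {z : KoszulTerm R p} (hz : z ∈ gr R p (p + 1))
    {g : PathAlg F Q →ₗ[F] KoszulTerm R p} (hg : ∀ x : W R p, g x = gen R p x) :
    z = ∑ c : Arrow Q, (lact (proj R (arr c)) : Env F (QuadAlg R)) •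
        g (leftDiv c (low R p 1 0 z)) +
      ∑ c : Arrow Q, (ract (proj R (arr c)) : Env F (QuadAlg R)) •
        g (rightDiv c (low R p 0 1 z)) := by
  refine gr_induction (P := fun z => z = ∑ c : Arrow Q,
      (lact (proj R (arr c)) : Env F (QuadAlg R)) • g (leftDiv c (low R p 1 0 z)) +
      ∑ c : Arrow Q, (ract (proj R (arr c)) : Env F (QuadAlg R)) •
        g (rightDiv c (low R p 0 1 z))) hz ?_ ?_ ?_ ?_
  · simp
  · intro z z' h h'
    simp only [map_add, smul_add, Finset.sum_add_distrib]
    rw [add_add_add_comm, ← h, ← h']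
  · intro c z h
    simp only [map_smul, env_smul_comm c, ← Finset.smul_sum]
    rw [← smul_add, ← h]
  · intro i j h a ha b hb x
    rw [low_tmul, low_tmul]
    obtain ⟨rfl, rfl⟩ | ⟨rfl, rfl⟩ : (i = 1 ∧ j = 0) ∨ (i = 0 ∧ j = 1) := by omega
    · obtain ⟨α, hα, rfl⟩ := ha
      obtain ⟨β, hβ, rfl⟩ := hb
      have hy : (x : PathAlg F Q) * β ∈ W R p := by
        have h := W_mul_mem R PathAlg.one_mem_wt_zero hβ x.2
        rwa [one_mul] at h
      simp only [AlgHom.toLinearMap_apply]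
      rw [lowRep_of_mem R 1 hα, lowRep_of_mem R 0 hβ, lowRep_of_ne R 0 (n := 1) (by decide)
        (proj_mem R hα), mul_assoc, sum_lact_gen_leftDiv hα hg hy]
      simp only [zero_mul, map_zero, smul_zero, Finset.sum_const_zero, add_zero]
      rw [genExt_ract R hg hβ x.2, smul_smul, Env.lact_mul_ract, hg]
    · obtain ⟨α, hα, rfl⟩ := ha
      obtain ⟨β, hβ, rfl⟩ := hb
      have hy : α * (x : PathAlg F Q) ∈ W R p := by
        have h := W_mul_mem R hα PathAlg.one_mem_wt_zero x.2
        rwa [mul_one] at h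
      simp only [AlgHom.toLinearMap_apply]
      rw [lowRep_of_mem R 0 hα, lowRep_of_mem R 1 hβ, lowRep_of_ne R 1 (n := 0) (by decide)
        (proj_mem R hα), sum_ract_gen_rightDiv hβ hg hy]
      simp only [zero_mul, map_zero, smul_zero, Finset.sum_const_zero, zero_add]
      rw [genExt_lact R hg hα x.2, smul_smul, Env.ract_mul_lact, hg]

theorem carrier_of_mem_W_two {x : PathAlg F Q} (hx : x ∈ W R 2) : x ∈ R.carrier := by
  refine Submodule.mul_induction_on (((mem_W R).1 hx).2 0 0 rfl) ?_ (fun _ _ => add_mem)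
  intro y hy m hm
  refine R.mul_vertex m hm y ?_
  exact Submodule.mul_induction_on hy (fun l hl r hr => R.vertex_mul l hl r hr)
    (fun _ _ => add_mem)

/-- In weight 3 exactly one outer factor has weight 1, so the two components lie in VR and in RV. -/
theorem low_mem {z : KoszulTerm R 2} (hz : z ∈ gr R 2 3) :
    low R 2 1 0 z ∈ PathAlg.wt 1 * R.carrier * PathAlg.wt 0 ∧
    low R 2 0 1 z ∈ PathAlg.wt 0 * R.carrier * PathAlg.wt 1 := by
  refine gr_induction (P := fun z => low R 2 1 0 z ∈ PathAlg.wt 1 * R.carrier * PathAlg.wt 0 ∧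
    low R 2 0 1 z ∈ PathAlg.wt 0 * R.carrier * PathAlg.wt 1) hz ?_ ?_ ?_ ?_
  · rw [map_zero, map_zero]
    exact ⟨zero_mem _, zero_mem _⟩
  · intro z z' h h'
    rw [map_add, map_add]
    exact ⟨add_mem h.1 h'.1, add_mem h.2 h'.2⟩
  · intro c z h
    rw [map_smul, map_smul]
    exact ⟨Submodule.smul_mem _ c h.1, Submodule.smul_mem _ c h.2⟩
  · intro i j h a ha b hb x
    have hx := carrier_of_mem_W_two x.2
    rw [low_tmul, low_tmul]
    obtain ⟨α, hα, rfl⟩ := ha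
    obtain ⟨β, hβ, rfl⟩ := hb
    simp only [AlgHom.toLinearMap_apply]
    obtain ⟨rfl, rfl⟩ | ⟨rfl, rfl⟩ : (i = 1 ∧ j = 0) ∨ (i = 0 ∧ j = 1) := by omega
    · rw [lowRep_of_mem R 1 hα, lowRep_of_mem R 0 hβ, lowRep_of_ne R 0 (n := 1) (by decide)
        (proj_mem R hα), zero_mul, zero_mul]
      exact ⟨Submodule.mul_mem_mul (Submodule.mul_mem_mul hα hx) hβ, zero_mem _⟩
    · rw [lowRep_of_mem R 0 hα, lowRep_of_mem R 1 hβ, lowRep_of_ne R 1 (n := 0) (by decide)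
        (proj_mem R hα), zero_mul, zero_mul]
      exact ⟨zero_mem _, Submodule.mul_mem_mul (Submodule.mul_mem_mul hα hx) hβ⟩

/-- Only one half of the differential of each component lands in A_1 ⊗ V ⊗ A_1, and there
multiplication returns the component. The sign in degree 2 is +1, whence a sum. -/
theorem low_one_one_d {z : KoszulTerm R 2} (hz : z ∈ gr R 2 3) :
    low R 1 1 1 (d R 1 z) = low R 2 1 0 z + low R 2 0 1 z := by
  refine gr_induction
    (P := fun z => low R 1 1 1 (d R 1 z) = low R 2 1 0 z + low R 2 0 1 z) hz ?_ ?_ ?_ ?_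
  · simp only [map_zero, add_zero]
  · intro z z' h h'
    simp only [map_add, h, h']
    abel
  · intro c z h
    rw [d_map_smul, map_smul, map_smul, map_smul, h, smul_add]
  · intro i j h a ha b hb x
    have hx := ((mem_W R).1 x.2).1
    have hs : (-1 : F) ^ (1 + 1) = 1 := by simp
    rw [d_tmul_gen, hs, one_smul, map_add, map_sum, map_sum]
    simp only [low_tmul]
    obtain ⟨α, hα, rfl⟩ := ha
    obtain ⟨β, hβ, rfl⟩ := hb
    simp only [AlgHom.toLinearMap_apply]
    obtain ⟨rfl, rfl⟩ | ⟨rfl, rfl⟩ : (i = 1 ∧ j = 0) ∨ (i = 0 ∧ j = 1) := by omega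
    · have h1 (c : Arrow Q) : lowRep R 1 (proj R α * proj R (arr c)) = 0 :=
        lowRep_of_ne R 1 (n := 1 + 1) (by decide)
          (QuadAlg.mul_mem_wt (proj_mem R hα) (proj_mem R (arr_mem c)))
      have h2 (c : Arrow Q) : lowRep R 1 (proj R (arr c) * proj R β) = arr c * β := by
        rw [← map_mul (proj R)]
        exact lowRep_of_mem R 1 (PathAlg.mul_vertex_mem_wt (arr_mem c) hβ)
      simp only [h1, h2, lowRep_of_mem R 1 hα, lowRep_of_mem R 0 hβ,
        lowRep_of_ne R 0 (n := 1) (by decide) (proj_mem R hα), zero_mul,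
        Finset.sum_const_zero, zero_add, add_zero]
      have h3 (c : Arrow Q) : α * (rightDivW R c 1 x : PathAlg F Q) * (arr c * β) =
          α * (rightDiv c (x : PathAlg F Q) * arr c) * β := by
        simp only [mul_assoc]
        rfl
      simp only [h3, ← Finset.mul_sum, ← Finset.sum_mul]
      rw [sum_rightDiv_mul_arr hx]
    · have h1 (c : Arrow Q) : lowRep R 1 (proj R (arr c) * proj R β) = 0 :=
        lowRep_of_ne R 1 (n := 1 + 1) (by decide)
          (QuadAlg.mul_mem_wt (proj_mem R (arr_mem c)) (proj_mem R hβ))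
      have h2 (c : Arrow Q) : lowRep R 1 (proj R α * proj R (arr c)) = α * arr c := by
        rw [← map_mul (proj R)]
        exact lowRep_of_mem R 1 (PathAlg.vertex_mul_mem_wt hα (arr_mem c))
      simp only [h1, h2, lowRep_of_mem R 0 hα, lowRep_of_mem R 1 hβ,
        lowRep_of_ne R 1 (n := 0) (by decide) (proj_mem R hα), zero_mul, mul_zero,
        Finset.sum_const_zero, zero_add, add_zero]
      have h3 (c : Arrow Q) : α * arr c * (leftDivW R c 1 x : PathAlg F Q) * β =
          α * (arr c * leftDiv c (x : PathAlg F Q)) * β := by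
        simp only [mul_assoc]
        rfl
      simp only [h3, ← Finset.mul_sum, ← Finset.sum_mul]
      rw [sum_arr_mul_leftDiv hx]

/-- The components u in VR and v in RV of a cycle satisfy u + v = 0. So u lies in VR ∩ RV = W_3, and
the cycle is the boundary of 1 ⊗ u ⊗ 1. -/
theorem exact_one_of_mem {z : KoszulTerm R 2} (hz : z ∈ gr R 2 3) (hd : d R 1 z = 0) :
    ∃ x, d R 2 (gen R 3 x) = z := by
  have h1 := low_one_one_d hz
  rw [hd, map_zero] at h1
  have h2 := low_mem hz
  have h3 : low R 2 0 1 z = - low R 2 1 0 z := (neg_eq_of_add_eq_zero_right h1.symm).symm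
  have hu : low R 2 1 0 z ∈ W R 3 := by
    refine (mem_W R).2 ⟨?_, fun i j h => ?_⟩
    · have h4 : (PathAlg.wt 1 * R.carrier * PathAlg.wt 0 : Submodule F (PathAlg F Q)) ≤
          PathAlg.wt (1 + 2 + 0) :=
        (mul_le_mul' ((mul_le_mul' le_rfl R.le_wt).trans (wt_mul_le 1 2)) le_rfl).trans
          (wt_mul_le (1 + 2) 0)
      exact h4 h2.1
    · obtain ⟨rfl, rfl⟩ | ⟨rfl, rfl⟩ : (i = 1 ∧ j = 0) ∨ (i = 0 ∧ j = 1) := by omega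
      · exact h2.1
      · rw [← neg_mem_iff, ← h3]
        exact h2.2
  refine ⟨⟨low R 2 1 0 z, hu⟩, ?_⟩
  obtain ⟨g, hg⟩ := exists_genExt R 2
  rw [d_gen, dGen_eq R hg]
  conv_rhs => rw [eq_sum_low hz hg]
  rw [h3]
  -- The sign of the differential out of degree 3 is -1, which matches v = -u.
  simp [pow_succ]

end KoszulTerm
end QuadraticQuiver
end

noncomputable section
namespace QuadraticQuiver
open PathAlg QuadAlg

/-! ### The radical and graded forms of Nakayama's lemma. -/

section Radical

variable {F : Type w} {A : Type x} [Field F] [Ring A] [Algebra F A]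
  {𝒜 : ℕ → Submodule F A} {N N' : Type x} [AddCommGroup N] [Module F N] [Module (Env F A) N]
  [IsScalarTower F (Env F A) N] [AddCommGroup N'] [Module F N'] [Module (Env F A) N']
  [IsScalarTower F (Env F A) N'] {gr : ℕ → Submodule F N} {gr' : ℕ → Submodule F N'}

theorem envGr_smul_mem (h : IsGradedBimod 𝒜 gr) {n m : ℕ} {s : Env F A} (hs : s ∈ envGr 𝒜 n)
    {z : N} (hz : z ∈ gr m) : s • z ∈ gr (n + m) := by
  refine Submodule.span_induction (p := fun s _ => s • z ∈ gr (n + m)) ?_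
    (by rw [zero_smul]; exact zero_mem _)
    (fun x y _ _ hx hy => by rw [add_smul]; exact add_mem hx hy)
    (fun c x _ hx => by rw [smul_assoc]; exact Submodule.smul_mem _ c hx) hs
  rintro _ ⟨i, j, a, b, rfl, ha, hb, rfl⟩
  have h1 := h.smul_mem i j m a ha b hb z hz
  rwa [show i + m + j = i + j + m by omega] at h1

theorem map_mem_radical (f : N →ₗ[Env F A] N') {z : N} (hz : z ∈ radical 𝒜 N) :
    f z ∈ radical 𝒜 N' := by
  refine Submodule.span_induction (p := fun z _ => f z ∈ radical 𝒜 N') ?_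
    (by rw [map_zero]; exact zero_mem _)
    (fun x y _ _ hx hy => by rw [map_add]; exact add_mem hx hy)
    (fun c x _ hx => by
      rw [show f (c • x) = c • f x from (f.restrictScalars F).map_smul c x]
      exact Submodule.smul_mem _ c hx) hz
  rintro _ ⟨m, a, n, hm, ha, rfl | rfl⟩
  · exact Submodule.subset_span ⟨m, a, f n, hm, ha, Or.inl (map_smul _ _ _)⟩
  · exact Submodule.subset_span ⟨m, a, f n, hm, ha, Or.inr (map_smul _ _ _)⟩

/-- Multiplication by an element of positive weight raises the weight, so the component of weight
`m` of an element of the radical is generated by elements of weight below `m`. -/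
theorem wtProj_radical_mem (h : IsGradedBimod 𝒜 gr) (h1 : (1 : A) ∈ 𝒜 0) {m : ℕ}
    {S : Submodule (Env F A) N} (hS : ∀ n < m, ∀ z ∈ gr n, z ∈ S) {z : N}
    (hz : z ∈ radical 𝒜 N) : wtProj h.isInternal m z ∈ S := by
  refine Submodule.span_induction (p := fun z _ => wtProj h.isInternal m z ∈ S) ?_
    (by rw [map_zero]; exact zero_mem _)
    (fun x y _ _ hx hy => by rw [map_add]; exact add_mem hx hy)
    (fun c x _ hx => by
      rw [map_smul]
      exact Submodule.smul_of_tower_mem S c hx) hz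
  rintro _ ⟨i, a, n, hi, ha, rfl | rfl⟩
  · by_cases hm : m < i
    · rw [wtProj_smul_of_lt h ha h1 (by omega)]; exact zero_mem _
    · have h2 := wtProj_smul h ha h1 (m - i) n
      rw [show i + (m - i) + 0 = m by omega] at h2
      rw [h2]
      exact S.smul_mem _ (hS (m - i) (by omega) _ (wtProj_mem _ _ _))
  · by_cases hm : m < i
    · rw [wtProj_smul_of_lt h h1 ha (by omega)]; exact zero_mem _
    · have h2 := wtProj_smul h h1 ha (m - i) n
      rw [show 0 + (m - i) + i = m by omega] at h2
      rw [h2]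
      exact S.smul_mem _ (hS (m - i) (by omega) _ (wtProj_mem _ _ _))

/-- Nakayama's lemma for graded bimodules: a homogeneous map which is surjective modulo the
radical is surjective. -/
theorem surjective_of_radical (h : IsGradedBimod 𝒜 gr) (h' : IsGradedBimod 𝒜 gr')
    (h1 : (1 : A) ∈ 𝒜 0) (f : N →ₗ[Env F A] N') (hf : ∀ m, ∀ z ∈ gr m, f z ∈ gr' m)
    (hs : ∀ z, ∃ y, z - f y ∈ radical 𝒜 N') : Function.Surjective f := by
  -- The induction on the weight starts because weights are natural numbers; no finite generation is
  -- needed.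
  have key (m : ℕ) : ∀ z ∈ gr' m, z ∈ LinearMap.range f := by
    induction m using Nat.strong_induction_on with
    | _ m ih =>
    intro z hz
    obtain ⟨y, hy⟩ := hs z
    have h2 := wtProj_radical_mem h' h1 ih hy
    rw [map_sub, wtProj_of_mem _ hz] at h2
    have h3 := map_wtProj h.isInternal h'.isInternal (f.restrictScalars F) hf m y
    simp only [LinearMap.restrictScalars_apply] at h3
    rw [← h3] at h2
    have h4 := add_mem h2 (LinearMap.mem_range_self f (wtProj h.isInternal m y))
    rwa [sub_add_cancel] at h4
  intro z
  change z ∈ LinearMap.range f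
  induction z using wt_hom_induction h'.isInternal with
  | zero => exact zero_mem _
  | add z z' hz hz' => exact add_mem hz hz'
  | mem m z hz => exact key m z hz

/-- A surjective map onto a projective bimodule is injective if its kernel is contained in the
radical of a graded bimodule. -/
theorem injective_of_radical (h : IsGradedBimod 𝒜 gr) (h1 : (1 : A) ∈ 𝒜 0)
    [Module.Projective (Env F A) N'] (f : N →ₗ[Env F A] N') (hs : Function.Surjective f)
    (hr : ∀ z, f z = 0 → z ∈ radical 𝒜 N) : Function.Injective f := by
  obtain ⟨s, hs⟩ := Module.projective_lifting_property f LinearMap.id hs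
  have hs' (z : N') : f (s z) = z := LinearMap.congr_fun hs z
  -- The projection onto the kernel of `f` given by a splitting. It need not be homogeneous, so the
  -- induction below concerns the components of arbitrary elements of the kernel.
  let π : N →ₗ[Env F A] N := LinearMap.id - s ∘ₗ f
  have hπ (z : N) : π z = z - s (f z) := rfl
  have hπ0 (z : N) : f (π z) = 0 := by rw [hπ, map_sub, hs', sub_self]
  have key (m : ℕ) : ∀ z, f z = 0 → wtProj h.isInternal m z = 0 := by
    induction m using Nat.strong_induction_on with
    | _ m ih =>
    intro z hz
    have hz' : π z = z := by rw [hπ, hz, map_zero, sub_zero]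
    rw [← hz']
    -- An element `z` of the kernel is a sum of terms a n with a of positive weight, hence z = π z
    -- is a sum of terms a π(n). Each π(n) is in the kernel, and the induction hypothesis kills its
    -- components of lower weight.
    refine Submodule.span_induction (p := fun z _ => wtProj h.isInternal m (π z) = 0) ?_
      (by rw [map_zero, map_zero])
      (fun x y _ _ hx hy => by rw [map_add, map_add, hx, hy, add_zero])
      (fun c x _ hx => by
        rw [show π (c • x) = c • π x from (π.restrictScalars F).map_smul c x, map_smul, hx,
          smul_zero]) (hr z hz)
    rintro _ ⟨i, a, n, hi, ha, rfl | rfl⟩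
    · rw [map_smul]
      by_cases hm : m < i
      · exact wtProj_smul_of_lt h ha h1 (by omega) _
      · have h2 := wtProj_smul h ha h1 (m - i) (π n)
        rw [show i + (m - i) + 0 = m by omega] at h2
        rw [h2, ih (m - i) (by omega) _ (hπ0 n), smul_zero]
    · rw [map_smul]
      by_cases hm : m < i
      · exact wtProj_smul_of_lt h h1 ha (by omega) _
      · have h2 := wtProj_smul h h1 ha (m - i) (π n)
        rw [show 0 + (m - i) + i = m by omega] at h2
        rw [h2, ih (m - i) (by omega) _ (hπ0 n), smul_zero]
  rw [injective_iff_map_eq_zero]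
  exact fun z hz => eq_zero_of_wtProj h.isInternal fun m => key m z hz

/-- The kernel of a homogeneous map is graded. -/
theorem isGradedBimod_ker (h : IsGradedBimod 𝒜 gr) (h' : IsGradedBimod 𝒜 gr')
    (f : N →ₗ[Env F A] N') (hf : ∀ m, ∀ z ∈ gr m, f z ∈ gr' m) :
    IsGradedBimod 𝒜 (N := LinearMap.ker f)
      fun m => (gr m).comap ((LinearMap.ker f).subtype.restrictScalars F) where
  isInternal := by
    refine isInternal_of_injective h.isInternal ((LinearMap.ker f).subtype.restrictScalars F)
      (Submodule.subtype_injective _) (fun m z hz => hz) ?_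
    rintro ⟨z, hz⟩
    -- The components of `z` lie in the kernel because `f` commutes with the projections.
    have h1 : z ∈ (⨆ m, (gr m).comap ((LinearMap.ker f).subtype.restrictScalars F)).map
        ((LinearMap.ker f).subtype.restrictScalars F) := by
      refine eq_of_wtProj h.isInternal fun m => ?_
      have h2 := map_wtProj h.isInternal h'.isInternal (f.restrictScalars F) hf m z
      simp only [LinearMap.restrictScalars_apply] at h2
      rw [LinearMap.mem_ker.1 hz, map_zero] at h2
      exact ⟨⟨wtProj h.isInternal m z, h2⟩,
        Submodule.mem_iSup_of_mem m (wtProj_mem h.isInternal m z), rfl⟩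
    obtain ⟨z', hz', h3⟩ := h1
    obtain rfl : z' = ⟨z, hz⟩ := Subtype.ext h3
    exact hz'
  smul_mem i j m a ha b hb z hz := h.smul_mem i j m a ha b hb z.1 hz

end Radical

/-- A graded bimodule. -/
structure GradedBimod {F : Type w} {A : Type x} [Field F] [Ring A] [Algebra F A]
    (𝒜 : ℕ → Submodule F A) where
  X : Type x
  [addCommGroup : AddCommGroup X]
  [module : Module F X]
  [envModule : Module (Env F A) X]
  [isScalarTower : IsScalarTower F (Env F A) X]
  gr : ℕ → Submodule F X
  isGraded : IsGradedBimod 𝒜 gr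

attribute [instance] GradedBimod.addCommGroup GradedBimod.module GradedBimod.envModule
  GradedBimod.isScalarTower

/-- A projective cover of a graded bimodule. -/
structure ProjCover {F : Type w} {A : Type x} [Field F] [Ring A] [Algebra F A]
    {𝒜 : ℕ → Submodule F A} (N : GradedBimod 𝒜) where
  P : GradedBimod 𝒜
  f : P.X →ₗ[Env F A] N.X
  projective : Module.Projective (Env F A) P.X
  surjective : Function.Surjective f
  map_mem : ∀ m, ∀ z ∈ P.gr m, f z ∈ N.gr m
  radical_of_map_eq_zero : ∀ z, f z = 0 → z ∈ radical 𝒜 P.X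

section Generated

/-! ### Projective graded bimodules with given generators -/

variable {F : Type w} {A : Type x} [Field F] [Ring A] [Algebra F A]
  {𝒜 : ℕ → Submodule F A} {B : Type x} (ε : B → Env F A) (deg : B → ℕ)

/-- The endomorphism of a free module multiplying each coordinate by a given element. -/
def coordMul : (B →₀ Env F A) →ₗ[Env F A] (B →₀ Env F A) :=
  Finsupp.linearCombination (Env F A) fun b => Finsupp.single b (ε b)

theorem coordMul_single (b : B) (s : Env F A) :
    coordMul ε (Finsupp.single b s) = Finsupp.single b (s * ε b) := by
  rw [coordMul, Finsupp.linearCombination_single, Finsupp.smul_single, smul_eq_mul]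

/-- The direct sum of the left ideals generated by a family of idempotents. -/
def IdemSum : Type x := LinearMap.range (coordMul ε)

namespace IdemSum

instance : AddCommGroup (IdemSum ε) := inferInstanceAs (AddCommGroup (LinearMap.range (coordMul ε)))
instance : Module (Env F A) (IdemSum ε) :=
  inferInstanceAs (Module (Env F A) (LinearMap.range (coordMul ε)))
instance : Module F (IdemSum ε) := Module.compHom _ (algebraMap F (Env F A))
instance : IsScalarTower F (Env F A) (IdemSum ε) := ⟨fun c s z => by
  rw [Algebra.smul_def, mul_smul]; rfl⟩

/-- The inclusion of the direct sum of left ideals in a free module. -/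
def incl : IdemSum ε →ₗ[Env F A] (B →₀ Env F A) := (LinearMap.range (coordMul ε)).subtype

/-- The projection of a free module onto the direct sum of left ideals. -/
def ofFree : (B →₀ Env F A) →ₗ[Env F A] IdemSum ε := (coordMul ε).rangeRestrict

theorem ofFree_surjective : Function.Surjective (ofFree ε) := (coordMul ε).surjective_rangeRestrict

theorem incl_injective : Function.Injective (incl ε) := Submodule.subtype_injective _

end IdemSum

open IdemSum

/-- The generators of the direct sum of left ideals. -/
def idemGen (b : B) : IdemSum ε := ofFree ε (Finsupp.single b 1)

theorem incl_idemGen (b : B) : incl ε (idemGen ε b) = Finsupp.single b (ε b) :=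
  (coordMul_single ε b 1).trans (by rw [one_mul])

variable (𝒜) in
/-- The grading of the direct sum of left ideals with generators in prescribed weights. -/
def idemGr (m : ℕ) : Submodule F (IdemSum ε) :=
  Submodule.span F {z | ∃ (n : ℕ) (b : B) (s : Env F A), n + deg b = m ∧ s ∈ envGr 𝒜 n ∧
    z = s • idemGen ε b}

theorem ofFree_single (b : B) (s : Env F A) :
    ofFree ε (Finsupp.single b s) = s • idemGen ε b := by
  rw [idemGen, ← map_smul, Finsupp.smul_single, smul_eq_mul, mul_one]

theorem idemSum_induction {P : IdemSum ε → Prop} (z : IdemSum ε) (zero : P 0)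
    (add : ∀ z z', P z → P z' → P (z + z')) (smul : ∀ (s : Env F A) b, P (s • idemGen ε b)) :
    P z := by
  obtain ⟨z, rfl⟩ := ofFree_surjective ε z
  induction z using Finsupp.induction_linear with
  | zero => rwa [map_zero]
  | add z z' h h' => rw [map_add]; exact add _ _ h h'
  | single b s => rw [ofFree_single]; exact smul s b

variable {ε}

theorem idem_smul_idemGen (hε : ∀ b, ε b * ε b = ε b) (b : B) : ε b • idemGen ε b = idemGen ε b :=
  incl_injective ε (by
    rw [map_smul, incl_idemGen, Finsupp.smul_single, smul_eq_mul, hε])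

/-- Right multiplication by an idempotent is a projection of the enveloping algebra onto the left
ideal that it generates. -/
theorem idemSum_projective (hε : ∀ b, ε b * ε b = ε b) :
    Module.Projective (Env F A) (IdemSum ε) := by
  refine Module.Projective.of_split (incl ε) (ofFree ε) ?_
  ext z : 1
  refine idemSum_induction ε (P := fun z => (ofFree ε ∘ₗ incl ε) z = LinearMap.id z) z
    (by simp) (fun z z' h h' => by rw [map_add, h, h', map_add]) fun s b => ?_
  rw [map_smul, map_smul, LinearMap.comp_apply, incl_idemGen, ofFree_single,
    idem_smul_idemGen hε, LinearMap.id_apply]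

variable (ε) in
theorem incl_smul_idemGen (s : Env F A) (b : B) :
    incl ε (s • idemGen ε b) = Finsupp.single b (s * ε b) := by
  rw [map_smul, incl_idemGen, Finsupp.smul_single, smul_eq_mul]

variable (ε) in
/-- A coordinate of an element of the direct sum of left ideals. -/
def idemCoord (b : B) : IdemSum ε →ₗ[F] Env F A :=
  Finsupp.lapply b ∘ₗ (incl ε).restrictScalars F

theorem idemCoord_apply (b : B) (z : IdemSum ε) : idemCoord ε b z = incl ε z b := rfl

theorem idemGr_induction {m : ℕ} {P : IdemSum ε → Prop} {z : IdemSum ε}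
    (hz : z ∈ idemGr 𝒜 ε deg m) (zero : P 0) (add : ∀ z z', P z → P z' → P (z + z'))
    (smul : ∀ (c : F) z, P z → P (c • z))
    (mem : ∀ (n : ℕ) (b : B) (s : Env F A), n + deg b = m → s ∈ envGr 𝒜 n →
      P (s • idemGen ε b)) : P z := by
  refine Submodule.span_induction (p := fun z _ => P z) ?_ zero (fun x y _ _ => add x y)
    (fun c x _ => smul c x) hz
  rintro _ ⟨n, b, s, hn, hs, rfl⟩
  exact mem n b s hn hs

-- With generators in weight `deg b`, the part of weight `n` is detected by the components of weight
-- `n - deg b` of the coordinates. The hypothesis `hε` says that right multiplication by the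
-- idempotents preserves weights.
open Classical in
theorem idemGr_isInternal (h : DirectSum.IsInternal 𝒜)
    (hε : ∀ b, ∀ n, ∀ s ∈ envGr 𝒜 n, s * ε b ∈ envGr 𝒜 n) :
    DirectSum.IsInternal (idemGr 𝒜 ε deg) := by
  let hE := envGr_isInternal h
  let π (n : ℕ) : IdemSum ε →ₗ[F] (B → Env F A) := LinearMap.pi fun b =>
    if deg b ≤ n then wtProj hE (n - deg b) ∘ₗ idemCoord ε b else 0
  have hπ (n : ℕ) (z : IdemSum ε) (b : B) : π n z b =
      if deg b ≤ n then wtProj hE (n - deg b) (idemCoord ε b z) else 0 := by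
    simp only [π, LinearMap.pi_apply]
    split_ifs <;> rfl
  have key (n k : ℕ) (b : B) (s : Env F A) (hs : s ∈ envGr 𝒜 k) (b' : B) :
      π n (s • idemGen ε b) b' =
        if k + deg b = n then idemCoord ε b' (s • idemGen ε b) else 0 := by
    have h3 := hε b k s hs
    rw [hπ, idemCoord_apply, incl_smul_idemGen]
    by_cases hb : b' = b
    · subst hb
      rw [Finsupp.single_eq_same]
      split_ifs with h4 h5 h5
      · rw [show n - deg b' = k by omega, wtProj_of_mem hE h3]
      · rw [wtProj_of_ne hE (by omega) h3]
      · omega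
      · rfl
    · rw [Finsupp.single_eq_of_ne hb, map_zero, ite_self, ite_self]
  refine isInternal_of_proj π ?_ ?_ ?_
  · intro m z hz h0
    suffices h : ∀ b, π m z b = idemCoord ε b z from
      incl_injective ε (Finsupp.ext fun b => (h b).symm.trans (congrFun h0 b))
    intro b'
    refine idemGr_induction deg (P := fun z => π m z b' = idemCoord ε b' z) hz
      (by rw [map_zero, map_zero]; rfl)
      (fun x y hx hy => by rw [map_add, map_add, Pi.add_apply, hx, hy])
      (fun c x hx => by rw [map_smul, map_smul, Pi.smul_apply, hx]) ?_
    intro n b s hn hs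
    rw [key m n b s hs, if_pos hn]
  · intro m n hmn z hz
    refine funext fun b' => ?_
    refine idemGr_induction deg (P := fun z => π n z b' = 0) hz
      (by rw [map_zero]; rfl)
      (fun x y hx hy => by rw [map_add, Pi.add_apply, hx, hy, add_zero])
      (fun c x hx => by rw [map_smul, Pi.smul_apply, hx, smul_zero]) ?_
    intro k b s hk hs
    rw [key n k b s hs, if_neg (by omega)]
  · intro z
    refine idemSum_induction ε (P := fun z => z ∈ ⨆ m, idemGr 𝒜 ε deg m) z (zero_mem _)
      (fun _ _ => add_mem) fun s b => ?_
    induction s using wt_hom_induction hE with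
    | zero => rw [zero_smul]; exact zero_mem _
    | add s t hs ht => rw [add_smul]; exact add_mem hs ht
    | mem n s hs =>
      exact Submodule.mem_iSup_of_mem (n + deg b) (Submodule.subset_span ⟨n, b, s, rfl, hs, rfl⟩)

theorem idemGr_isGraded (h : IsGradedBimod 𝒜 𝒜) (h1 : (1 : A) ∈ 𝒜 0)
    (hε : ∀ b, ∀ n, ∀ s ∈ envGr 𝒜 n, s * ε b ∈ envGr 𝒜 n) :
    IsGradedBimod 𝒜 (N := IdemSum ε) (idemGr 𝒜 ε deg) where
  isInternal := idemGr_isInternal deg h.isInternal hε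
  smul_mem i j m a ha a' ha' z hz := by
    refine idemGr_induction deg
      (P := fun z => Env.tmul F a a' • z ∈ idemGr 𝒜 ε deg (i + m + j)) hz
      (by rw [smul_zero]; exact zero_mem _)
      (fun x y hx hy => by rw [smul_add]; exact add_mem hx hy)
      (fun c x hx => by rw [env_smul_comm]; exact Submodule.smul_mem _ c hx) ?_
    intro n b s hn hs
    rw [smul_smul]
    exact Submodule.subset_span ⟨i + n + j, b, _, by omega,
      (env_isGradedBimod h h1).smul_mem i j n a ha a' ha' s hs, rfl⟩

/-- The map out of the direct sum of left ideals with prescribed values on the generators. -/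
def idemLift {N : Type*} [AddCommGroup N] [Module (Env F A) N] (l : B → N) :
    IdemSum ε →ₗ[Env F A] N :=
  Finsupp.linearCombination (Env F A) l ∘ₗ incl ε

theorem idemLift_gen {N : Type*} [AddCommGroup N] [Module (Env F A) N] (l : B → N) (b : B) :
    idemLift (ε := ε) l (idemGen ε b) = ε b • l b := by
  rw [idemLift, LinearMap.comp_apply, incl_idemGen,
    Finsupp.linearCombination_single]

end Generated
end QuadraticQuiver
end

noncomputable section
namespace QuadraticQuiver
open PathAlg QuadAlg IdemSum

/-! ### Projective covers and existence of a minimal resolution. -/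

section Resolution

variable {F : Type w} {Q : Type u} [Field F] [Quiver.{v} Q] [Fintype Q]
  [∀ i j : Q, Fintype (i ⟶ j)] (R : QuadraticRelations F Q)

/-- The idempotent of the enveloping algebra given by a pair of vertices. -/
def vertexIdem (i j : Q) : Env F (QuadAlg R) := Env.tmul F (proj R (e i)) (proj R (e j))

theorem vertexIdem_mul_self (i j : Q) :
    vertexIdem R i j * vertexIdem R i j = vertexIdem R i j := by
  rw [vertexIdem, Env.tmul_mul_tmul, ← map_mul (proj R), ← map_mul (proj R), e_mul_e_self,
    e_mul_e_self]

theorem mul_vertexIdem_mem (i j : Q) {n : ℕ} {s : Env F (QuadAlg R)}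
    (hs : s ∈ envGr (QuadAlg.wt R) n) : s * vertexIdem R i j ∈ envGr (QuadAlg.wt R) n := by
  have h := tmul_mem_envGr (F := F) (proj_mem R (PathAlg.e_mem_wt i))
    (proj_mem R (PathAlg.e_mem_wt j))
  have h2 := envGr_smul_mem (env_isGradedBimod (QuadAlg.isGradedBimod R) (QuadAlg.one_mem_wt R))
    hs h
  exact h2

/-- Modulo the radical only coefficients of weight 0 remain. These act on a generator supported at a
pair of vertices through scalars of F, so the generators span over F. -/
theorem idemGen_mod_radical {B : Type (max u v w)} (i j : B → Q)
    (z : IdemSum fun b => vertexIdem R (i b) (j b)) :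
    ∃ c : B →₀ F, z - Finsupp.linearCombination F (idemGen fun b => vertexIdem R (i b) (j b)) c ∈
      radical (QuadAlg.wt R) (IdemSum fun b => vertexIdem R (i b) (j b)) := by
  refine idemSum_induction _ (P := fun z => ∃ c : B →₀ F,
    z - Finsupp.linearCombination F (idemGen fun b => vertexIdem R (i b) (j b)) c ∈
      radical (QuadAlg.wt R) (IdemSum fun b => vertexIdem R (i b) (j b))) z ?_ ?_ ?_
  · exact ⟨0, by rw [map_zero, sub_zero]; exact zero_mem _⟩
  · rintro z z' ⟨c, hc⟩ ⟨c', hc'⟩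
    refine ⟨c + c', ?_⟩
    rw [map_add, add_sub_add_comm]
    exact add_mem hc hc'
  · intro s b
    induction s using env_hom_induction (QuadAlg.isInternal_wt R) with
    | add s t hs ht =>
      obtain ⟨c, hc⟩ := hs
      obtain ⟨c', hc'⟩ := ht
      refine ⟨c + c', ?_⟩
      rw [map_add, add_smul, add_sub_add_comm]
      exact add_mem hc hc'
    | tmul k l a ha a' ha' =>
      by_cases hk : k = 0
      · by_cases hl : l = 0
        · subst hk hl
          obtain ⟨x, hx, rfl⟩ := ha
          obtain ⟨y, hy, rfl⟩ := ha'
          obtain ⟨c, hc⟩ := PathAlg.vertex_scalars hx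
          obtain ⟨d, hd⟩ := PathAlg.vertex_scalars hy
          refine ⟨Finsupp.single b (c (i b) * d (j b)), ?_⟩
          rw [Finsupp.linearCombination_single, ← idem_smul_idemGen
            (fun b => vertexIdem_mul_self R (i b) (j b)) b, smul_smul, vertexIdem,
            AlgHom.toLinearMap_apply, AlgHom.toLinearMap_apply,
            KoszulTerm.tmul_vertex R (hc (i b)).1 (hd (j b)).2, smul_assoc, sub_self]
          exact zero_mem _
        · refine ⟨0, ?_⟩
          rw [map_zero, sub_zero]
          refine Submodule.subset_span ⟨l, a', (lact a : Env F (QuadAlg R)) •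
            idemGen (fun b => vertexIdem R (i b) (j b)) b, by omega, ha', Or.inr ?_⟩
          rw [smul_smul, Env.ract_mul_lact]
      · refine ⟨0, ?_⟩
        rw [map_zero, sub_zero]
        refine Submodule.subset_span ⟨k, a, (ract a' : Env F (QuadAlg R)) •
          idemGen (fun b => vertexIdem R (i b) (j b)) b, by omega, ha, Or.inl ?_⟩
        rw [smul_smul, Env.lact_mul_ract]

/-- Homogeneous elements supported at pairs of vertices are chosen so as to form a basis of N modulo
its radical. The projective bimodule on these generators surjects by Nakayama, and the linear
independence modulo the radical puts the kernel in the radical. -/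
theorem nonempty_projCover (N : GradedBimod (QuadAlg.wt R)) : Nonempty (ProjCover N) := by
  -- The index records the two vertices and the weight together with the element, so that a basis
  -- extracted from `T` keeps track of them.
  let T := {t : (Q × Q × ℕ) × N.X // t.2 ∈ N.gr t.1.2.2 ∧
    vertexIdem R t.1.1 t.1.2.1 • t.2 = t.2}
  let rad := radical (QuadAlg.wt R) N.X
  obtain ⟨B, a, -, hspan, hli⟩ := exists_linearIndependent' F (fun t : T => rad.mkQ t.1.2)
  let i (b : B) : Q := (a b).1.1.1
  let j (b : B) : Q := (a b).1.1.2.1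
  let deg (b : B) : ℕ := (a b).1.1.2.2
  let l (b : B) : N.X := (a b).1.2
  have hl (b : B) : l b ∈ N.gr (deg b) := (a b).2.1
  have hl' (b : B) : vertexIdem R (i b) (j b) • l b = l b := (a b).2.2
  let ε (b : B) := vertexIdem R (i b) (j b)
  have hε (b : B) : ε b * ε b = ε b := vertexIdem_mul_self R (i b) (j b)
  have hgr : IsGradedBimod (QuadAlg.wt R) (N := IdemSum ε) (idemGr (QuadAlg.wt R) ε deg) :=
    idemGr_isGraded deg (QuadAlg.isGradedBimod R) (QuadAlg.one_mem_wt R)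
      fun b n s hs => mul_vertexIdem_mem R (i b) (j b) hs
  let P : GradedBimod (QuadAlg.wt R) := { X := IdemSum ε, gr := _, isGraded := hgr }
  let f : IdemSum ε →ₗ[Env F (QuadAlg R)] N.X := idemLift l
  have hf (b : B) : f (idemGen ε b) = l b := (idemLift_gen l b).trans (hl' b)
  have hfF (c : F) (z : IdemSum ε) : f (c • z) = c • f z := (f.restrictScalars F).map_smul c z
  have hmem (m : ℕ) (z : IdemSum ε) (hz : z ∈ idemGr (QuadAlg.wt R) ε deg m) : f z ∈ N.gr m := by
    refine idemGr_induction deg (P := fun z => f z ∈ N.gr m) hz (by rw [map_zero]; exact zero_mem _)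
      (fun x y hx hy => by rw [map_add]; exact add_mem hx hy)
      (fun c x hx => by rw [hfF]; exact Submodule.smul_mem _ c hx) ?_
    intro n b s hn hs
    rw [map_smul, hf, ← hn]
    exact envGr_smul_mem N.isGraded hs (hl b)
  suffices h : Function.Surjective f ∧ ∀ z, f z = 0 → z ∈ radical (QuadAlg.wt R) (IdemSum ε) from
    ⟨ProjCover.mk P f (idemSum_projective hε) h.1 hmem h.2⟩
  constructor
  · refine surjective_of_radical hgr N.isGraded (QuadAlg.one_mem_wt R) f hmem fun z => ?_
    have h1 : rad.mkQ z ∈ Submodule.span F (Set.range fun t : T => rad.mkQ t.1.2) := by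
      induction z using wt_hom_induction N.isGraded.isInternal with
      | zero => rw [map_zero]; exact zero_mem _
      | add z z' h h' => rw [map_add]; exact add_mem h h'
      | mem m z hz =>
        -- The pieces e_i z e_j of a homogeneous element belong to `T`, so `T` spans N.
        have h2 : z = ∑ i : Q, ∑ j : Q, vertexIdem R i j • z := by
          simp only [← Finset.sum_smul]
          rw [show ∑ i : Q, ∑ j : Q, vertexIdem R i j = 1 from KoszulTerm.sum_sum_tmul_e R,
            one_smul]
        rw [h2, map_sum]
        refine Submodule.sum_mem _ fun i _ => ?_
        rw [map_sum]
        refine Submodule.sum_mem _ fun j _ => Submodule.subset_span ⟨⟨⟨(i, j, m),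
          vertexIdem R i j • z⟩, ?_, ?_⟩, rfl⟩
        · have h3 := N.isGraded.smul_mem 0 0 m _ (proj_mem R (PathAlg.e_mem_wt i)) _
            (proj_mem R (PathAlg.e_mem_wt j)) z hz
          rwa [zero_add, add_zero] at h3
        · rw [smul_smul, vertexIdem_mul_self]
    rw [← hspan] at h1
    have h2 : Submodule.span F (Set.range ((fun t : T => rad.mkQ t.1.2) ∘ a)) ≤
        (LinearMap.range (f.restrictScalars F)).map rad.mkQ := by
      rw [Submodule.span_le]
      rintro _ ⟨b, rfl⟩
      exact ⟨l b, ⟨idemGen ε b, hf b⟩, rfl⟩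
    obtain ⟨_, ⟨y, rfl⟩, hy⟩ := h2 h1
    exact ⟨y, (Submodule.Quotient.eq rad).1 hy.symm⟩
  · intro z hz
    obtain ⟨c, hc⟩ := idemGen_mod_radical R i j z
    have h1 := map_mem_radical f hc
    have h2 : f (Finsupp.linearCombination F (idemGen ε) c) = Finsupp.linearCombination F l c := by
      rw [← LinearMap.restrictScalars_apply F f, Finsupp.apply_linearCombination]
      congr 2
      exact funext hf
    -- Applying `f` shows that the combination of the chosen elements with coefficients `c` is in
    -- the radical of N, so `c = 0`.
    rw [map_sub, hz, zero_sub, neg_mem_iff, h2] at h1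
    have h3 : Finsupp.linearCombination F ((fun t : T => rad.mkQ t.1.2) ∘ a) c = 0 := by
      have h4 := Finsupp.apply_linearCombination F rad.mkQ l c
      refine Eq.trans ?_ (h4.symm.trans ((Submodule.Quotient.mk_eq_zero rad).2 h1))
      rfl
    have h4 : c = 0 := linearIndependent_iff.1 hli c h3
    rw [h4, map_zero, sub_zero] at hc
    exact hc

variable {R} in
/-- The kernel of a projective cover. -/
def ProjCover.ker {N : GradedBimod (QuadAlg.wt R)} (C : ProjCover N) :
    GradedBimod (QuadAlg.wt R) where
  X := LinearMap.ker C.f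
  gr := _
  isGraded := isGradedBimod_ker C.P.isGraded N.isGraded C.f C.map_mem

/-- A projective cover of a graded bimodule. -/
def projCover (N : GradedBimod (QuadAlg.wt R)) : ProjCover N := (nonempty_projCover R N).some

/-- The syzygies of the bimodule `A`. -/
def syzygy : ℕ → GradedBimod (QuadAlg.wt R)
  | 0 => { X := QuadAlg R, gr := QuadAlg.wt R, isGraded := QuadAlg.isGradedBimod R }
  | n + 1 => (projCover R (syzygy n)).ker

/-- The resolution of `A` by iterated projective covers. -/
def minRes : BimodComplex F (QuadAlg R) where
  X n := (projCover R (syzygy R n)).P.X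
  d n := (LinearMap.ker (projCover R (syzygy R n)).f).subtype ∘ₗ (projCover R (syzygy R (n + 1))).f
  aug := (projCover R (syzygy R 0)).f
  gr n := (projCover R (syzygy R n)).P.gr
  d_d n z := by
    have h := ((projCover R (syzygy R (n + 2))).f z).2
    rw [LinearMap.mem_ker] at h
    exact (congrArg (LinearMap.ker (projCover R (syzygy R n)).f).subtype h).trans (map_zero _)
  aug_d z := ((projCover R (syzygy R 1)).f z).2

/-- Minimality holds because each differential takes its values in the kernel of a projective cover.
-/
theorem minRes_isMinimalResolution : IsMinimalResolution (QuadAlg.wt R) (minRes R) where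
  projective n := (projCover R (syzygy R n)).projective
  isInternal n := (projCover R (syzygy R n)).P.isGraded.isInternal
  smul_mem n := (projCover R (syzygy R n)).P.isGraded.smul_mem
  d_mem n m z hz := (projCover R (syzygy R (n + 1))).map_mem m z hz
  aug_mem m z hz := (projCover R (syzygy R 0)).map_mem m z hz
  aug_surjective := (projCover R (syzygy R 0)).surjective
  exact_zero := by
    intro z
    constructor
    · intro hz
      obtain ⟨y, hy⟩ := (projCover R (syzygy R 1)).surjective ⟨z, hz⟩
      exact ⟨y, congrArg Subtype.val hy⟩
    · rintro ⟨y, rfl⟩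
      exact (minRes R).aug_d y
  exact_succ n := by
    intro z
    constructor
    · intro hz
      obtain ⟨y, hy⟩ := (projCover R (syzygy R (n + 2))).surjective
        ⟨z, LinearMap.mem_ker.2 (Subtype.ext hz)⟩
      exact ⟨y, congrArg Subtype.val hy⟩
    · rintro ⟨y, rfl⟩
      exact (minRes R).d_d n y
  minimal n z := (projCover R (syzygy R n)).radical_of_map_eq_zero _
    ((projCover R (syzygy R (n + 1))).f z).2

end Resolution
end QuadraticQuiver
end

noncomputable section
namespace QuadraticQuiver
open PathAlg QuadAlg

/-! ### Weights occurring in a minimal resolution. -/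

namespace IsMinimalResolution

variable {F : Type w} {A : Type x} [Field F] [Ring A] [Algebra F A] {𝒜 : ℕ → Submodule F A}
  {P : BimodComplex F A}

theorem isGradedBimod (hP : IsMinimalResolution 𝒜 P) (n : ℕ) : IsGradedBimod 𝒜 (P.gr n) :=
  ⟨hP.isInternal n, hP.smul_mem n⟩

/-- Exactness holds in each weight: the component of weight `m` of any preimage is still a preimage.
The next two lemmas follow the same pattern. -/
theorem exists_of_aug (hP : IsMinimalResolution 𝒜 P) {m : ℕ} {z : P.X 0} (hz : z ∈ P.gr 0 m)
    (h : P.aug z = 0) : ∃ y ∈ P.gr 1 m, P.d 0 y = z := by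
  obtain ⟨y, rfl⟩ := (hP.exact_zero z).1 h
  refine ⟨wtProj (hP.isInternal 1) m y, wtProj_mem _ _ _, ?_⟩
  exact (map_wtProj (hP.isInternal 1) (hP.isInternal 0) ((P.d 0).restrictScalars F)
    (hP.d_mem 0) m y).trans (wtProj_of_mem _ hz)

theorem exists_of_d (hP : IsMinimalResolution 𝒜 P) {n m : ℕ} {z : P.X (n + 1)}
    (hz : z ∈ P.gr (n + 1) m) (h : P.d n z = 0) : ∃ y ∈ P.gr (n + 2) m, P.d (n + 1) y = z := by
  obtain ⟨y, rfl⟩ := (hP.exact_succ n z).1 h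
  refine ⟨wtProj (hP.isInternal (n + 2)) m y, wtProj_mem _ _ _, ?_⟩
  exact (map_wtProj (hP.isInternal (n + 2)) (hP.isInternal (n + 1))
    ((P.d (n + 1)).restrictScalars F) (hP.d_mem (n + 1)) m y).trans (wtProj_of_mem _ hz)

theorem exists_aug (hP : IsMinimalResolution 𝒜 P) (hA : DirectSum.IsInternal 𝒜) {m : ℕ} {a : A}
    (ha : a ∈ 𝒜 m) : ∃ y ∈ P.gr 0 m, P.aug y = a := by
  obtain ⟨y, rfl⟩ := hP.aug_surjective a
  refine ⟨wtProj (hP.isInternal 0) m y, wtProj_mem _ _ _, ?_⟩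
  exact (map_wtProj (hP.isInternal 0) hA (P.aug.restrictScalars F) hP.aug_mem m y).trans
    (wtProj_of_mem _ ha)

theorem mem_radical_of_aug (hP : IsMinimalResolution 𝒜 P) {z : P.X 0} (h : P.aug z = 0) :
    z ∈ radical 𝒜 (P.X 0) := by
  obtain ⟨y, rfl⟩ := (hP.exact_zero z).1 h
  exact hP.minimal 0 y

theorem mem_radical_of_d (hP : IsMinimalResolution 𝒜 P) {n : ℕ} {z : P.X (n + 1)}
    (h : P.d n z = 0) : z ∈ radical 𝒜 (P.X (n + 1)) := by
  obtain ⟨y, rfl⟩ := (hP.exact_succ n z).1 h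
  exact hP.minimal (n + 1) y

/-- Nothing of lower weight is available to generate an element of the radical in the lowest weight.
-/
theorem eq_zero_of_mem_radical (hP : IsMinimalResolution 𝒜 P) (h1 : (1 : A) ∈ 𝒜 0) {n m : ℕ}
    (hlow : ∀ l < m, ∀ z ∈ P.gr n l, z = 0) {z : P.X n} (hz : z ∈ P.gr n m)
    (h : z ∈ radical 𝒜 (P.X n)) : z = 0 := by
  have h2 := wtProj_radical_mem (S := ⊥) (m := m) (hP.isGradedBimod n) h1
    (fun l hl z hz => (Submodule.mem_bot _).2 (hlow l hl z hz)) h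
  rwa [wtProj_of_mem _ hz, Submodule.mem_bot] at h2

/-- Take `z` in P_{n+1} of weight at most n. Its image in P_n has weight below n, or has weight n
and lies in the radical; in both cases it vanishes. So `z` is a cycle, hence lies in the radical,
and an induction on the weight concludes. -/
theorem eq_zero_of_lt (hP : IsMinimalResolution 𝒜 P) (h1 : (1 : A) ∈ 𝒜 0) :
    ∀ n m : ℕ, m < n → ∀ z ∈ P.gr n m, z = 0
  | 0, m, h, _, _ => absurd h (Nat.not_lt_zero m)
  | n + 1, m, h, z, hz => by
    have ih := eq_zero_of_lt hP h1 n
    induction m using Nat.strong_induction_on generalizing z with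
    | _ m ihm =>
    refine hP.eq_zero_of_mem_radical h1 (fun l hl z hz => ihm l hl (by omega) z hz) hz
      (hP.mem_radical_of_d ?_)
    have hd := hP.d_mem n m z hz
    rcases Nat.lt_or_ge m n with hm | hm
    · exact ih m hm _ hd
    · exact hP.eq_zero_of_mem_radical h1 (fun l hl z hz => ih l (by omega) z hz) hd
        (hP.minimal n z)

/-- Injectivity of the differential in the lowest weight of P_{n+1}; existence and uniqueness of ι
and the computation of P_3 in weight 3 depend on it. -/
theorem eq_zero_of_d (hP : IsMinimalResolution 𝒜 P) (h1 : (1 : A) ∈ 𝒜 0) {n : ℕ}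
    {z : P.X (n + 1)} (hz : z ∈ P.gr (n + 1) (n + 1)) (h : P.d n z = 0) : z = 0 :=
  hP.eq_zero_of_mem_radical h1 (hP.eq_zero_of_lt h1 (n + 1)) hz (hP.mem_radical_of_d h)

theorem eq_zero_of_aug (hP : IsMinimalResolution 𝒜 P) (h1 : (1 : A) ∈ 𝒜 0) {z : P.X 0}
    (hz : z ∈ P.gr 0 0) (h : P.aug z = 0) : z = 0 :=
  hP.eq_zero_of_mem_radical h1 (hP.eq_zero_of_lt h1 0) hz (hP.mem_radical_of_aug h)

end IsMinimalResolution

/-! ### The morphism from K(A) to a minimal resolution. -/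

section KoszulComparison

variable {F : Type w} {Q : Type u} [Field F] [Quiver.{v} Q] [Fintype Q]
  [∀ i j : Q, Fintype (i ⟶ j)] {R : QuadraticRelations F Q}

namespace KoszulTerm

/-- The injectivity of `D` in weight `p` makes the preimages of the values on generators unique. So
any choice of preimages is automatically linear and compatible with k, and it extends to a bimodule
map. -/
theorem exists_lift {N N' : Type*} [AddCommGroup N] [Module F N] [Module (Env F (QuadAlg R)) N]
    [IsScalarTower F (Env F (QuadAlg R)) N] [AddCommGroup N'] [Module F N']
    [Module (Env F (QuadAlg R)) N'] [IsScalarTower F (Env F (QuadAlg R)) N']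
    {grN : ℕ → Submodule F N} (hN : IsGradedBimod (QuadAlg.wt R) grN) {p : ℕ}
    (D : N →ₗ[Env F (QuadAlg R)] N') (hD : ∀ z ∈ grN p, D z = 0 → z = 0)
    (U : KoszulTerm R p →ₗ[Env F (QuadAlg R)] N')
    (hU : ∀ x, ∃ y ∈ grN p, D y = U (gen R p x)) :
    ∃ g : KoszulTerm R p →ₗ[Env F (QuadAlg R)] N, (∀ x, g (gen R p x) ∈ grN p) ∧
      ∀ z, D (g z) = U z := by
  choose g hg hDg using hU
  have hinj {y y' : N} (hy : y ∈ grN p) (hy' : y' ∈ grN p) (h : D y = D y') : y = y' :=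
    sub_eq_zero.1 (hD _ (sub_mem hy hy') (by rw [map_sub, h, sub_self]))
  let g' : W R p →ₗ[F] N :=
    { toFun := g
      map_add' := fun x y => hinj (hg _) (add_mem (hg _) (hg _)) (by
        rw [hDg, map_add, map_add, map_add, hDg, hDg])
      map_smul' := fun c x => hinj (hg _) (Submodule.smul_mem _ c (hg _)) (by
        rw [hDg, map_smul, RingHom.id_apply, show U (c • gen R p x) = c • U (gen R p x) from
          (U.restrictScalars F).map_smul c _, show D (c • g x) = c • D (g x) from
          (D.restrictScalars F).map_smul c _, hDg]) }
  have he : ∀ (l m : PathAlg F Q) (x y : W R p), l ∈ PathAlg.wt 0 → m ∈ PathAlg.wt 0 →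
      (y : PathAlg F Q) = l * x * m →
      g' y = Env.tmul F (proj R l) (proj R m) • g' x := by
    intro l m x y hl hm h
    refine hinj (hg y) ?_ ?_
    · have h2 := hN.smul_mem 0 0 p _ (proj_mem R hl) _ (proj_mem R hm) _ (hg x)
      rwa [zero_add, add_zero] at h2
    · rw [map_smul]
      refine (hDg y).trans ?_
      rw [gen_rel R p hl hm x y h, map_smul]
      exact congrArg _ (hDg x).symm
  refine ⟨lift R p g' he, fun x => by rw [lift_gen]; exact hg x, fun z => ?_⟩
  suffices h : D ∘ₗ lift R p g' he = U from LinearMap.congr_fun h z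
  refine hom_ext fun x => ?_
  rw [LinearMap.comp_apply, lift_gen]
  exact hDg x

theorem map_mem_of_gen {N : Type*} [AddCommGroup N] [Module F N] [Module (Env F (QuadAlg R)) N]
    [IsScalarTower F (Env F (QuadAlg R)) N] {grN : ℕ → Submodule F N}
    (hN : IsGradedBimod (QuadAlg.wt R) grN) {p : ℕ} (f : KoszulTerm R p →ₗ[Env F (QuadAlg R)] N)
    (hf : ∀ x, f (gen R p x) ∈ grN p) {m : ℕ} {z : KoszulTerm R p} (hz : z ∈ gr R p m) :
    f z ∈ grN m := by
  refine gr_induction (P := fun z => f z ∈ grN m) hz (by rw [map_zero]; exact zero_mem _)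
    (fun z z' h h' => by rw [map_add]; exact add_mem h h')
    (fun c z h => by
      rw [show f (c • z) = c • f z from (f.restrictScalars F).map_smul c z]
      exact Submodule.smul_mem _ c h) ?_
  intro i j h a ha b hb x
  rw [map_smul, ← h]
  exact hN.smul_mem i j p a ha b hb _ (hf x)

theorem aug_surjective : Function.Surjective (aug R) := fun a =>
  ⟨Env.tmul F a 1 • genOne R, by rw [aug_tmul_genOne, mul_one]⟩

end KoszulTerm

namespace IsMinimalResolution

open KoszulTerm

variable {P : BimodComplex F (QuadAlg R)}

/-- The degree `p` part of a morphism from the Koszul complex to a minimal resolution, which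
extends to the next degree. -/
def IsStage (P : BimodComplex F (QuadAlg R)) (p : ℕ)
    (f : KoszulTerm R p →ₗ[Env F (QuadAlg R)] P.X p) : Prop :=
  (∀ x, f (gen R p x) ∈ P.gr p p) ∧
    ∀ x, ∃ y ∈ P.gr (p + 1) (p + 1), P.d p y = f (KoszulTerm.d R p (gen R (p + 1) x))

theorem exists_stage_zero (hP : IsMinimalResolution (QuadAlg.wt R) P) :
    ∃ f : KoszulTerm R 0 →ₗ[Env F (QuadAlg R)] P.X 0, IsStage P 0 f ∧
      ∀ z, P.aug (f z) = KoszulTerm.aug R z := by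
  obtain ⟨f, hf, hfa⟩ := exists_lift (hP.isGradedBimod 0) P.aug
    (fun z hz => hP.eq_zero_of_aug (QuadAlg.one_mem_wt R) hz) (KoszulTerm.aug R)
    fun x => hP.exists_aug (QuadAlg.isInternal_wt R) (KoszulTerm.aug_mem (gen_mem x))
  refine ⟨f, ⟨hf, fun x => hP.exists_of_aug ?_ ?_⟩, hfa⟩
  · exact map_mem_of_gen (hP.isGradedBimod 0) f hf (KoszulTerm.d_mem (gen_mem x))
  · rw [hfa, KoszulTerm.aug_d]

theorem exists_stage_succ (hP : IsMinimalResolution (QuadAlg.wt R) P) (p : ℕ)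
    (f : KoszulTerm R p →ₗ[Env F (QuadAlg R)] P.X p) (hf : IsStage P p f) :
    ∃ g : KoszulTerm R (p + 1) →ₗ[Env F (QuadAlg R)] P.X (p + 1), IsStage P (p + 1) g ∧
      ∀ z, P.d p (g z) = f (KoszulTerm.d R p z) := by
  obtain ⟨g, hg, hgd⟩ := exists_lift (hP.isGradedBimod (p + 1)) (P.d p)
    (fun z hz => hP.eq_zero_of_d (QuadAlg.one_mem_wt R) hz) (f ∘ₗ KoszulTerm.d R p) hf.2
  refine ⟨g, ⟨hg, fun x => hP.exists_of_d ?_ ?_⟩, hgd⟩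
  · exact map_mem_of_gen (hP.isGradedBimod (p + 1)) g hg (KoszulTerm.d_mem (gen_mem x))
  · rw [hgd, LinearMap.comp_apply, KoszulTerm.d_d, map_zero]

theorem exists_homogeneous (hP : IsMinimalResolution (QuadAlg.wt R) P) :
    ∃ ι : (koszulComplex R).Hom P, ι.IsHomogeneous := by
  obtain ⟨f, hf, hfa⟩ := hP.exists_stage_zero
  choose! g hg hgd using hP.exists_stage_succ
  -- The recursion carries the proof of `IsStage`, which is what permits the next extension.
  let s : ∀ p, {f : KoszulTerm R p →ₗ[Env F (QuadAlg R)] P.X p // IsStage P p f} := fun p =>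
    Nat.rec ⟨f, hf⟩ (fun p t => ⟨g p t.1, hg p t.1 t.2⟩) p
  refine ⟨{ f := fun p => (s p).1, comm := fun p z => (hgd p (s p).1 (s p).2 z).symm,
            aug := hfa }, fun p m z hz => ?_⟩
  exact map_mem_of_gen (hP.isGradedBimod p) (s p).1 (s p).2.1 hz

/-- The components of a morphism of complexes out of the Koszul complex. -/
def koszulMap (ι : (koszulComplex R).Hom P) (p : ℕ) :
    KoszulTerm R p →ₗ[Env F (QuadAlg R)] P.X p := ι.f p

theorem koszulMap_d (ι : (koszulComplex R).Hom P) (p : ℕ) (z : KoszulTerm R (p + 1)) :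
    koszulMap ι p (KoszulTerm.d R p z) = P.d p (koszulMap ι (p + 1) z) := ι.comm p z

theorem koszulMap_aug (ι : (koszulComplex R).Hom P) (z : KoszulTerm R 0) :
    P.aug (koszulMap ι 0 z) = KoszulTerm.aug R z := ι.aug z

variable {ι : (koszulComplex R).Hom P}

theorem koszulMap_mem (hι : ι.IsHomogeneous) (p m : ℕ) (z : KoszulTerm R p) (hz : z ∈ gr R p m) :
    koszulMap ι p z ∈ P.gr p m := hι p m z hz

/-- By induction on the degree, the values of the two morphisms on a generator have the same image
one degree lower, where the map is injective in that weight. -/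
theorem hom_ext (hP : IsMinimalResolution (QuadAlg.wt R) P) {ι κ : (koszulComplex R).Hom P}
    (hι : ι.IsHomogeneous) (hκ : κ.IsHomogeneous) : ι = κ := by
  refine BimodComplex.Hom.ext (funext fun p => ?_)
  induction p with
  | zero =>
    refine KoszulTerm.hom_ext (R := R) (p := 0) fun x => ?_
    refine sub_eq_zero.1 (hP.eq_zero_of_aug (QuadAlg.one_mem_wt R)
      (sub_mem (koszulMap_mem hι 0 0 _ (gen_mem x)) (hκ 0 0 _ (gen_mem x))) ?_)
    rw [map_sub, sub_eq_zero]
    exact (koszulMap_aug ι _).trans (koszulMap_aug κ _).symm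
  | succ p ih =>
    refine KoszulTerm.hom_ext (R := R) (p := p + 1) fun x => ?_
    refine sub_eq_zero.1 (hP.eq_zero_of_d (QuadAlg.one_mem_wt R)
      (sub_mem (koszulMap_mem hι _ _ _ (gen_mem x)) (hκ _ _ _ (gen_mem x))) ?_)
    rw [map_sub, sub_eq_zero]
    exact ((koszulMap_d ι p _).symm.trans (LinearMap.congr_fun ih _)).trans (κ.comm p _)

theorem bijective_zero (hP : IsMinimalResolution (QuadAlg.wt R) P) (hι : ι.IsHomogeneous) :
    Function.Bijective (koszulMap ι 0) := by
  have := hP.projective 0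
  have hs : Function.Surjective (koszulMap ι 0) := by
    refine surjective_of_radical (KoszulTerm.isGradedBimod R 0) (hP.isGradedBimod 0)
      (QuadAlg.one_mem_wt R) (koszulMap ι 0) (koszulMap_mem hι 0) fun z => ?_
    obtain ⟨y, hy⟩ := KoszulTerm.aug_surjective (R := R) (P.aug z)
    refine ⟨y, hP.mem_radical_of_aug ?_⟩
    rw [map_sub, koszulMap_aug, sub_eq_zero]
    exact hy.symm
  refine ⟨injective_of_radical (KoszulTerm.isGradedBimod R 0) (QuadAlg.one_mem_wt R) (koszulMap ι 0) hs
    fun z hz => KoszulTerm.mem_radical_of_aug ?_, hs⟩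
  exact (koszulMap_aug ι z).symm.trans (by rw [hz, map_zero])

/-- The hypothesis `hex` gives y such that z - ι y is a cycle of P, hence in the radical: this is
surjectivity by Nakayama. Since ι_p is injective, the kernel of ι_{p+1} consists of Koszul cycles,
which lie in the radical: this is injectivity. -/
theorem bijective_succ (hP : IsMinimalResolution (QuadAlg.wt R) P) (hι : ι.IsHomogeneous) {p : ℕ}
    (hp : Function.Bijective (koszulMap ι p))
    (hex : ∀ z : P.X (p + 1), ∃ y : KoszulTerm R (p + 1),
      koszulMap ι p (KoszulTerm.d R p y) = P.d p z) : Function.Bijective (koszulMap ι (p + 1)) := by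
  have := hP.projective (p + 1)
  have hs : Function.Surjective (koszulMap ι (p + 1)) := by
    refine surjective_of_radical (KoszulTerm.isGradedBimod R (p + 1)) (hP.isGradedBimod (p + 1))
      (QuadAlg.one_mem_wt R) (koszulMap ι (p + 1)) (koszulMap_mem hι (p + 1)) fun z => ?_
    obtain ⟨y, hy⟩ := hex z
    refine ⟨y, hP.mem_radical_of_d ?_⟩
    rw [map_sub, ← koszulMap_d, sub_eq_zero]
    exact hy.symm
  refine ⟨injective_of_radical (KoszulTerm.isGradedBimod R (p + 1)) (QuadAlg.one_mem_wt R)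
    (koszulMap ι (p + 1)) hs fun z hz => KoszulTerm.mem_radical_of_d ?_, hs⟩
  refine hp.1 ((koszulMap_d ι p z).trans ?_)
  rw [hz, map_zero, map_zero]

/-- The input is exactness of K(A) in degree 0. -/
theorem bijective_one (hP : IsMinimalResolution (QuadAlg.wt R) P) (hι : ι.IsHomogeneous) :
    Function.Bijective (koszulMap ι 1) := by
  refine hP.bijective_succ hι (hP.bijective_zero hι) fun z => ?_
  obtain ⟨w, hw⟩ := (hP.bijective_zero hι).2 (P.d 0 z)
  have h : KoszulTerm.aug R w = 0 := (koszulMap_aug ι w).symm.trans (by rw [hw, P.aug_d])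
  obtain ⟨y, rfl⟩ := KoszulTerm.exact_aug h
  exact ⟨y, hw⟩

/-- The input is exactness of K(A) in degree 1, that is, the fact that R generates the relations. -/
theorem bijective_two (hP : IsMinimalResolution (QuadAlg.wt R) P) (hι : ι.IsHomogeneous) :
    Function.Bijective (koszulMap ι 2) := by
  refine hP.bijective_succ hι (hP.bijective_one hι) fun z => ?_
  obtain ⟨w, hw⟩ := (hP.bijective_one hι).2 (P.d 1 z)
  have h : KoszulTerm.d R 0 w = 0 := (hP.bijective_zero hι).1 (by
    rw [map_zero]
    exact (koszulMap_d ι 0 w).trans (by rw [hw, P.d_d]))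
  obtain ⟨y, rfl⟩ := KoszulTerm.exact_zero h
  exact ⟨y, hw⟩

theorem bijective (hP : IsMinimalResolution (QuadAlg.wt R) P) (hι : ι.IsHomogeneous) {p : ℕ}
    (hp : p ≤ 2) : Function.Bijective (koszulMap ι p) := by
  interval_cases p
  · exact hP.bijective_zero hι
  · exact hP.bijective_one hι
  · exact hP.bijective_two hι

theorem exists_mem_of_mem (hP : IsMinimalResolution (QuadAlg.wt R) P) (hι : ι.IsHomogeneous)
    {p m : ℕ} (hp : p ≤ 2) {z : P.X p} (hz : z ∈ P.gr p m) : ∃ y ∈ gr R p m, koszulMap ι p y = z := by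
  obtain ⟨y, rfl⟩ := (hP.bijective hι hp).2 z
  refine ⟨wtProj (gr_isInternal R p) m y, wtProj_mem _ _ _, ?_⟩
  exact (map_wtProj (gr_isInternal R p) (hP.isInternal p) ((koszulMap ι p).restrictScalars F) (koszulMap_mem hι p) m
    y).trans (wtProj_of_mem _ hz)

/-- The component of weight 3 of the degree 3 term of the minimal resolution is `W_3`. -/
theorem exists_gen_three (hP : IsMinimalResolution (QuadAlg.wt R) P) (hι : ι.IsHomogeneous)
    {z : P.X 3} (hz : z ∈ P.gr 3 3) : ∃ x, z = koszulMap ι 3 (gen R 3 x) := by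
  -- The boundary of `z`, seen in K_2, is a cycle of weight 3, hence the boundary of some 1 ⊗ x ⊗ 1.
  -- Then `z` and ι(1 ⊗ x ⊗ 1) have the same boundary, and the differential is injective in this
  -- weight.
  obtain ⟨y, hy, hyz⟩ := hP.exists_mem_of_mem hι le_rfl (hP.d_mem 2 3 z hz)
  have h : KoszulTerm.d R 1 y = 0 := (hP.bijective_one hι).1 (by
    rw [map_zero]
    exact (koszulMap_d ι 1 y).trans (by rw [hyz, P.d_d]))
  obtain ⟨x, rfl⟩ := KoszulTerm.exact_one_of_mem hy h
  refine ⟨x, sub_eq_zero.1 (hP.eq_zero_of_d (QuadAlg.one_mem_wt R)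
    (sub_mem hz (koszulMap_mem hι 3 3 _ (gen_mem x))) ?_)⟩
  rw [map_sub, ← hyz, sub_eq_zero]
  exact koszulMap_d ι 2 _

end IsMinimalResolution

end KoszulComparison
end QuadraticQuiver
end

noncomputable section
namespace QuadraticQuiver
open PathAlg QuadAlg

/-! ### The grading of the bar resolution. -/

section BarGrading

variable {F : Type w} {A : Type x} [Field F] [Ring A] [Algebra F A] {𝒜 : ℕ → Submodule F A}
  {Y : Type x} [AddCommGroup Y] [Module F Y] [Module (Env F A) Y] [IsScalarTower F (Env F A) Y]
  {gr : ℕ → Submodule F Y}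

namespace BalTensor

theorem mk_mem_grading (k : Submodule F A) {i j m : ℕ} (h : i + j = m) {a : A} (ha : a ∈ 𝒜 i)
    {y : Y} (hy : y ∈ gr j) : mk k a y ∈ grading k 𝒜 gr m :=
  Submodule.subset_span ⟨i, j, a, y, h, ha, hy, rfl⟩

theorem grading_induction {k : Submodule F A} {m : ℕ} {P : BalTensor k Y → Prop}
    {z : BalTensor k Y} (hz : z ∈ grading k 𝒜 gr m) (zero : P 0)
    (add : ∀ z z', P z → P z' → P (z + z')) (smul : ∀ (c : F) z, P z → P (c • z))
    (mk : ∀ i j, i + j = m → ∀ a ∈ 𝒜 i, ∀ y ∈ gr j, P (mk k a y)) : P z := by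
  refine Submodule.span_induction (p := fun z _ => P z) ?_ zero (fun x y _ _ => add x y)
    (fun c x _ => smul c x) hz
  rintro _ ⟨i, j, a, y, h, ha, hy, rfl⟩
  exact mk i j h a ha y hy

/-- The map induced by the projections to the components of weights `i` and `j`. -/
def proj₂ (hA : IsGradedBimod 𝒜 𝒜) (h1 : (1 : A) ∈ 𝒜 0) (h : IsGradedBimod 𝒜 gr) (i j : ℕ) :
    BalTensor (𝒜 0) Y →ₗ[F] BalTensor (𝒜 0) Y :=
  liftLinear (𝒜 0) ((mk (𝒜 0)).compl₁₂ (wtProj hA.isInternal i) (wtProj h.isInternal j))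
    fun a l y hl => by
      have h2 := wtProj_smul hA h1 hl i a
      rw [Env.tmul_smul, Env.tmul_smul, one_mul, one_mul, zero_add, add_zero] at h2
      have h3 := wtProj_smul h hl h1 j y
      rw [zero_add, add_zero] at h3
      rw [LinearMap.compl₁₂_apply, LinearMap.compl₁₂_apply, h2, h3, mk_mul _ _ _ hl]

theorem grading_isInternal (hA : IsGradedBimod 𝒜 𝒜) (h1 : (1 : A) ∈ 𝒜 0)
    (h : IsGradedBimod 𝒜 gr) : DirectSum.IsInternal (grading (𝒜 0) 𝒜 gr) := by
  let π (n : ℕ) : BalTensor (𝒜 0) Y →ₗ[F] BalTensor (𝒜 0) Y :=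
    ∑ ij ∈ Finset.HasAntidiagonal.antidiagonal n, proj₂ hA h1 h ij.1 ij.2
  have hπ (n : ℕ) (a : A) (y : Y) : π n (mk (𝒜 0) a y) =
      ∑ ij ∈ Finset.HasAntidiagonal.antidiagonal n,
        mk (𝒜 0) (wtProj hA.isInternal ij.1 a) (wtProj h.isInternal ij.2 y) :=
    LinearMap.sum_apply _ _ _
  refine isInternal_of_proj π ?_ ?_ ?_
  · intro n z hz h0
    suffices h : π n z = z by rw [← h, h0]
    refine grading_induction (P := fun z => π n z = z) hz (map_zero _)
      (fun x y hx hy => by rw [map_add, hx, hy]) (fun c x hx => by rw [map_smul, hx]) ?_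
    intro i j hij a ha y hy
    subst hij
    rw [hπ, Finset.sum_eq_single (i, j), wtProj_of_mem _ ha, wtProj_of_mem _ hy]
    · rintro ⟨k, l⟩ - h'
      by_cases hk : i = k
      · subst hk
        rw [wtProj_of_ne h.isInternal (fun h'' => h' (by rw [h''])) hy, map_zero]
      · rw [wtProj_of_ne hA.isInternal hk ha, map_zero, LinearMap.zero_apply]
    · simp
  · intro m n hmn z hz
    refine grading_induction (P := fun z => π n z = 0) hz (map_zero _)
      (fun x y hx hy => by rw [map_add, hx, hy, add_zero])
      (fun c x hx => by rw [map_smul, hx, smul_zero]) ?_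
    intro i j hij a ha y hy
    rw [hπ]
    refine Finset.sum_eq_zero fun ⟨k, l⟩ hkl => ?_
    rw [Finset.HasAntidiagonal.mem_antidiagonal] at hkl
    by_cases hk : i = k
    · rw [wtProj_of_ne h.isInternal (fun h' => hmn (by rw [← hkl, ← hij, hk, h'])) hy, map_zero]
    · rw [wtProj_of_ne hA.isInternal hk ha, map_zero, LinearMap.zero_apply]
  · intro z
    induction z using BalTensor.induction with
    | zero => exact zero_mem _
    | add z z' hz hz' => exact add_mem hz hz'
    | mk a y =>
      induction a using wt_hom_induction hA.isInternal with
      | zero => rw [map_zero]; exact zero_mem _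
      | add a a' h h' => rw [map_add]; exact add_mem h h'
      | mem i a ha =>
      induction y using wt_hom_induction h.isInternal with
      | zero => rw [map_zero]; exact zero_mem _
      | add y y' h h' => rw [map_add]; exact add_mem h h'
      | mem j y hy => exact Submodule.mem_iSup_of_mem (i + j) (mk_mem_grading _ rfl ha hy)

theorem grading_isGraded (hA : IsGradedBimod 𝒜 𝒜) (h1 : (1 : A) ∈ 𝒜 0)
    (h : IsGradedBimod 𝒜 gr) : IsGradedBimod 𝒜 (grading (𝒜 0) 𝒜 gr) where
  isInternal := grading_isInternal hA h1 h
  smul_mem i j m a ha b hb z hz := by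
    refine grading_induction (P := fun z => Env.tmul F a b • z ∈ grading (𝒜 0) 𝒜 gr (i + m + j)) hz
      (by rw [smul_zero]; exact zero_mem _) (fun x y hx hy => by rw [smul_add]; exact add_mem hx hy)
      (fun c x hx => by rw [env_smul_comm]; exact Submodule.smul_mem _ c hx) ?_
    intro k l hkl a' ha' y hy
    rw [smul_mk]
    have h2 := hA.smul_mem i 0 k a ha 1 h1 a' ha'
    have h3 := h.smul_mem 0 j l 1 h1 b hb y hy
    rw [Env.tmul_smul, mul_one] at h2
    exact mk_mem_grading _ (by omega) h2 h3

theorem act_mem (hA : IsGradedBimod 𝒜 𝒜) (h1 : (1 : A) ∈ 𝒜 0) (h : IsGradedBimod 𝒜 gr)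
    {k : Submodule F A} {m : ℕ} {z : BalTensor k Y} (hz : z ∈ grading k 𝒜 gr m) :
    act k Y z ∈ gr m := by
  refine grading_induction (P := fun z => act k Y z ∈ gr m) hz
      (by rw [map_zero]; exact zero_mem _) (fun x y hx hy => by rw [map_add]; exact add_mem hx hy)
      (fun c x hx => by
        rw [show act k Y (c • x) = c • act k Y x from ((act k Y).restrictScalars F).map_smul c x]
        exact Submodule.smul_mem _ c hx) ?_
  intro i j hij a ha y hy
  rw [act_mk, ← hij]
  exact h.smul_mem i 0 j a ha 1 h1 y hy

theorem map_mem {k : Submodule F A} {Y' : Type x} [AddCommGroup Y'] [Module F Y']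
    [Module (Env F A) Y'] [IsScalarTower F (Env F A) Y'] {gr' : ℕ → Submodule F Y'}
    (f : Y →ₗ[Env F A] Y') (hf : ∀ m, ∀ z ∈ gr m, f z ∈ gr' m) {m : ℕ} {z : BalTensor k Y}
    (hz : z ∈ grading k 𝒜 gr m) : map k f z ∈ grading k 𝒜 gr' m := by
  refine grading_induction (P := fun z => map k f z ∈ grading k 𝒜 gr' m) hz
      (by rw [map_zero]; exact zero_mem _) (fun x y hx hy => by rw [map_add]; exact add_mem hx hy)
      (fun c x hx => by
        rw [show map k f (c • x) = c • map k f x from ((map k f).restrictScalars F).map_smul c x]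
        exact Submodule.smul_mem _ c hx) ?_
  intro i j hij a ha y hy
  rw [map_mk]
  exact mk_mem_grading _ hij ha (hf j y hy)

/-- The contracting homotopy z ↦ 1 ⊗ z of the bar resolution, evaluated on cycles; it yields
exactness in all degrees. -/
theorem barStep_of_eq_zero {k : Submodule F A} {d : BalTensor k Y →ₗ[Env F A] Y}
    {z : BalTensor k Y} (hz : d z = 0) : barStep k d (mk k 1 z) = z := by
  rw [barStep_mk, hz, map_zero, sub_zero, lact, Env.tmul_one_one, one_smul]

end BalTensor

variable (𝒜) in
theorem barStage_isGraded (hA : IsGradedBimod 𝒜 𝒜) (h1 : (1 : A) ∈ 𝒜 0) :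
    ∀ n, IsGradedBimod 𝒜 (barStage (𝒜 0) 𝒜 n).gr
  | 0 => hA
  | n + 1 => BalTensor.grading_isGraded hA h1 (barStage_isGraded hA h1 n)

variable (𝒜) in
theorem barStage_d_mem (hA : IsGradedBimod 𝒜 𝒜) (h1 : (1 : A) ∈ 𝒜 0) :
    ∀ n m, ∀ z ∈ BalTensor.grading (𝒜 0) 𝒜 (barStage (𝒜 0) 𝒜 n).gr m,
      (barStage (𝒜 0) 𝒜 n).d z ∈ (barStage (𝒜 0) 𝒜 n).gr m
  | 0, m, z, hz => BalTensor.act_mem hA h1 hA hz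
  | n + 1, m, z, hz => sub_mem
    (BalTensor.act_mem hA h1 (BalTensor.grading_isGraded hA h1 (barStage_isGraded 𝒜 hA h1 n)) hz)
    (BalTensor.map_mem _ (barStage_d_mem hA h1 n) hz)

end BarGrading

/-! ### Projectivity of the terms of the bar resolution, and exactness. -/

section BarProjective

variable {F : Type w} {Q : Type u} [Field F] [Quiver.{v} Q] [Fintype Q]
  [∀ i j : Q, Fintype (i ⟶ j)] {R : QuadraticRelations F Q}
  {Y : Type (max u v w)} [AddCommGroup Y] [Module F Y] [Module (Env F (QuadAlg R)) Y]
  [IsScalarTower F (Env F (QuadAlg R)) Y]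

namespace BalTensor

/-- The average over the vertices of a bilinear map. -/
def avg {N : Type*} [AddCommGroup N] [Module F N] (f : QuadAlg R →ₗ[F] Y →ₗ[F] N) :
    QuadAlg R →ₗ[F] Y →ₗ[F] N :=
  ∑ i : Q, f.compl₁₂ (LinearMap.mulRight F (proj R (e i)))
    (Algebra.lsmul F F Y (lact (proj R (e i)) : Env F (QuadAlg R)))

theorem avg_apply {N : Type*} [AddCommGroup N] [Module F N] (f : QuadAlg R →ₗ[F] Y →ₗ[F] N)
    (a : QuadAlg R) (y : Y) : avg f a y =
      ∑ i : Q, f (a * proj R (e i)) ((lact (proj R (e i)) : Env F (QuadAlg R)) • y) := by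
  simp only [avg, LinearMap.sum_apply]
  rfl

/-- The sum of the e_i ⊗ e_i is a separability idempotent of k: an element of k may be moved from
one factor to the other. -/
theorem avg_balanced {N : Type*} [AddCommGroup N] [Module F N]
    (f : QuadAlg R →ₗ[F] Y →ₗ[F] N) (a l : QuadAlg R) (y : Y) (hl : l ∈ QuadAlg.wt R 0) :
    avg f (a * l) y = avg f a ((lact l : Env F (QuadAlg R)) • y) := by
  rw [avg_apply, avg_apply]
  exact sum_vertex_balanced R f a hl y

theorem avg_mk (a : QuadAlg R) (y : Y) :
    avg (mk (QuadAlg.wt R 0)) a y = mk (QuadAlg.wt R 0) a y := by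
  rw [avg_apply]
  have h (i : Q) : mk (QuadAlg.wt R 0) (a * proj R (e i))
      ((lact (proj R (e i)) : Env F (QuadAlg R)) • y) =
        mk (QuadAlg.wt R 0) (a * proj R (e i)) y := by
    rw [← mk_mul _ _ _ (proj_mem R (PathAlg.e_mem_wt i)), mul_assoc, ← map_mul (proj R),
      e_mul_e_self]
  simp only [h]
  rw [← LinearMap.sum_apply, ← map_sum, ← Finset.mul_sum, sum_proj_e, mul_one]

/-- The right action of `A` on a bimodule. -/
def ractHom₂ (Y : Type*) [AddCommGroup Y] [Module F Y] [Module (Env F (QuadAlg R)) Y]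
    [IsScalarTower F (Env F (QuadAlg R)) Y] : Y ⊗[F] QuadAlg R →ₗ[F] Y :=
  TensorProduct.lift ((Algebra.lsmul F F Y).toLinearMap ∘ₗ
    (Env.tmulBil F (QuadAlg R) 1)).flip

theorem ractHom₂_tmul (Y : Type*) [AddCommGroup Y] [Module F Y] [Module (Env F (QuadAlg R)) Y]
    [IsScalarTower F (Env F (QuadAlg R)) Y] (y : Y) (b : QuadAlg R) :
    ractHom₂ Y (y ⊗ₜ[F] b) = (ract b : Env F (QuadAlg R)) • y := rfl

/-- A splitting, as a map of right modules, of the right action `Y ⊗ A → Y`. -/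
structure IsRightSection {Y : Type*} [AddCommGroup Y] [Module F Y] [Module (Env F (QuadAlg R)) Y]
    [IsScalarTower F (Env F (QuadAlg R)) Y] (σ : Y →ₗ[F] Y ⊗[F] QuadAlg R) : Prop where
  map_ract : ∀ (b : QuadAlg R) (y : Y), σ ((ract b : Env F (QuadAlg R)) • y) =
    (LinearMap.mulRight F b).lTensor Y (σ y)
  ractHom₂_apply : ∀ y, ractHom₂ Y (σ y) = y

theorem ract_lact_comm (b l : QuadAlg R) (y : Y) : (lact l : Env F (QuadAlg R)) •
    (ract b : Env F (QuadAlg R)) • y = (ract b : Env F (QuadAlg R)) •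
      (lact l : Env F (QuadAlg R)) • y := by
  rw [smul_smul, smul_smul, Env.ract_mul_lact, Env.lact_mul_ract]

variable (R) in
theorem isRightSection_self :
    IsRightSection (TensorProduct.mk F (QuadAlg R) (QuadAlg R) 1) where
  map_ract b y := by
    rw [Env.tmul_smul, one_mul]
    rfl
  ractHom₂_apply y := by
    rw [TensorProduct.mk_apply, ractHom₂_tmul, Env.tmul_smul, one_mul, one_mul]

/-- Right projectivity passes from Y to A ⊗_k Y. It is carried through the construction of the bar
resolution as an explicit splitting, made k-balanced by averaging over the vertices. -/
theorem exists_rightSection {σ : Y →ₗ[F] Y ⊗[F] QuadAlg R} (hσ : IsRightSection σ) :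
    ∃ σ' : BalTensor (QuadAlg.wt R 0) Y →ₗ[F] BalTensor (QuadAlg.wt R 0) Y ⊗[F] QuadAlg R,
      IsRightSection σ' := by
  let f : QuadAlg R →ₗ[F] Y →ₗ[F] BalTensor (QuadAlg.wt R 0) Y ⊗[F] QuadAlg R :=
    (LinearMap.lcomp F _ σ) ∘ₗ (LinearMap.rTensorHom (QuadAlg R)) ∘ₗ mk (QuadAlg.wt R 0)
  have hf (a : QuadAlg R) (y : Y) :
      f a y = (mk (QuadAlg.wt R 0) a).rTensor (QuadAlg R) (σ y) := rfl
  have h1 (b a : QuadAlg R) (z : Y ⊗[F] QuadAlg R) :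
      (mk (QuadAlg.wt R 0) a).rTensor (QuadAlg R) ((LinearMap.mulRight F b).lTensor Y z) =
      (LinearMap.mulRight F b).lTensor (BalTensor (QuadAlg.wt R 0) Y)
        ((mk (QuadAlg.wt R 0) a).rTensor (QuadAlg R) z) := by
    induction z using TensorProduct.induction_on with
    | zero => simp only [map_zero]
    | add z z' h h' => simp only [map_add, h, h']
    | tmul y c => rfl
  have h2 (a : QuadAlg R) (z : Y ⊗[F] QuadAlg R) :
      ractHom₂ (BalTensor (QuadAlg.wt R 0) Y)
        ((mk (QuadAlg.wt R 0) a).rTensor (QuadAlg R) z) =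
      mk (QuadAlg.wt R 0) a (ractHom₂ Y z) := by
    induction z using TensorProduct.induction_on with
    | zero => simp only [map_zero]
    | add z z' h h' => simp only [map_add, h, h']
    | tmul y c => exact ract_smul_mk _ _ _ _
  refine ⟨liftLinear _ (avg f) (avg_balanced f), ⟨fun b z => ?_, fun z => ?_⟩⟩
  · induction z using BalTensor.induction with
    | zero => simp only [map_zero, smul_zero]
    | add z z' h h' => simp only [map_add, smul_add, h, h']
    | mk a y =>
      rw [ract_smul_mk, liftLinear_mk, liftLinear_mk, avg_apply, avg_apply, map_sum]
      refine Finset.sum_congr rfl fun i _ => ?_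
      rw [ract_lact_comm, hf, hf, hσ.map_ract, h1]
  · induction z using BalTensor.induction with
    | zero => simp only [map_zero]
    | add z z' h h' => simp only [map_add, h, h']
    | mk a y =>
      rw [liftLinear_mk, avg_apply, map_sum]
      simp only [hf, h2, hσ.ractHom₂_apply]
      rw [← avg_apply, avg_mk]

/-- With σ writing y as a sum of terms y' ⊗ b, the averaged map a ⊗ y ↦ Σ (a ⊗ b) ⊗ y' embeds A ⊗_k
Y as a direct summand of the free module on Y over the enveloping algebra. -/
theorem projective {σ : Y →ₗ[F] Y ⊗[F] QuadAlg R} (hσ : IsRightSection σ) :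
    Module.Projective (Env F (QuadAlg R)) (BalTensor (QuadAlg.wt R 0) Y) := by
  let T : QuadAlg R →ₗ[F] Y ⊗[F] QuadAlg R →ₗ[F] Env F (QuadAlg R) ⊗[F] Y :=
    LinearMap.compRight F (TensorProduct.comm F Y (Env F (QuadAlg R))).toLinearMap ∘ₗ
      LinearMap.lTensorHom Y ∘ₗ Env.tmulBil F (QuadAlg R)
  have hT (a : QuadAlg R) (y : Y) (b : QuadAlg R) : T a (y ⊗ₜ[F] b) = Env.tmul F a b ⊗ₜ[F] y := rfl
  let f : QuadAlg R →ₗ[F] Y →ₗ[F] Env F (QuadAlg R) ⊗[F] Y := LinearMap.lcomp F _ σ ∘ₗ T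
  have hf (a : QuadAlg R) (y : Y) : f a y = T a (σ y) := rfl
  have h1 (a b a' : QuadAlg R) (z : Y ⊗[F] QuadAlg R) :
      T (a * a') ((LinearMap.mulRight F b).lTensor Y z) = Env.tmul F a b • T a' z := by
    induction z using TensorProduct.induction_on with
    | zero => simp only [map_zero, smul_zero]
    | add z z' h h' => simp only [map_add, smul_add, h, h']
    | tmul y c =>
      rw [LinearMap.lTensor_tmul, hT, hT, TensorProduct.smul_tmul', smul_eq_mul,
        Env.tmul_mul_tmul, LinearMap.mulRight_apply]
  let s : BalTensor (QuadAlg.wt R 0) Y →ₗ[Env F (QuadAlg R)] Env F (QuadAlg R) ⊗[F] Y :=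
    lift _ (avg f) (avg_balanced f) fun a b a' y => by
      rw [avg_apply, avg_apply, Finset.smul_sum]
      refine Finset.sum_congr rfl fun i _ => ?_
      rw [ract_lact_comm, hf, hf, hσ.map_ract, mul_assoc, h1]
  let t : Env F (QuadAlg R) ⊗[F] Y →ₗ[Env F (QuadAlg R)] BalTensor (QuadAlg.wt R 0) Y :=
    TensorProduct.AlgebraTensorModule.lift
      (LinearMap.toSpanSingleton (Env F (QuadAlg R)) _ (mk (QuadAlg.wt R 0) 1))
  have ht (u : Env F (QuadAlg R)) (y : Y) : t (u ⊗ₜ[F] y) = u • mk (QuadAlg.wt R 0) 1 y := rfl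
  have h2 (a : QuadAlg R) (z : Y ⊗[F] QuadAlg R) :
      t (T a z) = mk (QuadAlg.wt R 0) a (ractHom₂ Y z) := by
    induction z using TensorProduct.induction_on with
    | zero => simp only [map_zero]
    | add z z' h h' => simp only [map_add, h, h']
    | tmul y c => rw [hT, ht, smul_mk, mul_one]; rfl
  refine Module.Projective.of_split s t (hom_ext _ fun a y => ?_)
  rw [LinearMap.comp_apply, LinearMap.id_apply, lift_mk, avg_apply, map_sum]
  simp only [hf, h2, hσ.ractHom₂_apply]
  rw [← avg_apply, avg_mk]

end BalTensor

variable (R)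

theorem exists_barStage_rightSection : ∀ n, ∃ σ : (barStage (QuadAlg.wt R 0) (QuadAlg.wt R) n).Y →ₗ[F]
    (barStage (QuadAlg.wt R 0) (QuadAlg.wt R) n).Y ⊗[F] QuadAlg R, BalTensor.IsRightSection σ
  | 0 => ⟨_, BalTensor.isRightSection_self R⟩
  | n + 1 => (exists_barStage_rightSection n).elim fun _ h => BalTensor.exists_rightSection h

theorem bar_projective (n : ℕ) : Module.Projective (Env F (QuadAlg R)) ((bar R).X n) :=
  (exists_barStage_rightSection R n).elim fun _ h => BalTensor.projective h

theorem bar_isGraded (n : ℕ) : IsGradedBimod (QuadAlg.wt R) ((bar R).gr n) :=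
  barStage_isGraded (QuadAlg.wt R) (QuadAlg.isGradedBimod R) (QuadAlg.one_mem_wt R) (n + 1)

theorem bar_d_mem (n m : ℕ) (z : (bar R).X (n + 1)) (hz : z ∈ (bar R).gr (n + 1) m) :
    (bar R).d n z ∈ (bar R).gr n m :=
  barStage_d_mem (QuadAlg.wt R) (QuadAlg.isGradedBimod R) (QuadAlg.one_mem_wt R) (n + 1) m z hz

theorem bar_aug_mem (m : ℕ) (z : (bar R).X 0) (hz : z ∈ (bar R).gr 0 m) :
    (bar R).aug z ∈ QuadAlg.wt R m :=
  barStage_d_mem (QuadAlg.wt R) (QuadAlg.isGradedBimod R) (QuadAlg.one_mem_wt R) 0 m z hz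

theorem bar_aug_surjective : Function.Surjective (bar R).aug := fun a =>
  ⟨BalTensor.mk (Y := QuadAlg R) (QuadAlg.wt R 0) a 1, by
    refine (BalTensor.act_mk (Y := QuadAlg R) _ a 1).trans ?_
    rw [Env.tmul_smul, mul_one, mul_one]⟩

theorem bar_exact_zero (z : (bar R).X 0) (hz : (bar R).aug z = 0) :
    ∃ y, (bar R).d 0 y = z :=
  ⟨_, BalTensor.barStep_of_eq_zero hz⟩

theorem bar_exact_succ (n : ℕ) (z : (bar R).X (n + 1)) (hz : (bar R).d n z = 0) :
    ∃ y, (bar R).d (n + 1) y = z :=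
  ⟨_, BalTensor.barStep_of_eq_zero hz⟩

end BarProjective

end QuadraticQuiver
end

noncomputable section
namespace QuadraticQuiver

/-! ### Comparison theorem for projective resolutions, in degree 2. -/

section Comparison

variable {F : Type w} {A : Type x} [Field F] [Ring A] [Algebra F A]

namespace BimodComplex

/-- The augmented complex is exact. -/
structure IsResolution (D : BimodComplex F A) : Prop where
  aug_surjective : Function.Surjective D.aug
  exact_zero : ∀ z, D.aug z = 0 → ∃ y, D.d 0 y = z
  exact_succ : ∀ n z, D.d n z = 0 → ∃ y, D.d (n + 1) y = z

variable {C D E : BimodComplex F A}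

/-- The map `d` need not be surjective: it suffices that its range contains that of `g`, which is
what exactness supplies. -/
theorem exists_projective_lift {S : Type*} [Ring S] {N N' N'' : Type*} [AddCommGroup N]
    [Module S N] [AddCommGroup N'] [Module S N'] [AddCommGroup N''] [Module S N'']
    [Module.Projective S N] (g : N →ₗ[S] N'') (d : N' →ₗ[S] N'') (h : ∀ z, ∃ y, d y = g z) :
    ∃ l : N →ₗ[S] N', ∀ z, d (l z) = g z := by
  obtain ⟨l, hl⟩ := Module.projective_lifting_property d.rangeRestrict
    (g.codRestrict (LinearMap.range d) h) d.surjective_rangeRestrict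
  exact ⟨l, fun z => congrArg Subtype.val (LinearMap.congr_fun hl z)⟩

theorem exists_hom (hC : ∀ n, Module.Projective (Env F A) (C.X n)) (hD : D.IsResolution) :
    Nonempty (C.Hom D) := by
  let S (n : ℕ) (f : C.X n →ₗ[Env F A] D.X n) : Prop := ∀ z, ∃ y, D.d n y = f (C.d n z)
  have h0 : ∃ f : C.X 0 →ₗ[Env F A] D.X 0, S 0 f ∧ ∀ z, D.aug (f z) = C.aug z := by
    have := hC 0
    obtain ⟨f, hf⟩ := exists_projective_lift C.aug D.aug fun z => hD.aug_surjective _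
    exact ⟨f, fun z => hD.exact_zero _ (by rw [hf, C.aug_d]), hf⟩
  have h1 (n : ℕ) (f : C.X n →ₗ[Env F A] D.X n) (hf : S n f) :
      ∃ g : C.X (n + 1) →ₗ[Env F A] D.X (n + 1), S (n + 1) g ∧
        ∀ z, D.d n (g z) = f (C.d n z) := by
    have := hC (n + 1)
    obtain ⟨g, hg⟩ := exists_projective_lift (f ∘ₗ C.d n) (D.d n) hf
    refine ⟨g, fun z => hD.exact_succ n _ ?_, hg⟩
    rw [hg, LinearMap.comp_apply, C.d_d, map_zero]
  obtain ⟨f, hf, hfa⟩ := h0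
  choose! g hg hgd using h1
  let s : ∀ n, {f : C.X n →ₗ[Env F A] D.X n // S n f} := fun n =>
    Nat.rec ⟨f, hf⟩ (fun n t => ⟨g n t.1, hg n t.1 t.2⟩) n
  exact ⟨{ f := fun n => (s n).1, comm := fun n z => (hgd n (s n).1 (s n).2 z).symm,
           aug := hfa }⟩

/-- The homotopy is constructed only as far as degree 2 requires. `C` is not assumed exact, so that
`C` may be the Koszul complex. -/
theorem exists_homotopy (hC : ∀ n, Module.Projective (Env F A) (C.X n)) (hD : D.IsResolution)
    (φ ψ : C.Hom D) : ∃ (h₁ : C.X 1 →ₗ[Env F A] D.X 2) (h₂ : C.X 2 →ₗ[Env F A] D.X 3),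
      φ.f 2 = ψ.f 2 + (D.d 2 ∘ₗ h₂ + h₁ ∘ₗ C.d 1) := by
  have p0 := hC 0
  have p1 := hC 1
  have p2 := hC 2
  obtain ⟨h₀, hh₀⟩ := exists_projective_lift (φ.f 0 - ψ.f 0) (D.d 0) fun z =>
    hD.exact_zero _ (by rw [LinearMap.sub_apply, map_sub, φ.aug, ψ.aug, sub_self])
  obtain ⟨h₁, hh₁⟩ := exists_projective_lift (φ.f 1 - ψ.f 1 - h₀ ∘ₗ C.d 0) (D.d 1) fun z =>
    hD.exact_succ 0 _ (by
      rw [LinearMap.sub_apply, LinearMap.sub_apply, map_sub, map_sub, LinearMap.comp_apply, hh₀,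
        ← φ.comm, ← ψ.comm, LinearMap.sub_apply, sub_self])
  obtain ⟨h₂, hh₂⟩ := exists_projective_lift (φ.f 2 - ψ.f 2 - h₁ ∘ₗ C.d 1) (D.d 2) fun z =>
    hD.exact_succ 1 _ (by
      rw [LinearMap.sub_apply, LinearMap.sub_apply, map_sub, map_sub, LinearMap.comp_apply, hh₁,
        ← φ.comm, ← ψ.comm, LinearMap.sub_apply, LinearMap.sub_apply, LinearMap.comp_apply, C.d_d,
        map_zero, sub_zero, sub_self])
  refine ⟨h₁, h₂, LinearMap.ext fun z => ?_⟩
  have h := hh₂ z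
  rw [LinearMap.sub_apply, LinearMap.sub_apply, sub_sub, eq_sub_iff_add_eq] at h
  rw [← h, LinearMap.add_apply, LinearMap.add_apply, LinearMap.comp_apply, LinearMap.comp_apply]
  abel

namespace Hom

/-- The identity morphism. -/
def id (C : BimodComplex F A) : C.Hom C where
  f n := LinearMap.id
  comm n z := rfl
  aug z := rfl

/-- The composition of morphisms. -/
def comp (ψ : D.Hom E) (φ : C.Hom D) : C.Hom E where
  f n := ψ.f n ∘ₗ φ.f n
  comm n z := (congrArg (ψ.f n) (φ.comm n z)).trans (ψ.comm n _)
  aug z := (ψ.aug _).trans (φ.aug z)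

end Hom

end BimodComplex

section

variable (M : Type y) [AddCommGroup M] [Module F M] [Module (Env F A) M]
  [IsScalarTower F (Env F A) M] {N N' : Type x} [AddCommGroup N] [Module F N] [Module (Env F A) N]
  [IsScalarTower F (Env F A) N] [AddCommGroup N'] [Module F N'] [Module (Env F A) N']
  [IsScalarTower F (Env F A) N'] {C D E : BimodComplex F A}

namespace EnvTensor

variable {M} in
theorem induction {P : EnvTensor F A M N → Prop} (z : EnvTensor F A M N) (zero : P 0)
    (add : ∀ z z', P z → P z' → P (z + z')) (tmul : ∀ m n, P (tmul M m n)) : P z := by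
  obtain ⟨z, rfl⟩ := Submodule.mkQ_surjective _ z
  induction z using TensorProduct.induction_on with
  | zero => rw [map_zero]; exact zero
  | add z z' hz hz' => rw [map_add]; exact add _ _ hz hz'
  | tmul m n => exact tmul m n

theorem tmul_add (m : M) (n n' : N) : (tmul M m (n + n') : EnvTensor F A M N) =
    tmul M m n + tmul M m n' := by
  rw [tmul, TensorProduct.tmul_add, map_add]; rfl

theorem map_tmul (f : N →ₗ[Env F A] N') (m : M) (n : N) :
    map M f (tmul M m n) = tmul M m (f n) := rfl

theorem map_add_apply (f g : N →ₗ[Env F A] N') (z : EnvTensor F A M N) :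
    map M (f + g) z = map M f z + map M g z := by
  induction z using EnvTensor.induction with
  | zero => simp only [map_zero, add_zero]
  | add z z' h h' => rw [map_add, map_add, map_add, h, h', add_add_add_comm]
  | tmul m n => rw [map_tmul, map_tmul, map_tmul, LinearMap.add_apply, tmul_add]

theorem map_id_apply (z : EnvTensor F A M N) : map M LinearMap.id z = z := by
  induction z using EnvTensor.induction with
  | zero => rw [map_zero]
  | add z z' h h' => rw [map_add, h, h']
  | tmul m n => rw [map_tmul, LinearMap.id_apply]

theorem map_bijective {f : N →ₗ[Env F A] N'} (hf : Function.Bijective f) :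
    Function.Bijective (map M f) := by
  let e := LinearEquiv.ofBijective f hf
  have h1 : e.symm.toLinearMap ∘ₗ f = LinearMap.id := LinearMap.ext fun z => e.symm_apply_apply z
  have h2 : f ∘ₗ e.symm.toLinearMap = LinearMap.id := LinearMap.ext fun z => e.apply_symm_apply z
  refine Function.bijective_iff_has_inverse.2 ⟨map M e.symm.toLinearMap, fun z => ?_, fun z => ?_⟩
  · rw [map_comp_apply, h1, map_id_apply]
  · rw [map_comp_apply, h2, map_id_apply]

end EnvTensor

theorem homologyClass_surjective (z : Homology M C) : ∃ c, homologyClass M c = z :=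
  Submodule.mkQ_surjective _ z

theorem cohomologyClass_surjective (z : Cohomology M C) : ∃ c, cohomologyClass M c = z :=
  Submodule.mkQ_surjective _ z

theorem homologyClass_eq_iff {z z' : cycles M C} :
    homologyClass M z = homologyClass M z' ↔ (z : EnvTensor F A M (C.X 2)) - z' ∈ boundaries M C :=
  Submodule.Quotient.eq _

theorem homologyClass_eq_zero_iff {z : cycles M C} :
    homologyClass M z = 0 ↔ (z : EnvTensor F A M (C.X 2)) ∈ boundaries M C :=
  Submodule.Quotient.mk_eq_zero _

theorem cohomologyClass_eq_iff {f f' : cocycles M C} : cohomologyClass M f = cohomologyClass M f' ↔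
    (f : C.X 2 →ₗ[Env F A] M) - f' ∈ coboundaries M C :=
  Submodule.Quotient.eq _

theorem cohomologyClass_eq_zero_iff {f : cocycles M C} :
    cohomologyClass M f = 0 ↔ (f : C.X 2 →ₗ[Env F A] M) ∈ coboundaries M C :=
  Submodule.Quotient.mk_eq_zero _

theorem chainMap_mem_cycles (φ : C.Hom D) {z : EnvTensor F A M (C.X 2)} (hz : z ∈ cycles M C) :
    chainMap M φ z ∈ cycles M D := by
  rw [cycles, LinearMap.mem_ker] at hz ⊢
  rw [map_chainMap, hz, map_zero]

theorem cochainMap_mem_cocycles (φ : C.Hom D) {f : D.X 2 →ₗ[Env F A] M} (hf : f ∈ cocycles M D) :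
    cochainMap M φ f ∈ cocycles M C := by
  rw [cocycles, LinearMap.mem_ker] at hf ⊢
  ext z
  exact (congrArg f (φ.comm 2 z)).trans (LinearMap.congr_fun hf (φ.f 3 z))

theorem homologyMap_mk (φ : C.Hom D) (z : cycles M C) : homologyMap M φ (homologyClass M z) =
    homologyClass M ⟨chainMap M φ z, chainMap_mem_cycles M φ z.2⟩ := rfl

theorem cohomologyMap_mk (φ : C.Hom D) (f : cocycles M D) :
    cohomologyMap M φ (cohomologyClass M f) =
      cohomologyClass M ⟨cochainMap M φ f, cochainMap_mem_cocycles M φ f.2⟩ := rfl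

theorem homologyMap_comp (ψ : D.Hom E) (φ : C.Hom D) :
    homologyMap M ψ ∘ₗ homologyMap M φ = homologyMap M (ψ.comp φ) := by
  refine LinearMap.ext fun z => ?_
  obtain ⟨z, rfl⟩ := homologyClass_surjective M z
  rw [LinearMap.comp_apply, homologyMap_mk, homologyMap_mk, homologyMap_mk]
  exact congrArg (homologyClass M) (Subtype.ext (EnvTensor.map_comp_apply M _ _ _))

theorem cohomologyMap_comp (ψ : D.Hom E) (φ : C.Hom D) :
    cohomologyMap M φ ∘ₗ cohomologyMap M ψ = cohomologyMap M (ψ.comp φ) := by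
  refine LinearMap.ext fun z => ?_
  obtain ⟨z, rfl⟩ := cohomologyClass_surjective M z
  rfl

theorem homologyMap_id : homologyMap M (BimodComplex.Hom.id C) = LinearMap.id := by
  refine LinearMap.ext fun z => ?_
  obtain ⟨z, rfl⟩ := homologyClass_surjective M z
  rw [homologyMap_mk]
  exact congrArg (homologyClass M) (Subtype.ext (EnvTensor.map_id_apply M _))

theorem cohomologyMap_id : cohomologyMap M (BimodComplex.Hom.id C) = LinearMap.id := by
  refine LinearMap.ext fun z => ?_
  obtain ⟨z, rfl⟩ := cohomologyClass_surjective M z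
  rfl

theorem homologyMap_congr (hC : ∀ n, Module.Projective (Env F A) (C.X n)) (hD : D.IsResolution)
    (φ ψ : C.Hom D) : homologyMap M φ = homologyMap M ψ := by
  obtain ⟨h₁, h₂, h⟩ := BimodComplex.exists_homotopy hC hD φ ψ
  refine LinearMap.ext fun z => ?_
  obtain ⟨z, rfl⟩ := homologyClass_surjective M z
  rw [homologyMap_mk, homologyMap_mk, homologyClass_eq_iff]
  have hz : EnvTensor.map M (C.d 1) z = 0 := z.2
  refine ⟨EnvTensor.map M h₂ z, ?_⟩
  change EnvTensor.map M (D.d 2) _ = EnvTensor.map M (φ.f 2) z.1 - EnvTensor.map M (ψ.f 2) z.1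
  rw [h, EnvTensor.map_add_apply, EnvTensor.map_add_apply,
    add_sub_cancel_left, ← EnvTensor.map_comp_apply M h₁, hz, map_zero, add_zero,
    EnvTensor.map_comp_apply]

theorem cohomologyMap_congr (hC : ∀ n, Module.Projective (Env F A) (C.X n)) (hD : D.IsResolution)
    (φ ψ : C.Hom D) : cohomologyMap M φ = cohomologyMap M ψ := by
  obtain ⟨h₁, h₂, h⟩ := BimodComplex.exists_homotopy hC hD φ ψ
  refine LinearMap.ext fun f => ?_
  obtain ⟨f, rfl⟩ := cohomologyClass_surjective M f
  rw [cohomologyMap_mk, cohomologyMap_mk, cohomologyClass_eq_iff]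
  refine ⟨f.1 ∘ₗ h₁, LinearMap.ext fun z => ?_⟩
  have hf (z : D.X 3) : f.1 (D.d 2 z) = 0 := LinearMap.congr_fun f.2 z
  change f.1 (h₁ (C.d 1 z)) = f.1 (φ.f 2 z) - f.1 (ψ.f 2 z)
  rw [h, LinearMap.add_apply, LinearMap.add_apply, map_add, map_add, LinearMap.comp_apply, hf,
    zero_add, add_sub_cancel_left, LinearMap.comp_apply]

/-- A lift of the identity in the opposite direction is an inverse, because both composites induce
the same map as the identity morphism. -/
theorem homologyMap_bijective (hC : ∀ n, Module.Projective (Env F A) (C.X n))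
    (hD : ∀ n, Module.Projective (Env F A) (D.X n)) (hC' : C.IsResolution) (hD' : D.IsResolution)
    (φ : C.Hom D) : Function.Bijective (homologyMap M φ) := by
  obtain ⟨ψ⟩ := BimodComplex.exists_hom hD hC'
  refine Function.bijective_iff_has_inverse.2 ⟨homologyMap M ψ, fun z => ?_, fun z => ?_⟩
  · rw [← LinearMap.comp_apply, homologyMap_comp,
      homologyMap_congr M hC hC' _ (BimodComplex.Hom.id C), homologyMap_id, LinearMap.id_apply]
  · rw [← LinearMap.comp_apply, homologyMap_comp,
      homologyMap_congr M hD hD' _ (BimodComplex.Hom.id D), homologyMap_id, LinearMap.id_apply]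

theorem cohomologyMap_bijective (hC : ∀ n, Module.Projective (Env F A) (C.X n))
    (hD : ∀ n, Module.Projective (Env F A) (D.X n)) (hC' : C.IsResolution) (hD' : D.IsResolution)
    (φ : C.Hom D) : Function.Bijective (cohomologyMap M φ) := by
  obtain ⟨ψ⟩ := BimodComplex.exists_hom hD hC'
  refine Function.bijective_iff_has_inverse.2 ⟨cohomologyMap M ψ, fun z => ?_, fun z => ?_⟩
  · rw [← LinearMap.comp_apply, cohomologyMap_comp,
      cohomologyMap_congr M hD hD' _ (BimodComplex.Hom.id D), cohomologyMap_id, LinearMap.id_apply]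
  · rw [← LinearMap.comp_apply, cohomologyMap_comp,
      cohomologyMap_congr M hC hC' _ (BimodComplex.Hom.id C), cohomologyMap_id, LinearMap.id_apply]

end

theorem IsMinimalResolution.isResolution {𝒜 : ℕ → Submodule F A} {P : BimodComplex F A}
    (hP : IsMinimalResolution 𝒜 P) : P.IsResolution where
  aug_surjective := hP.aug_surjective
  exact_zero z hz := (hP.exact_zero z).1 hz
  exact_succ n z hz := (hP.exact_succ n z).1 hz

end Comparison

section

variable {F : Type w} {Q : Type u} [Field F] [Quiver.{v} Q] [Fintype Q]
  [∀ i j : Q, Fintype (i ⟶ j)] (R : QuadraticRelations F Q)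

theorem bar_isResolution : (bar R).IsResolution where
  aug_surjective := bar_aug_surjective R
  exact_zero := bar_exact_zero R
  exact_succ := bar_exact_succ R

theorem koszul_projective (n : ℕ) : Module.Projective (Env F (QuadAlg R)) ((koszulComplex R).X n) :=
  KoszulTerm.projective R n

end

end QuadraticQuiver
end

noncomputable section
namespace QuadraticQuiver

/-! ### Morphisms that are isomorphisms in degrees 1 and 2. -/

section BijectiveComparison

variable {F : Type w} {A : Type x} [Field F] [Ring A] [Algebra F A]
  (M : Type y) [AddCommGroup M] [Module F M] [Module (Env F A) M]
  [IsScalarTower F (Env F A) M] {C D : BimodComplex F A} {φ : C.Hom D}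

/-- An isomorphism in degree 1 detects the vanishing of the boundary of a chain of degree 2. -/
theorem mem_cycles_of_chainMap (h1 : Function.Bijective (φ.f 1)) {z : EnvTensor F A M (C.X 2)}
    (hz : chainMap M φ z ∈ cycles M D) : z ∈ cycles M C := by
  rw [cycles, LinearMap.mem_ker] at hz ⊢
  rw [map_chainMap] at hz
  exact (EnvTensor.map_bijective M h1).1 (hz.trans (map_zero _).symm)

theorem boundaries_le_cycles : boundaries M C ≤ cycles M C := by
  rintro _ ⟨z, rfl⟩
  rw [cycles, LinearMap.mem_ker, EnvTensor.map_comp_apply]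
  have h : C.d 1 ∘ₗ C.d 2 = 0 := LinearMap.ext (C.d_d 1)
  -- Additivity applied to 0 + 0 shows that the zero map induces zero.
  have h2 := EnvTensor.map_add_apply M (0 : C.X 3 →ₗ[Env F A] C.X 1) 0 z
  rw [add_zero, left_eq_add] at h2
  rw [h, h2]

theorem homologyMap_surjective_of_bijective (h1 : Function.Bijective (φ.f 1))
    (h2 : Function.Bijective (φ.f 2)) : Function.Surjective (homologyMap M φ) := by
  intro w
  obtain ⟨⟨w, hw⟩, rfl⟩ := homologyClass_surjective M w
  obtain ⟨z, rfl⟩ := (EnvTensor.map_bijective M h2).2 w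
  exact ⟨homologyClass M ⟨z, mem_cycles_of_chainMap M h1 hw⟩, rfl⟩

theorem cohomologyMap_injective_of_bijective (h1 : Function.Bijective (φ.f 1))
    (h2 : Function.Bijective (φ.f 2)) : Function.Injective (cohomologyMap M φ) := by
  rw [injective_iff_map_eq_zero]
  intro f hf
  obtain ⟨f, rfl⟩ := cohomologyClass_surjective M f
  rw [cohomologyMap_mk, cohomologyClass_eq_zero_iff] at hf
  obtain ⟨g, hg⟩ := hf
  let e := LinearEquiv.ofBijective (φ.f 1) h1
  rw [cohomologyClass_eq_zero_iff]
  refine ⟨g ∘ₗ e.symm.toLinearMap, LinearMap.ext fun z => ?_⟩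
  obtain ⟨z, rfl⟩ := h2.2 z
  refine Eq.trans ?_ (LinearMap.congr_fun hg z)
  change g (e.symm (D.d 1 (φ.f 2 z))) = g (C.d 1 z)
  rw [← φ.comm]
  exact congrArg g (e.symm_apply_apply _)

/-- A class of `C` dies in `D` exactly when the image of a representative is a boundary of `D`. The
preimage of the boundaries is the form in which they are seen in the chains of `C`; it consists of
cycles since `φ.f 1` is bijective. -/
theorem exists_ker_homologyMap_equiv (h1 : Function.Bijective (φ.f 1)) :
    ∃ e : (((boundaries M D).comap (chainMap M φ)) ⧸
        (boundaries M C).submoduleOf ((boundaries M D).comap (chainMap M φ))) ≃ₗ[F]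
        (homologyMap M φ).ker,
      ∀ z : (boundaries M D).comap (chainMap M φ), ∃ hz : z.1 ∈ cycles M C,
        (e (Submodule.Quotient.mk z)).1 = homologyClass M ⟨z.1, hz⟩ := by
  have hc (z : (boundaries M D).comap (chainMap M φ)) : z.1 ∈ cycles M C :=
    mem_cycles_of_chainMap M h1 (boundaries_le_cycles M z.2)
  let l : ((boundaries M D).comap (chainMap M φ)) →ₗ[F] (homologyMap M φ).ker :=
    (homologyClass M ∘ₗ (Submodule.inclusion fun z hz => hc ⟨z, hz⟩)).codRestrict _ fun z => by
      rw [LinearMap.mem_ker]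
      exact (homologyClass_eq_zero_iff M).2 z.2
  have hl : Function.Surjective l := by
    rintro ⟨z, hz⟩
    obtain ⟨z, rfl⟩ := homologyClass_surjective M z
    exact ⟨⟨z.1, (homologyClass_eq_zero_iff M).1 hz⟩, rfl⟩
  have hk : (boundaries M C).submoduleOf ((boundaries M D).comap (chainMap M φ)) =
      LinearMap.ker l := by
    ext z
    rw [LinearMap.mem_ker, ← Subtype.val_inj]
    exact (homologyClass_eq_zero_iff M (z := ⟨z.1, hc z⟩)).symm
  exact ⟨(Submodule.quotEquivOfEq _ _ hk).trans (l.quotKerEquivOfSurjective hl),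
    fun z => ⟨hc z, rfl⟩⟩

/-- The classes in the range are those represented by a cocycle transported from `D`, and two such
classes agree up to coboundaries of `C`. -/
theorem exists_range_cohomologyMap_equiv :
    ∃ e : (((cocycles M D).map (cochainMap M φ)) ⧸
        (coboundaries M C).submoduleOf ((cocycles M D).map (cochainMap M φ))) ≃ₗ[F]
        (cohomologyMap M φ).range,
      ∀ f : (cocycles M D).map (cochainMap M φ), ∃ hf : f.1 ∈ cocycles M C,
        (e (Submodule.Quotient.mk f)).1 = cohomologyClass M ⟨f.1, hf⟩ := by
  have hc (f : (cocycles M D).map (cochainMap M φ)) : f.1 ∈ cocycles M C := by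
    obtain ⟨_, g, hg, rfl⟩ := f
    exact cochainMap_mem_cocycles M φ hg
  let l : ((cocycles M D).map (cochainMap M φ)) →ₗ[F] (cohomologyMap M φ).range :=
    (cohomologyClass M ∘ₗ (Submodule.inclusion fun z hz => hc ⟨z, hz⟩)).codRestrict _ (by
      rintro ⟨_, g, hg, rfl⟩
      exact ⟨cohomologyClass M ⟨g, hg⟩, rfl⟩)
  have hl : Function.Surjective l := by
    rintro ⟨_, g, rfl⟩
    obtain ⟨g, rfl⟩ := cohomologyClass_surjective M g
    exact ⟨⟨_, g.1, g.2, rfl⟩, rfl⟩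
  have hk : (coboundaries M C).submoduleOf ((cocycles M D).map (cochainMap M φ)) =
      LinearMap.ker l := by
    ext f
    rw [LinearMap.mem_ker, ← Subtype.val_inj]
    exact (cohomologyClass_eq_zero_iff M (f := ⟨f.1, hc f⟩)).symm
  exact ⟨(Submodule.quotEquivOfEq _ _ hk).trans (l.quotKerEquivOfSurjective hl),
    fun z => ⟨hc z, rfl⟩⟩

end BijectiveComparison

/-! ### Total weight in homology and cohomology. -/

section Weights

variable {F : Type w} {A : Type x} [Field F] [Ring A] [Algebra F A] {𝒜 : ℕ → Submodule F A}

/-- A complex of graded bimodules, with homogeneous differentials. -/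
structure BimodComplex.IsGraded (𝒜 : ℕ → Submodule F A) (C : BimodComplex F A) : Prop where
  isGradedBimod : ∀ n, IsGradedBimod 𝒜 (C.gr n)
  d_mem : ∀ n m, ∀ z ∈ C.gr (n + 1) m, C.d n z ∈ C.gr n m
  aug_mem : ∀ m, ∀ z ∈ C.gr 0 m, C.aug z ∈ 𝒜 m

theorem IsMinimalResolution.isGraded {P : BimodComplex F A} (hP : IsMinimalResolution 𝒜 P) :
    P.IsGraded 𝒜 :=
  ⟨hP.isGradedBimod, hP.d_mem, hP.aug_mem⟩

variable {C D : BimodComplex F A}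

/-- Because differentials and augmentations are homogeneous, the parts of weight zero of the
components of `φ` again form a lift of the identity. -/
theorem BimodComplex.IsGraded.exists_homogeneous (hA : DirectSum.IsInternal 𝒜)
    (hC : C.IsGraded 𝒜) (hD : D.IsGraded 𝒜) (φ : C.Hom D) : ∃ ψ : C.Hom D, ψ.IsHomogeneous := by
  choose g hg using fun n => exists_weight_zero_part hA (hC.isGradedBimod n) (hD.isGradedBimod n)
    (φ.f n)
  refine ⟨{ f := g, comm := fun n => ?_, aug := ?_ }, fun n m z hz => ?_⟩
  · refine LinearMap.congr_fun (f := g n ∘ₗ C.d n) (g := D.d n ∘ₗ g (n + 1))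
      (envMap_ext_wt (hC.isGradedBimod (n + 1)).isInternal fun m z hz => ?_)
    rw [LinearMap.comp_apply, LinearMap.comp_apply, hg n m _ (hC.d_mem n m z hz),
      hg (n + 1) m z hz, φ.comm]
    exact (map_wtProj (hD.isGradedBimod (n + 1)).isInternal (hD.isGradedBimod n).isInternal
      ((D.d n).restrictScalars F) (hD.d_mem n) m _).symm
  · refine LinearMap.congr_fun (f := D.aug ∘ₗ g 0) (g := C.aug)
      (envMap_ext_wt (hC.isGradedBimod 0).isInternal fun m z hz => ?_)
    rw [LinearMap.comp_apply, hg 0 m z hz]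
    refine (map_wtProj (hD.isGradedBimod 0).isInternal hA
      (D.aug.restrictScalars F) hD.aug_mem m _).trans ?_
    rw [LinearMap.restrictScalars_apply, φ.aug, wtProj_of_mem _ (hC.aug_mem m z hz)]
  · rw [hg n m z hz]
    exact wtProj_mem _ _ _

section EnvTensorGrading

variable {N N' : Type x} [AddCommGroup N] [Module F N] [Module (Env F A) N]
  [IsScalarTower F (Env F A) N] [AddCommGroup N'] [Module F N'] [Module (Env F A) N']
  [IsScalarTower F (Env F A) N'] {gr : ℕ → Submodule F N} {gr' : ℕ → Submodule F N'}

namespace EnvTensor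

variable (𝒜 gr) in
/-- The component of total weight `t` of `A ⊗_{Aᵉ} N`. -/
def wt (t : ℕ) : Submodule F (EnvTensor F A A N) :=
  Submodule.span F {z | ∃ (i j : ℕ) (a : A) (y : N), i + j = t ∧ a ∈ 𝒜 i ∧
    y ∈ gr j ∧ z = EnvTensor.tmul A a y}

theorem tmul_mem_wt {i j t : ℕ} (h : i + j = t) {a : A} (ha : a ∈ 𝒜 i) {y : N} (hy : y ∈ gr j) :
    tmul A a y ∈ wt 𝒜 gr t :=
  Submodule.subset_span ⟨i, j, a, y, h, ha, hy, rfl⟩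

theorem wt_induction {t : ℕ} {P : EnvTensor F A A N → Prop} {z : EnvTensor F A A N}
    (hz : z ∈ wt 𝒜 gr t) (zero : P 0) (add : ∀ z z', P z → P z' → P (z + z'))
    (smul : ∀ (c : F) z, P z → P (c • z))
    (tmul : ∀ i j, i + j = t → ∀ a ∈ 𝒜 i, ∀ y ∈ gr j, P (tmul A a y)) : P z := by
  refine Submodule.span_induction (p := fun z _ => P z) ?_ zero (fun x y _ _ => add x y)
    (fun c x _ => smul c x) hz
  rintro _ ⟨i, j, a, y, h, ha, hy, rfl⟩
  exact tmul i j h a ha y hy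

theorem smul_tmul (a b m : A) (n : N) : (tmul A (Env.tmul F b a • m) n : EnvTensor F A A N) =
    tmul A m (Env.tmul F a b • n) :=
  (Submodule.Quotient.eq (envRel F A A N)).2 (Submodule.subset_span ⟨a, b, m, n, rfl⟩)

/-- The projection to the component of total weight `t`, before passing to the quotient. -/
def preProj (hA : IsGradedBimod 𝒜 𝒜) (h : IsGradedBimod 𝒜 gr) (t : ℕ) :
    A ⊗[F] N →ₗ[F] EnvTensor F A A N :=
  (envRel F A A N).mkQ ∘ₗ ∑ ij ∈ Finset.HasAntidiagonal.antidiagonal t,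
    TensorProduct.map (wtProj hA.isInternal ij.1) (wtProj h.isInternal ij.2)

theorem preProj_tmul (hA : IsGradedBimod 𝒜 𝒜) (h : IsGradedBimod 𝒜 gr) (t : ℕ) {i j : ℕ} {a : A}
    (ha : a ∈ 𝒜 i) {y : N} (hy : y ∈ gr j) :
    preProj hA h t (a ⊗ₜ[F] y) = if i + j = t then tmul A a y else 0 := by
  rw [preProj, LinearMap.comp_apply, LinearMap.sum_apply, map_sum]
  simp only [TensorProduct.map_tmul]
  have hne (kl : ℕ × ℕ) (hkl : kl ≠ (i, j)) : (envRel F A A N).mkQ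
      (wtProj hA.isInternal kl.1 a ⊗ₜ[F] wtProj h.isInternal kl.2 y) = 0 := by
    by_cases hk : i = kl.1
    · rw [wtProj_of_ne h.isInternal (fun h' => hkl (by rw [hk, h'])) hy, TensorProduct.tmul_zero,
        map_zero]
    · rw [wtProj_of_ne hA.isInternal hk ha, TensorProduct.zero_tmul, map_zero]
  split
  · next ht =>
    rw [Finset.sum_eq_single (i, j), wtProj_of_mem _ ha, wtProj_of_mem _ hy]
    · rfl
    · exact fun kl _ => hne kl
    · exact fun h' => absurd (Finset.HasAntidiagonal.mem_antidiagonal.2 ht) h'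
  · next ht =>
    refine Finset.sum_eq_zero fun kl hkl => hne kl fun h' => ht ?_
    rw [h'] at hkl
    exact Finset.HasAntidiagonal.mem_antidiagonal.1 hkl

/-- On homogeneous factors the two sides of a defining relation of the tensor product have the same
total weight, so the projection passes to the quotient. -/
theorem preProj_smul_tmul (hA : IsGradedBimod 𝒜 𝒜) (h : IsGradedBimod 𝒜 gr) (t : ℕ) (a b m : A)
    (n : N) : preProj hA h t ((Env.tmul F b a • m) ⊗ₜ[F] n) =
      preProj hA h t (m ⊗ₜ[F] (Env.tmul F a b • n)) := by
  induction a using wt_hom_induction hA.isInternal with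
  | zero => simp only [Env.tmul_zero_left, Env.tmul_zero_right, zero_smul,
      TensorProduct.zero_tmul, TensorProduct.tmul_zero]
  | add a a' ha ha' => simp only [Env.tmul_add_left, Env.tmul_add_right, add_smul,
      TensorProduct.add_tmul, TensorProduct.tmul_add, map_add, ha, ha']
  | mem i a ha =>
  induction b using wt_hom_induction hA.isInternal with
  | zero => simp only [Env.tmul_zero_left, Env.tmul_zero_right, zero_smul,
      TensorProduct.zero_tmul, TensorProduct.tmul_zero]
  | add b b' hb hb' => simp only [Env.tmul_add_left, Env.tmul_add_right, add_smul,
      TensorProduct.add_tmul, TensorProduct.tmul_add, map_add, hb, hb']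
  | mem j b hb =>
  induction m using wt_hom_induction hA.isInternal with
  | zero => simp only [smul_zero, TensorProduct.zero_tmul]
  | add m m' hm hm' => simp only [smul_add, TensorProduct.add_tmul, map_add, hm, hm']
  | mem k m hm =>
  induction n using wt_hom_induction h.isInternal with
  | zero => simp only [smul_zero, TensorProduct.tmul_zero]
  | add n n' hn hn' => simp only [smul_add, TensorProduct.tmul_add, map_add, hn, hn']
  | mem l n hn =>
  rw [preProj_tmul hA h t (hA.smul_mem j i k b hb a ha m hm) hn,
    preProj_tmul hA h t hm (h.smul_mem i j l a ha b hb n hn), smul_tmul,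
    show j + k + i + l = k + (i + l + j) by omega]

/-- The projection to the component of total weight `t` of `A ⊗_{Aᵉ} N`. -/
def proj (hA : IsGradedBimod 𝒜 𝒜) (h : IsGradedBimod 𝒜 gr) (t : ℕ) :
    EnvTensor F A A N →ₗ[F] EnvTensor F A A N :=
  (envRel F A A N).liftQ (preProj hA h t) (by
    refine Submodule.span_le.2 ?_
    rintro _ ⟨a, b, m, n, rfl⟩
    rw [SetLike.mem_coe, LinearMap.mem_ker, map_sub, preProj_smul_tmul, sub_self])

theorem proj_tmul (hA : IsGradedBimod 𝒜 𝒜) (h : IsGradedBimod 𝒜 gr) (t : ℕ) {i j : ℕ} {a : A}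
    (ha : a ∈ 𝒜 i) {y : N} (hy : y ∈ gr j) :
    proj hA h t (tmul A a y) = if i + j = t then tmul A a y else 0 :=
  preProj_tmul hA h t ha hy

theorem tmul_zero (m : A) : (tmul A m (0 : N) : EnvTensor F A A N) = 0 := by
  rw [tmul, TensorProduct.tmul_zero, map_zero]

theorem zero_tmul (n : N) : (tmul A (0 : A) n : EnvTensor F A A N) = 0 := by
  rw [tmul, TensorProduct.zero_tmul, map_zero]

theorem add_tmul (m m' : A) (n : N) : (tmul A (m + m') n : EnvTensor F A A N) =
    tmul A m n + tmul A m' n := by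
  rw [tmul, TensorProduct.add_tmul, map_add]; rfl

theorem hom_induction (hA : IsGradedBimod 𝒜 𝒜) (h : IsGradedBimod 𝒜 gr)
    {P : EnvTensor F A A N → Prop} (z : EnvTensor F A A N) (zero : P 0)
    (add : ∀ z z', P z → P z' → P (z + z'))
    (mem : ∀ i j, ∀ a ∈ 𝒜 i, ∀ y ∈ gr j, P (tmul A a y)) : P z := by
  induction z using EnvTensor.induction with
  | zero => exact zero
  | add z z' h h' => exact add z z' h h'
  | tmul m n =>
    induction m using wt_hom_induction hA.isInternal with
    | zero => rw [zero_tmul]; exact zero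
    | add m m' hm hm' => rw [add_tmul]; exact add _ _ hm hm'
    | mem i m hm =>
    induction n using wt_hom_induction h.isInternal with
    | zero => rw [tmul_zero]; exact zero
    | add n n' hn hn' => rw [tmul_add]; exact add _ _ hn hn'
    | mem j n hn => exact mem i j m hm n hn

theorem proj_mem (hA : IsGradedBimod 𝒜 𝒜) (h : IsGradedBimod 𝒜 gr) (t : ℕ)
    (z : EnvTensor F A A N) : proj hA h t z ∈ wt 𝒜 gr t := by
  refine hom_induction hA h (P := fun z => proj hA h t z ∈ wt 𝒜 gr t) z
    (by rw [map_zero]; exact zero_mem _)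
    (fun z z' hz hz' => by rw [map_add]; exact add_mem hz hz') fun i j a ha y hy => ?_
  rw [proj_tmul hA h t ha hy]
  split
  · next ht => exact tmul_mem_wt ht ha hy
  · exact zero_mem _

theorem proj_of_mem (hA : IsGradedBimod 𝒜 𝒜) (h : IsGradedBimod 𝒜 gr) {t : ℕ}
    {z : EnvTensor F A A N} (hz : z ∈ wt 𝒜 gr t) : proj hA h t z = z := by
  refine wt_induction (P := fun z => proj hA h t z = z) hz (map_zero _)
    (fun z z' h h' => by rw [map_add, h, h']) (fun c z h => by rw [map_smul, h])
    fun i j ht a ha y hy => ?_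
  rw [proj_tmul hA h t ha hy, if_pos ht]

theorem map_proj (hA : IsGradedBimod 𝒜 𝒜) (h : IsGradedBimod 𝒜 gr) (h' : IsGradedBimod 𝒜 gr')
    (f : N →ₗ[Env F A] N') (hf : ∀ m, ∀ z ∈ gr m, f z ∈ gr' m) (t : ℕ) (z : EnvTensor F A A N) :
    map A f (proj hA h t z) = proj hA h' t (map A f z) := by
  refine hom_induction hA h (P := fun z => map A f (proj hA h t z) = proj hA h' t (map A f z)) z
    (by simp only [map_zero])
    (fun z z' hz hz' => by simp only [map_add, hz, hz']) fun i j a ha y hy => ?_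
  rw [proj_tmul hA h t ha hy, map_tmul, proj_tmul hA h' t ha (hf j y hy)]
  split
  · rfl
  · rw [map_zero]

theorem map_mem_wt (f : N →ₗ[Env F A] N') (hf : ∀ m, ∀ z ∈ gr m, f z ∈ gr' m) {t : ℕ}
    {z : EnvTensor F A A N} (hz : z ∈ wt 𝒜 gr t) : map A f z ∈ wt 𝒜 gr' t := by
  refine wt_induction (P := fun z => map A f z ∈ wt 𝒜 gr' t) hz
    (by rw [map_zero]; exact zero_mem _)
    (fun z z' h h' => by rw [map_add]; exact add_mem h h')
    (fun c z h => by rw [map_smul]; exact Submodule.smul_mem _ c h) fun i j ht a ha y hy => ?_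
  exact tmul_mem_wt ht ha (hf j y hy)

end EnvTensor

end EnvTensorGrading

theorem mem_homologyWt {t : ℕ} {z : Homology A C} : z ∈ homologyWt 𝒜 C t ↔
    ∃ c : cycles A C, c.1 ∈ EnvTensor.wt 𝒜 (C.gr 2) t ∧ homologyClass A c = z := Iff.rfl

theorem mem_cohomologyWt {t : ℤ} {z : Cohomology A C} : z ∈ cohomologyWt 𝒜 C t ↔
    ∃ c : cocycles A C, c.1 ∈ cochainWt 𝒜 C t ∧ cohomologyClass A c = z := Iff.rfl

theorem BimodComplex.Hom.IsHomogeneous.homologyMap_mem {φ : C.Hom D} (hφ : φ.IsHomogeneous) {t : ℕ}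
    {z : Homology A C} (hz : z ∈ homologyWt 𝒜 C t) : homologyMap A φ z ∈ homologyWt 𝒜 D t := by
  obtain ⟨c, hc, rfl⟩ := mem_homologyWt.1 hz
  exact mem_homologyWt.2 ⟨⟨chainMap A φ c, chainMap_mem_cycles A φ c.2⟩,
    EnvTensor.map_mem_wt _ (hφ 2) hc, rfl⟩

theorem BimodComplex.Hom.IsHomogeneous.cohomologyMap_mem {φ : C.Hom D} (hφ : φ.IsHomogeneous)
    {t : ℤ} {z : Cohomology A D} (hz : z ∈ cohomologyWt 𝒜 D t) :
    cohomologyMap A φ z ∈ cohomologyWt 𝒜 C t := by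
  obtain ⟨c, hc, rfl⟩ := mem_cohomologyWt.1 hz
  exact mem_cohomologyWt.2 ⟨⟨cochainMap A φ c, cochainMap_mem_cocycles A φ c.2⟩,
    fun n z hz => hc n _ (hφ 2 n z hz), rfl⟩

/-- The morphism `φ` is not assumed homogeneous, but in homology it may be replaced by its part of
weight zero, and the same holds for a lift in the opposite direction. Both therefore preserve the
total weight. -/
theorem homologyMap_bijOn
    (hA : DirectSum.IsInternal 𝒜)
    (hC : ∀ n, Module.Projective (Env F A) (C.X n)) (hD : ∀ n, Module.Projective (Env F A) (D.X n))
    (hC' : C.IsResolution) (hD' : D.IsResolution) (hCg : C.IsGraded 𝒜) (hDg : D.IsGraded 𝒜)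
    (φ : C.Hom D) (t : ℕ) :
    Set.BijOn (homologyMap A φ) (homologyWt 𝒜 C t) (homologyWt 𝒜 D t) := by
  obtain ⟨ψ, hψ⟩ := hCg.exists_homogeneous hA hDg φ
  obtain ⟨κ⟩ := BimodComplex.exists_hom hD hC'
  obtain ⟨κ, hκ⟩ := hDg.exists_homogeneous hA hCg κ
  refine ⟨fun z hz => ?_, (homologyMap_bijective A hC hD hC' hD' φ).1.injOn, fun z hz => ?_⟩
  · rw [homologyMap_congr A hC hD' φ ψ]
    exact hψ.homologyMap_mem hz
  · refine ⟨homologyMap A κ z, hκ.homologyMap_mem hz, ?_⟩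
    rw [← LinearMap.comp_apply, homologyMap_comp,
      homologyMap_congr A hD hD' _ (BimodComplex.Hom.id D), homologyMap_id, LinearMap.id_apply]

theorem cohomologyMap_bijOn
    (hA : DirectSum.IsInternal 𝒜)
    (hC : ∀ n, Module.Projective (Env F A) (C.X n)) (hD : ∀ n, Module.Projective (Env F A) (D.X n))
    (hC' : C.IsResolution) (hD' : D.IsResolution) (hCg : C.IsGraded 𝒜) (hDg : D.IsGraded 𝒜)
    (φ : C.Hom D) (t : ℤ) :
    Set.BijOn (cohomologyMap A φ) (cohomologyWt 𝒜 D t) (cohomologyWt 𝒜 C t) := by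
  obtain ⟨ψ, hψ⟩ := hCg.exists_homogeneous hA hDg φ
  obtain ⟨κ⟩ := BimodComplex.exists_hom hD hC'
  obtain ⟨κ, hκ⟩ := hDg.exists_homogeneous hA hCg κ
  refine ⟨fun z hz => ?_, (cohomologyMap_bijective A hC hD hC' hD' φ).1.injOn, fun z hz => ?_⟩
  · rw [cohomologyMap_congr A hC hD' φ ψ]
    exact hψ.cohomologyMap_mem hz
  · refine ⟨cohomologyMap A κ z, hκ.cohomologyMap_mem hz, ?_⟩
    rw [← LinearMap.comp_apply, cohomologyMap_comp,
      cohomologyMap_congr A hC hC' _ (BimodComplex.Hom.id C), cohomologyMap_id, LinearMap.id_apply]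

end Weights

end QuadraticQuiver
end

noncomputable section
namespace QuadraticQuiver
open PathAlg QuadAlg

/-! ### Weights of A indexed by the integers. -/

section IntWeights

variable {F : Type w} {A : Type x} [Field F] [Ring A] [Algebra F A] {𝒜 : ℕ → Submodule F A}

theorem mem_intWt_natCast {m : ℕ} {a : A} : a ∈ intWt 𝒜 m ↔ a ∈ 𝒜 m := by
  rw [intWt, if_pos (Int.natCast_nonneg m), Int.toNat_natCast]

theorem smul_mem_intWt (hA : IsGradedBimod 𝒜 𝒜) {i j : ℕ} {m n : ℤ} (h : i + m + j = n) {a b c : A}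
    (ha : a ∈ 𝒜 i) (hb : b ∈ 𝒜 j) (hc : c ∈ intWt 𝒜 m) : Env.tmul F a b • c ∈ intWt 𝒜 n := by
  subst h
  by_cases hm : 0 ≤ m
  · lift m to ℕ using hm
    rw [mem_intWt_natCast] at hc
    exact_mod_cast (mem_intWt_natCast (m := i + m + j)).2 (hA.smul_mem i j m a ha b hb c hc)
  · rw [intWt, if_neg hm, Submodule.mem_bot] at hc
    rw [hc, smul_zero]
    exact zero_mem _

theorem eq_zero_of_mem_intWt {N : ℕ} (hN : IsGreatest {m : ℕ | 𝒜 m ≠ ⊥} N) {m : ℤ} (hm : N < m)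
    {a : A} (ha : a ∈ intWt 𝒜 m) : a = 0 := by
  lift m to ℕ using by omega
  rw [mem_intWt_natCast] at ha
  by_contra h
  have h2 : m ≤ N := hN.2 fun hbot => h ((Submodule.mem_bot F).1 (hbot ▸ ha))
  omega

end IntWeights

/-! ### Coefficient weight, total weight and the bijections for M = A. -/

section KoszulWeights

variable {F : Type w} {Q : Type u} [Field F] [Quiver.{v} Q] [Fintype Q]
  [∀ i j : Q, Fintype (i ⟶ j)] {R : QuadraticRelations F Q}

namespace KoszulTerm

variable (R) in
/-- The Koszul chains of degree 2 and coefficient weight `r`. -/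
def chainWt (r : ℕ) : Submodule F (EnvTensor F (QuadAlg R) (QuadAlg R) (KoszulTerm R 2)) :=
  Submodule.span F {z | ∃ (a : QuadAlg R) (x : W R 2), a ∈ QuadAlg.wt R r ∧
    z = EnvTensor.tmul (QuadAlg R) a (gen R 2 x)}

/-- Over the enveloping algebra the outer factors of an element of A ⊗ W_2 ⊗ A can be absorbed in
the coefficient. As `W R 2` has weight 2, total weight `r + 2` becomes coefficient weight `r`. -/
theorem tmul_mem_chainWt {i j r : ℕ} (h : i + j = r + 2) {a : QuadAlg R} (ha : a ∈ QuadAlg.wt R i)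
    {y : KoszulTerm R 2} (hy : y ∈ gr R 2 j) : EnvTensor.tmul (QuadAlg R) a y ∈ chainWt R r := by
  refine gr_induction (P := fun y => EnvTensor.tmul (QuadAlg R) a y ∈ chainWt R r) hy ?_ ?_ ?_ ?_
  · rw [EnvTensor.tmul_zero]; exact zero_mem _
  · intro z z' hz hz'
    rw [EnvTensor.tmul_add]; exact add_mem hz hz'
  · intro c z hz
    rw [EnvTensor.tmul, TensorProduct.tmul_smul, map_smul]
    exact Submodule.smul_mem _ c hz
  · intro k l hkl b hb b' hb' x
    rw [← EnvTensor.smul_tmul]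
    refine Submodule.subset_span ⟨_, x, ?_, rfl⟩
    have h2 := (QuadAlg.isGradedBimod R).smul_mem l k i b' hb' b hb a ha
    rwa [show l + i + k = r by omega] at h2

theorem chainWt_le (r : ℕ) : chainWt R r ≤ EnvTensor.wt (QuadAlg.wt R) (gr R 2) (r + 2) := by
  refine Submodule.span_le.2 ?_
  rintro _ ⟨a, x, ha, rfl⟩
  exact EnvTensor.tmul_mem_wt rfl ha (gen_mem x)

theorem le_chainWt (r : ℕ) : EnvTensor.wt (QuadAlg.wt R) (gr R 2) (r + 2) ≤ chainWt R r := by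
  refine Submodule.span_le.2 ?_
  rintro _ ⟨i, j, a, y, h, ha, hy, rfl⟩
  exact tmul_mem_chainWt h ha hy

end KoszulTerm

theorem koszulHomologyWt_eq (r : ℕ) :
    koszulHomologyWt R r = homologyWt (QuadAlg.wt R) (koszulComplex R) (r + 2) := by
  have h := le_antisymm (KoszulTerm.chainWt_le (R := R) r) (KoszulTerm.le_chainWt r)
  exact congrArg (fun S : Submodule F (EnvTensor F (QuadAlg R) (QuadAlg R)
    ((koszulComplex R).X 2)) => (S.submoduleOf (cycles (QuadAlg R) (koszulComplex R))).map
      (homologyClass (QuadAlg R))) h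

namespace IsMinimalResolution

open KoszulTerm

variable {P : BimodComplex F (QuadAlg R)} {ι : (koszulComplex R).Hom P}

/-- The elements of the degree 3 term of `A ⊗_{Aᵉ} P` of weight at most 3 come from the Koszul
complex. -/
theorem exists_map_three (hP : IsMinimalResolution (QuadAlg.wt R) P) (hι : ι.IsHomogeneous)
    {t : ℕ} (ht : t ≤ 3) {z : EnvTensor F (QuadAlg R) (QuadAlg R) (P.X 3)}
    (hz : z ∈ EnvTensor.wt (QuadAlg.wt R) (P.gr 3) t) :
    ∃ w, EnvTensor.map (QuadAlg R) (ι.f 3) w = z := by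
  refine EnvTensor.wt_induction
    (P := fun z => ∃ w, EnvTensor.map (QuadAlg R) (ι.f 3) w = z) hz ⟨0, map_zero _⟩ ?_ ?_ ?_
  · rintro _ _ ⟨w, rfl⟩ ⟨w', rfl⟩
    exact ⟨w + w', map_add _ _ _⟩
  · rintro c _ ⟨w, rfl⟩
    exact ⟨c • w, map_smul _ _ _⟩
  · intro i j hij a ha y hy
    -- Since P_3 vanishes in weights below 3 and the total weight is at most 3, only weight 3
    -- contributes.
    by_cases hj : j = 3
    · subst hj
      obtain ⟨x, rfl⟩ := hP.exists_gen_three hι hy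
      exact ⟨EnvTensor.tmul (QuadAlg R) a (gen R 3 x), rfl⟩
    · rw [hP.eq_zero_of_lt (QuadAlg.one_mem_wt R) 3 j (by omega) y hy, EnvTensor.tmul_zero]
      exact ⟨0, map_zero _⟩

/-- Surjectivity comes from the isomorphism in degree 2 and holds in every weight. The bound on `r`
serves injectivity: boundaries of P of total weight at most 3 are Koszul boundaries. -/
theorem bijOn_koszulHomologyWt (hP : IsMinimalResolution (QuadAlg.wt R) P) (hι : ι.IsHomogeneous)
    {r : ℕ} (hr : r ≤ 1) : Set.BijOn (homologyMap (QuadAlg R) ι) (koszulHomologyWt R r)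
      (homologyWt (QuadAlg.wt R) P (r + 2)) := by
  have hA := QuadAlg.isGradedBimod R
  have h2 := EnvTensor.map_bijective (QuadAlg R) (hP.bijective_two hι)
  rw [koszulHomologyWt_eq]
  refine ⟨fun z hz => hι.homologyMap_mem hz, ?_, ?_⟩
  · intro z hz z' hz' h
    obtain ⟨c, hc, hcz⟩ := mem_homologyWt.1 (sub_mem hz hz')
    refine sub_eq_zero.1 (hcz.symm.trans ?_)
    have h3 : homologyMap (QuadAlg R) ι (homologyClass (QuadAlg R) c) = 0 := by
      rw [hcz, map_sub, h, sub_self]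
    rw [homologyMap_mk, homologyClass_eq_zero_iff] at h3
    obtain ⟨w, hw⟩ := h3
    -- The bounding chain is replaced by its component of weight `r + 2`, which has the same
    -- boundary because that boundary is homogeneous.
    have h4 : EnvTensor.map (QuadAlg R) (P.d 2)
        (EnvTensor.proj hA (hP.isGradedBimod 3) (r + 2) w) = chainMap (QuadAlg R) ι c := by
      rw [EnvTensor.map_proj hA (hP.isGradedBimod 3) (hP.isGradedBimod 2) (P.d 2) (hP.d_mem 2), hw]
      exact EnvTensor.proj_of_mem hA (hP.isGradedBimod 2) (EnvTensor.map_mem_wt _ (hι 2) hc)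
    obtain ⟨u, hu⟩ := hP.exists_map_three hι (by omega)
      (EnvTensor.proj_mem hA (hP.isGradedBimod 3) (r + 2) w)
    rw [homologyClass_eq_zero_iff]
    refine ⟨u, h2.1 ?_⟩
    rw [← hu] at h4
    exact (chainMap_map (QuadAlg R) ι u).trans h4
  · intro z hz
    obtain ⟨⟨c, hc⟩, hcw, rfl⟩ := mem_homologyWt.1 hz
    obtain ⟨u, rfl⟩ := h2.2 c
    refine ⟨homologyClass (QuadAlg R)
      ⟨u, mem_cycles_of_chainMap (QuadAlg R) (hP.bijective_one hι) hc⟩, ?_, rfl⟩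
    refine mem_homologyWt.2 ⟨_, ?_, rfl⟩
    have h3 := EnvTensor.map_proj hA (KoszulTerm.isGradedBimod R 2) (hP.isGradedBimod 2)
      (koszulMap ι 2) (koszulMap_mem hι 2) (r + 2) u
    rw [EnvTensor.proj_of_mem hA (hP.isGradedBimod 2) hcw] at h3
    have h4 := EnvTensor.proj_mem hA (KoszulTerm.isGradedBimod R 2) (r + 2) u
    rw [h2.1 h3] at h4
    exact h4

/-- Injectivity holds for every `r`. The bound `N - 1 ≤ r` guarantees that a homogeneous Koszul
cocycle remains a cocycle on P, which is surjectivity. Integer weights are needed, as `r = -1`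
occurs when `N = 0`. -/
theorem bijOn_koszulCohomologyWt (hP : IsMinimalResolution (QuadAlg.wt R) P)
    (hι : ι.IsHomogeneous) {N : ℕ} (hN : IsGreatest {m : ℕ | QuadAlg.wt R m ≠ ⊥} N) {r : ℤ}
    (hr : N - 1 ≤ r) : Set.BijOn (cohomologyMap (QuadAlg R) ι)
      (cohomologyWt (QuadAlg.wt R) P (r - 2)) (koszulCohomologyWt R r) := by
  have hA := QuadAlg.isGradedBimod R
  have h2 := hP.bijective_two hι
  refine ⟨?_, (cohomologyMap_injective_of_bijective (QuadAlg R) (hP.bijective_one hι) h2).injOn, ?_⟩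
  · intro z hz
    obtain ⟨c, hc, rfl⟩ := mem_cohomologyWt.1 hz
    refine ⟨⟨cochainMap (QuadAlg R) ι c, cochainMap_mem_cocycles _ ι c.2⟩, fun x => ?_, rfl⟩
    have h := hc 2 _ (koszulMap_mem hι 2 2 _ (gen_mem x))
    rwa [show ((2 : ℕ) : ℤ) + (r - 2) = r by push_cast; ring] at h
  · rintro _ ⟨⟨g, hgc⟩, hg, rfl⟩
    let e := LinearEquiv.ofBijective (koszulMap ι 2) h2
    let f : P.X 2 →ₗ[Env F (QuadAlg R)] QuadAlg R := g ∘ₗ e.symm.toLinearMap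
    have hfg (y : KoszulTerm R 2) : f (koszulMap ι 2 y) = g y := congrArg g (e.symm_apply_apply y)
    have hgen (x : W R 2) : g (gen R 2 x) ∈ intWt (QuadAlg.wt R) r := hg x
    -- The generators of K_2 have weight 2 and are sent to weight `r`, so the cochain raises weights
    -- by `r - 2`.
    have hfw : f ∈ cochainWt (QuadAlg.wt R) P (r - 2) := by
      intro n z hz
      obtain ⟨y, hy, rfl⟩ := hP.exists_mem_of_mem hι le_rfl hz
      rw [hfg]
      refine gr_induction (P := fun y => g y ∈ intWt (QuadAlg.wt R) (n + (r - 2))) hy ?_ ?_ ?_ ?_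
      · exact (map_zero g).symm ▸ zero_mem _
      · intro z z' hz hz'
        exact (map_add g z z').symm ▸ add_mem hz hz'
      · intro c z hz
        exact ((g.restrictScalars F).map_smul c z).symm ▸ Submodule.smul_mem _ c hz
      · intro i j hij a ha b hb x
        refine (map_smul g _ _).symm ▸ smul_mem_intWt hA ?_ ha hb (hgen x)
        omega
    have hfc : f ∈ cocycles (QuadAlg R) P := by
      refine envMap_ext_wt (hP.isInternal 3) fun m z hz => ?_
      change f (P.d 2 z) = 0
      rcases lt_trichotomy m 3 with hm | hm | hm
      · rw [hP.eq_zero_of_lt (QuadAlg.one_mem_wt R) 3 m hm z hz, map_zero, map_zero]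
      · subst hm
        obtain ⟨x, rfl⟩ := hP.exists_gen_three hι hz
        rw [← koszulMap_d, hfg]
        exact LinearMap.congr_fun hgc (gen R 3 x)
      -- For `m ≥ 4` the value has weight `m + r - 2 ≥ r + 2 ≥ N + 1`, where A vanishes.
      · refine eq_zero_of_mem_intWt hN ?_ (hfw m _ (hP.d_mem 2 m z hz))
        omega
    refine ⟨cohomologyClass (QuadAlg R) ⟨f, hfc⟩, mem_cohomologyWt.2 ⟨_, hfw, rfl⟩, ?_⟩
    exact cohomologyMap_class (QuadAlg R) ι ⟨f, hfc⟩ ⟨g, hgc⟩ (LinearMap.ext hfg)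

end IsMinimalResolution

variable (R) in
theorem bar_isGradedComplex : (bar R).IsGraded (QuadAlg.wt R) :=
  ⟨bar_isGraded R, bar_d_mem R, bar_aug_mem R⟩

/-- Both morphisms lift the identity of A, from a complex with projective terms to an exact one, so
they are homotopic. -/
theorem homologyMap_comp_eq_chi (M : Type y) [AddCommGroup M] [Module F M]
    [Module (Env F (QuadAlg R)) M] [IsScalarTower F (Env F (QuadAlg R)) M]
    {P : BimodComplex F (QuadAlg R)} (φ : P.Hom (bar R)) (ι : (koszulComplex R).Hom P) :
    homologyMap M φ ∘ₗ homologyMap M ι = homologyMap M (chi R) :=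
  (homologyMap_comp M φ ι).trans
    (homologyMap_congr M (koszul_projective R) (bar_isResolution R) _ _)

theorem cohomologyMap_comp_eq_chi (M : Type y) [AddCommGroup M] [Module F M]
    [Module (Env F (QuadAlg R)) M] [IsScalarTower F (Env F (QuadAlg R)) M]
    {P : BimodComplex F (QuadAlg R)} (φ : P.Hom (bar R)) (ι : (koszulComplex R).Hom P) :
    cohomologyMap M ι ∘ₗ cohomologyMap M φ = cohomologyMap M (chi R) :=
  (cohomologyMap_comp M φ ι).trans
    (cohomologyMap_congr M (koszul_projective R) (bar_isResolution R) _ _)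

theorem IsMinimalResolution.exists_hom_bar {P : BimodComplex F (QuadAlg R)}
    (hP : IsMinimalResolution (QuadAlg.wt R) P) : Nonempty (P.Hom (bar R)) :=
  BimodComplex.exists_hom hP.projective (bar_isResolution R)

end KoszulWeights

end QuadraticQuiver
end

theorem mainTheorem10 {F : Type w} {Q : Type u} [Field F] [Quiver.{v} Q] [Fintype Q]
    [∀ i j : Q, Fintype (i ⟶ j)] (R : QuadraticRelations F Q) :
    -- graded minimal projective resolutions `P` of `A` exist
    (∃ P : BimodComplex F (QuadAlg R),
      IsMinimalResolution (QuadAlg.wt R) P) ∧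
    -- they contain `K(A)` in a unique way, which is the identity in degrees 0, 1, 2
    (∀ P : BimodComplex F (QuadAlg R),
      IsMinimalResolution (QuadAlg.wt R) P →
      (∃! ι : (koszulComplex R).Hom P, ι.IsHomogeneous) ∧
      (∀ ι : (koszulComplex R).Hom P, ι.IsHomogeneous →
        ∀ p ≤ 2, Function.Bijective (ι.f p)) ∧
      Nonempty (P.Hom (bar R))) ∧
    -- the comparison of Koszul and Hochschild (co)homology in degree 2
    (∀ (M : Type y) [AddCommGroup M] [Module F M]
      [Module (Env F (QuadAlg R)) M]
      [IsScalarTower F (Env F (QuadAlg R)) M],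
      Function.Surjective (homologyMap M (chi R)) ∧
      Function.Injective (cohomologyMap M (chi R)) ∧
      ∀ P : BimodComplex F (QuadAlg R),
        IsMinimalResolution (QuadAlg.wt R) P →
        ∀ ι : (koszulComplex R).Hom P, ι.IsHomogeneous →
        -- `P` and `B(A)` compute the same (co)homology, and `ι` and `χ` induce the same maps
        (∀ φ : P.Hom (bar R),
          Function.Bijective (homologyMap M φ) ∧
          homologyMap M φ ∘ₗ homologyMap M ι =
            homologyMap M (chi R) ∧
          Function.Bijective (cohomologyMap M φ) ∧
          cohomologyMap M ι ∘ₗ cohomologyMap M φ =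
            cohomologyMap M (chi R)) ∧
        Function.Surjective (homologyMap M ι) ∧
        Function.Injective (cohomologyMap M ι) ∧
        -- the kernel in homology
        (∃ e : (((boundaries M P).comap (chainMap M ι)) ⧸
            (boundaries M (koszulComplex R)).submoduleOf
              ((boundaries M P).comap (chainMap M ι))) ≃ₗ[F]
            (homologyMap M ι).ker,
          ∀ z : (boundaries M P).comap (chainMap M ι),
            ∃ hz : z.1 ∈ cycles M (koszulComplex R),
              (e (Submodule.Quotient.mk z)).1 = homologyClass M ⟨z.1, hz⟩) ∧
        -- the image in cohomology
        (∃ e : (((cocycles M P).map (cochainMap M ι)) ⧸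
            (coboundaries M (koszulComplex R)).submoduleOf
              ((cocycles M P).map (cochainMap M ι))) ≃ₗ[F]
            (cohomologyMap M ι).range,
          ∀ f : (cocycles M P).map (cochainMap M ι),
            ∃ hf : f.1 ∈ cocycles M (koszulComplex R),
              (e (Submodule.Quotient.mk f)).1 = cohomologyClass M ⟨f.1, hf⟩)) ∧
    -- coefficients in `A`, homology
    (∀ r : ℕ, r = 0 ∨ r = 1 →
      Set.BijOn (homologyMap (QuadAlg R) (chi R))
        (koszulHomologyWt R r)
        (homologyWt (QuadAlg.wt R) (bar R)
          (r + 2)) ∧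
      ∀ P : BimodComplex F (QuadAlg R),
        IsMinimalResolution (QuadAlg.wt R) P →
        ∀ ι : (koszulComplex R).Hom P, ι.IsHomogeneous →
        Set.BijOn (homologyMap (QuadAlg R) ι)
          (koszulHomologyWt R r)
          (homologyWt (QuadAlg.wt R) P (r + 2))) ∧
    -- coefficients in `A`, cohomology
    (FiniteDimensional F (QuadAlg R) →
      ∀ N : ℕ, IsGreatest {m : ℕ | QuadAlg.wt R m ≠ ⊥} N →
      ∀ r : ℤ, r = N ∨ r = N - 1 →
      Set.BijOn
        (cohomologyMap (QuadAlg R) (chi R))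
        (cohomologyWt (QuadAlg.wt R) (bar R)
          (r - 2))
        (koszulCohomologyWt R r) ∧
      ∀ P : BimodComplex F (QuadAlg R),
        IsMinimalResolution (QuadAlg.wt R) P →
        ∀ ι : (koszulComplex R).Hom P, ι.IsHomogeneous →
        Set.BijOn (cohomologyMap (QuadAlg R) ι)
          (cohomologyWt (QuadAlg.wt R) P (r - 2))
          (koszulCohomologyWt R r)) := by
  have hmin := minRes_isMinimalResolution R
  have hbar := bar_isResolution R
  have hbarp := bar_projective R
  -- One minimal resolution with its morphisms φ₀ and ι₀ is fixed; the assertions on χ are deduced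
  -- from the factorization of its maps through those of φ₀ and ι₀.
  obtain ⟨φ₀⟩ := hmin.exists_hom_bar
  obtain ⟨ι₀, hι₀⟩ := hmin.exists_homogeneous
  refine ⟨⟨_, hmin⟩, fun P hP => ⟨?_, fun ι hι p hp => hP.bijective hι hp, hP.exists_hom_bar⟩,
    ?_, ?_, ?_⟩
  · obtain ⟨ι, hι⟩ := hP.exists_homogeneous
    exact ⟨ι, hι, fun κ hκ => hP.hom_ext hκ hι⟩
  · intro M _ _ _ _
    have key (P : BimodComplex F (QuadAlg R)) (hP : IsMinimalResolution (QuadAlg.wt R) P)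
        (φ : P.Hom (bar R)) : Function.Bijective (homologyMap M φ) ∧
          Function.Bijective (cohomologyMap M φ) :=
      ⟨homologyMap_bijective M hP.projective hbarp hP.isResolution hbar φ,
        cohomologyMap_bijective M hP.projective hbarp hP.isResolution hbar φ⟩
    refine ⟨?_, ?_, fun P hP ι hι => ⟨fun φ => ⟨(key P hP φ).1, homologyMap_comp_eq_chi M φ ι,
      (key P hP φ).2, cohomologyMap_comp_eq_chi M φ ι⟩, ?_, ?_, ?_, ?_⟩⟩
    · rw [← homologyMap_comp_eq_chi M φ₀ ι₀]
      exact (key _ hmin φ₀).1.2.comp (homologyMap_surjective_of_bijective M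
        (hmin.bijective_one hι₀) (hmin.bijective_two hι₀))
    · rw [← cohomologyMap_comp_eq_chi M φ₀ ι₀]
      exact (cohomologyMap_injective_of_bijective M
        (hmin.bijective_one hι₀) (hmin.bijective_two hι₀)).comp (key _ hmin φ₀).2.1
    · exact homologyMap_surjective_of_bijective M (hP.bijective_one hι) (hP.bijective_two hι)
    · exact cohomologyMap_injective_of_bijective M (hP.bijective_one hι) (hP.bijective_two hι)
    · exact exists_ker_homologyMap_equiv M (hP.bijective_one hι)
    · exact exists_range_cohomologyMap_equiv M
  · intro r hr
    have hr' : r ≤ 1 := by omega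
    refine ⟨?_, fun P hP ι hι => hP.bijOn_koszulHomologyWt hι hr'⟩
    rw [← homologyMap_comp_eq_chi (QuadAlg R) φ₀ ι₀]
    exact (homologyMap_bijOn (QuadAlg.isInternal_wt R) hmin.projective hbarp hmin.isResolution
      hbar hmin.isGraded (bar_isGradedComplex R) φ₀ (r + 2)).comp
      (hmin.bijOn_koszulHomologyWt hι₀ hr')
  · intro _ N hN r hr
    have hr' : N - 1 ≤ r := by omega
    refine ⟨?_, fun P hP ι hι => hP.bijOn_koszulCohomologyWt hι hN hr'⟩
    rw [← cohomologyMap_comp_eq_chi (QuadAlg R) φ₀ ι₀]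
    exact (hmin.bijOn_koszulCohomologyWt hι₀ hN hr').comp
      (cohomologyMap_bijOn (QuadAlg.isInternal_wt R) hmin.projective hbarp hmin.isResolution
        hbar hmin.isGraded (bar_isGradedComplex R) φ₀ (r - 2))
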